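/- Let $0<p<4$ and $\omega\in\mathbb R$ with $|\omega|=\sqrt{p/4}$. For $|\lambda|<1$ let $\phi_\lambda$ be the ground state, i.e. the positive even $H^1(\mathbb R)$-solution of $-\phi''+(1-\lambda^2)\phi-\phi^{p+1}=0$, and put $\overrightarrow{\Phi_\lambda}=(\phi_\lambda,-\lambda\phi_\lambda)^T$, $\overrightarrow{\Psi_\lambda}=(\phi_\lambda,0)^T$ and $\overrightarrow{\Gamma_\lambda}=(\gamma_\lambda,0)^T$ with $\gamma_\lambda(x)=\int_0^x\phi_\lambda$, so that $\partial_x\overrightarrow{\Gamma_\lambda}=\overrightarrow{\Psi_\lambda}$. Let $Q(u,v)=\int_{\mathbb R}uv\,dx$ and $$U_\varepsilon(\overrightarrow{\Phi_\omega})=\Big\{\vec u\in H^1(\mathbb R)\times L^2(\mathbb R):\ \inf_{y\in\mathbb R}\|\vec u-\overrightarrow{\Phi_\omega}(\cdot-y)\|_{H^1\times L^2}<\varepsilon\Big\}.$$ There is a constant $C>0$ (depending only on $p$ and $\omega$) such that for every $K>0$ there is $\varepsilon_0>0$ with the following property for every $\varepsilon\in(0,\varepsilon_0)$. Let $I\ni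 0$ be an open time interval (for instance $I=\mathbb R$) and let $\vec u=(u,v)^T\in C(I;H^1(\mathbb R)\times L^2(\mathbb R))$ be a (distributional) solution of $$u_t=v_x,\qquad v_t=(-u_{xx}+u-|u|^pu)_x$$ with $\vec u(0)=\vec u_0$ and $\vec u(t)\in U_\varepsilon(\overrightarrow{\Phi_\omega})$ for all $t\in I$. Let $y:I\to\mathbb R$ and $\lambda:I\to(-1,1)$ be $C^1$ functions such that the remainder $$\vec\eta(t)=\vec u(t,\cdot+y(t))-\overrightarrow{\Phi_{\lambda(t)}}$$ satisfies, for all $t\in I$, the orthogonality conditions $\langle\vec\eta(t),\overrightarrow{\Gamma_{\lambda(t)}}\rangle=\langle\vec\eta(t),\overrightarrow{\Psi_{\lambda(t)}}\rangle=0$ and the bound $\|\vec\eta(t)\|_{H^1\times L^2}+|\lambda(t)-\omega|\le K\varepsilon$. Here $\langle\vec f,\vec g\rangle=\int_{\mathbb R}\vec f\cdot\vec g\,dx$, where the pairing with the bounded function $\overrightarrow{\Gamma_\lambda}$ is the improper integral $\lim_{R\to\infty}\int_{-R}^R$, whose convergence is part of the condition. Then, for all $t\in I$, $$\Big|\dot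 y-\lambda-\|\phi_\lambda\|_{L^2}^{-2}\big[Q(\overrightarrow{\Phi_\lambda})-Q(\overrightarrow{\Phi_\omega})\big]+\|\phi_\lambda\|_{L^2}^{-2}\big[Q(\vec u_0)-Q(\overrightarrow{\Phi_\omega})\big]\Big|\le C\big(\|\vec\eta\|_{H^1\times L^2}^2+|\lambda-\omega|\,\|\vec\eta\|_{H^1\times L^2}\big)$$ and $$|\dot\lambda|\le C\|\vec\eta\|_{H^1\times L^2}.$$ -/

import Mathlib

open Filter Topology MeasureTheory Set
open scoped ENNReal

noncomputable section

namespace Boussinesq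

/-- Smooth compactly supported functions on the line. -/
def IsTestFunction (ψ : ℝ → ℝ) : Prop :=
  ContDiff ℝ (⊤ : ℕ∞) ψ ∧ HasCompactSupport ψ

/-- The real Hilbert space `L²(ℝ)`. -/
abbrev L2 : Type := Lp ℝ 2 (volume : Measure ℝ)

/-- `g` is the weak derivative of `f`. -/
def HasWeakDeriv (f g : L2) : Prop :=
  ∀ ψ : ℝ → ℝ, IsTestFunction ψ → (∫ x, f x * deriv ψ x) = -∫ x, g x * ψ x

theorem IsTestFunction.memLp {ψ : ℝ → ℝ} (h : IsTestFunction ψ) : MemLp ψ 2 volume :=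
  h.1.continuous.memLp_of_hasCompactSupport h.2

theorem IsTestFunction.memLp_deriv {ψ : ℝ → ℝ} (h : IsTestFunction ψ) :
    MemLp (deriv ψ) 2 volume :=
  (h.1.continuous_deriv (by simp)).memLp_of_hasCompactSupport h.2.deriv

theorem integral_add_mul (f g : L2) {ψ : ℝ → ℝ} (h : MemLp ψ 2 volume) :
    ∫ x, (f + g : L2) x * ψ x = (∫ x, f x * ψ x) + ∫ x, g x * ψ x := by
  have hf : Integrable (fun x => f x * ψ x) := (Lp.memLp f).integrable_mul h
  have hg : Integrable (fun x => g x * ψ x) := (Lp.memLp g).integrable_mul h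
  rw [← integral_add hf hg]
  refine integral_congr_ae ?_
  filter_upwards [Lp.coeFn_add f g] with x hx
  rw [hx, Pi.add_apply, add_mul]

theorem integral_smul_mul (c : ℝ) (f : L2) (ψ : ℝ → ℝ) :
    ∫ x, (c • f : L2) x * ψ x = c * ∫ x, f x * ψ x := by
  rw [← integral_const_mul]
  refine integral_congr_ae ?_
  filter_upwards [Lp.coeFn_smul c f] with x hx
  simp [hx, mul_assoc]

/-- The Sobolev space `H¹(ℝ)`: pairs `(f, ∂ₓf)` of an `L²` function and its weak derivative. The
norm inherited from the Hilbert product is `(‖f‖² + ‖∂ₓf‖²)^{1/2}`. -/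
def H1 : Submodule ℝ (WithLp 2 (L2 × L2)) where
  carrier := {w | HasWeakDeriv w.fst w.snd}
  add_mem' := by
    intro a b ha hb ψ hψ
    have h1 := integral_add_mul a.fst b.fst hψ.memLp_deriv
    have h2 := integral_add_mul a.snd b.snd hψ.memLp
    rw [WithLp.add_fst, WithLp.add_snd, h1, h2, ha ψ hψ, hb ψ hψ]
    ring
  zero_mem' := by
    intro ψ hψ
    have h1 := integral_smul_mul 0 (0 : L2) (deriv ψ)
    have h2 := integral_smul_mul 0 (0 : L2) ψ
    rw [zero_smul, zero_mul] at h1 h2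
    rw [WithLp.zero_fst, WithLp.zero_snd, h1, h2, neg_zero]
  smul_mem' := by
    intro c a ha ψ hψ
    rw [WithLp.smul_fst, WithLp.smul_snd, integral_smul_mul, integral_smul_mul, ha ψ hψ]
    ring

/-- The energy space `H¹(ℝ) × L²(ℝ)`, with the norm `(‖u‖_{H¹}² + ‖v‖_{L²}²)^{1/2}`. -/
abbrev EnergySpace : Type := WithLp 2 (H1 × L2)

/-- The component `u` of `w = (u, v)`. -/
def uComp (w : EnergySpace) : ℝ → ℝ := (w.fst : WithLp 2 (L2 × L2)).fst

/-- The weak derivative `∂ₓu` of the component `u` of `w = (u, v)`. -/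
def uxComp (w : EnergySpace) : ℝ → ℝ := (w.fst : WithLp 2 (L2 × L2)).snd

/-- The component `v` of `w = (u, v)`. -/
def vComp (w : EnergySpace) : ℝ → ℝ := w.snd

/-- The element `w` of the energy space is the (class of the) pair of functions `(f, g)`. -/
def Represents (w : EnergySpace) (f g : ℝ → ℝ) : Prop :=
  uComp w =ᵐ[volume] f ∧ vComp w =ᵐ[volume] g

/-- The ground state of wave speed `c`: the positive even `H¹` solution of
`-φ'' + (1 - c²) φ - φ^{p+1} = 0`. -/
structure IsGroundState (p c : ℝ) (φ : ℝ → ℝ) : Prop where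
  contDiff : ContDiff ℝ 2 φ
  pos : ∀ x, 0 < φ x
  even : ∀ x, φ (-x) = φ x
  memLp : MemLp φ 2 volume
  memLp_deriv : MemLp (deriv φ) 2 volume
  equation : ∀ x, -deriv (deriv φ) x + (1 - c ^ 2) * φ x - φ x ^ (p + 1) = 0

/-- The neighbourhood `U_ε(Φ_ω)` of the orbit of `Φ_ω = (φ, -ω φ)`, where `φ = φ_ω`. The infimum
over translations `y` of the `H¹ × L²` distance of `w` to `Φ_ω(· - y)` is less than `ε` exactly
when the distance is less than `ε` for one of them. -/
def orbitNhd (ω : ℝ) (φ : ℝ → ℝ) (ε : ℝ) : Set EnergySpace :=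
  {w | ∃ (y : ℝ) (z : EnergySpace),
    Represents z (fun x => φ (x - y)) (fun x => -ω * φ (x - y)) ∧ ‖w - z‖ < ε}

/-- The momentum `Q(u, v) = ∫ u v`. -/
def momentum (u v : ℝ → ℝ) : ℝ := ∫ x, u x * v x

/-- `H¹ × L²` solutions, on the time interval `I`, of the system
`u_t = v_x`, `v_t = (-u_xx + u - |u|^p u)_x`: continuous curves in the energy space which satisfy
the equations in the sense of distributions. -/
def IsSolution (p : ℝ) (I : Set ℝ) (w : ℝ → EnergySpace) : Prop :=
  ContinuousOn w I ∧
  ∀ ψ : ℝ → ℝ, IsTestFunction ψ → ∀ t ∈ I,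
    HasDerivAt (fun s => ∫ x, uComp (w s) x * ψ x)
      (-∫ x, vComp (w t) x * deriv ψ x) t ∧
    HasDerivAt (fun s => ∫ x, vComp (w s) x * ψ x)
      (-(∫ x, uxComp (w t) x * deriv (deriv ψ) x)
        - ∫ x, (uComp (w t) x - |uComp (w t) x| ^ p * uComp (w t) x) * deriv ψ x) t

/-- The odd primitive `γ(x) = ∫_0^x φ` of an even function `φ`. -/
def oddPrimitive (φ : ℝ → ℝ) (x : ℝ) : ℝ := ∫ s in (0 : ℝ)..x, φ s

/-- The orthogonality conditions `⟨η, Ψ⟩ = 0` and `⟨η, Γ⟩ = 0` for `Ψ = (φ, 0)` and `Γ = (γ, 0)`,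
where `γ` is the odd primitive of `φ`. As `γ` is bounded but not square integrable, the second
pairing is the improper integral `lim_{R → ∞} ∫_{-R}^R ξ γ`, with `ξ` the first component of
`η`. -/
def IsOrthogonal (φ : ℝ → ℝ) (η : EnergySpace) : Prop :=
  (∫ x, uComp η x * φ x) = 0 ∧
  Tendsto (fun R : ℝ => ∫ x in (-R)..R, uComp η x * oddPrimitive φ x) atTop (𝓝 0)

/-- Modulation parameters `y`, `l` and remainder `η` of the curve `w` on the time interval `I`, for
a family `φ l` of profiles: `y` and `l` are `C¹`, `η(t) = w(t, · + y(t)) - Φ_{l(t)}` with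
`Φ_l = (φ_l, -l φ_l)`, and `η(t)` satisfies the orthogonality conditions at speed `l(t)`. -/
structure IsModulation (φ : ℝ → ℝ → ℝ) (I : Set ℝ) (w : ℝ → EnergySpace)
    (y l : ℝ → ℝ) (η : ℝ → EnergySpace) : Prop where
  contDiffOn_y : ContDiffOn ℝ 1 y I
  contDiffOn_l : ContDiffOn ℝ 1 l I
  speed_mem : ∀ t ∈ I, l t ∈ Ioo (-1 : ℝ) 1
  remainder : ∀ t ∈ I, Represents (η t)
    (fun x => uComp (w t) (x + y t) - φ (l t) x)
    (fun x => vComp (w t) (x + y t) - -(l t) * φ (l t) x)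
  orthogonal : ∀ t ∈ I, IsOrthogonal (φ (l t)) (η t)

end Boussinesq

end

noncomputable section

namespace Boussinesq

open scoped RealInnerProductSpace

/-! Ground states are explicit: φ_λ(x) = A P(bx) with P = cosh^{-q}, q = 2/p, b = (p/2)√(1-λ²), A =
κ b^q and κ depending on p alone (`IsGroundState.eq_prof`). With G the odd primitive of P,
orthogonality to Ψ_λ and Γ_λ is orthogonality to P(b·) and G(b·), so modulating λ amounts to
dilating fixed profiles. Write η = (ξ, ζ), σ = ‖P‖², N = ‖φ_λ‖² = A²σ/b.

Differentiating the two orthogonality conditions in time, with the equation u_t = v_x only, gives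
the modulation equations (`IsModulation.equations`). The condition on Ψ_λ reads ⟨u(· + y), P(b·)⟩ =
κσ b^{q-1}, and its derivative is b'(κσ(q - 1/2) b^{q-2} + O(‖η‖)) = O((1 + |y'|)‖η‖). Since p < 4
means q > 1/2, this yields b' = O(‖η‖), and bb' = -(p²/4)λλ' with λ away from 0 yields λ' = O(‖η‖).
The condition on Γ_λ gives (y' - λ)Aσ = -b⟨ζ, P(b·)⟩ + b'⟨ξ, xP(b·)⟩.

The term ⟨ζ, P(b·)⟩ is linear in η, but it is also the only linear term of the momentum: Q(u) =
Q(Φ_λ) + A⟨ζ, P(b·)⟩ + ⟨ξ, ζ⟩, because ξ is orthogonal to P(b·). As Q is conserved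
(`IsSolution.momentum_eq`), it can be eliminated, and what remains of the left-hand side is exactly
N⁻¹(⟨ξ, ζ⟩ + (A/b) b'⟨ξ, xP(b·)⟩), which is quadratic in η (`modulation_speed_identity`).

Two points need analysis. The solution is only weak: averages over short intervals turn ∂ₓ into a
bounded difference quotient, the computations are made on averaged curves, and locally uniform
bounds or dominated convergence justify the limit. And G is not square integrable: it is cut off by
exp(-εx²), Abel's theorem turns the improper orthogonality into Gaussian summability, and the cutoff
is removed after differentiating (`IsTransported.stationary`). -/

theorem inner_eq_integral (f g : L2) : ⟪f, g⟫ = ∫ x, f x * g x := by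
  rw [L2.inner_def]
  refine integral_congr_ae (Eventually.of_forall fun x => ?_)
  simp [mul_comm]

theorem inner_toLp (f : L2) {g : ℝ → ℝ} (hg : MemLp g 2 volume) :
    ⟪f, hg.toLp g⟫ = ∫ x, f x * g x := by
  rw [inner_eq_integral]
  refine integral_congr_ae ?_
  filter_upwards [hg.coeFn_toLp] with x hx
  rw [hx]

theorem eq_of_forall_test {f g : L2}
    (h : ∀ ψ : ℝ → ℝ, IsTestFunction ψ → ∫ x, f x * ψ x = ∫ x, g x * ψ x) : f = g := by
  rw [← sub_eq_zero]
  apply Lp.ext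
  have key : ∀ᵐ x, (f - g : L2) x = 0 := by
    refine ae_eq_zero_of_integral_contDiff_smul_eq_zero
      ((Lp.memLp (f - g)).locallyIntegrable (by norm_num)) fun ψ h1 h2 => ?_
    have hψ : IsTestFunction ψ := ⟨h1, h2⟩
    have := h ψ hψ
    rw [← inner_toLp f hψ.memLp, ← inner_toLp g hψ.memLp, ← sub_eq_zero, ← inner_sub_left,
      inner_toLp] at this
    simpa [mul_comm] using this
  filter_upwards [key, Lp.coeFn_zero ℝ 2 (volume : Measure ℝ)] with x hx h0
  rw [hx, h0, Pi.zero_apply]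

/-! ### Translations, difference quotients and averages on `L²` -/

/-- Translation `f ↦ f(· + s)` on `L²(ℝ)`. -/
def trans (s : ℝ) : L2 →ₗᵢ[ℝ] L2 :=
  Lp.compMeasurePreservingₗᵢ ℝ (fun x => x + s) (measurePreserving_add_right volume s)

theorem coeFn_trans (s : ℝ) (f : L2) : trans s f =ᵐ[volume] fun x => f (x + s) :=
  Lp.coeFn_compMeasurePreserving f (measurePreserving_add_right volume s)

theorem continuous_trans (f : L2) : Continuous fun s => trans s f := by
  let g : C(ℝ, C(ℝ, ℝ)) := (ContinuousMap.mk (fun a : ℝ × ℝ => a.2 + a.1) (by fun_prop)).curry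
  exact (continuous_const (y := f)).compMeasurePreservingLp g.continuous
    (fun s => measurePreserving_add_right volume s) (by norm_num)

theorem inner_trans_left (s : ℝ) (f g : L2) : ⟪trans s f, g⟫ = ⟪f, trans (-s) g⟫ := by
  rw [inner_eq_integral, inner_eq_integral]
  have h1 : ∫ x, trans s f x * g x = ∫ x, f (x + s) * g x := by
    refine integral_congr_ae ?_
    filter_upwards [coeFn_trans s f] with x hx
    rw [hx]
  have h2 : ∫ x, f x * trans (-s) g x = ∫ x, f x * g (x + -s) := by
    refine integral_congr_ae ?_
    filter_upwards [coeFn_trans (-s) g] with x hx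
    rw [hx]
  rw [h1, h2, ← integral_add_right_eq_self (fun x => f x * g (x + -s)) s]
  simp

theorem trans_trans (s r : ℝ) (f : L2) : trans s (trans r f) = trans (s + r) f := by
  apply Lp.ext
  have h := (measurePreserving_add_right (volume : Measure ℝ) s).quasiMeasurePreserving.ae
    (coeFn_trans r f)
  filter_upwards [coeFn_trans s (trans r f), coeFn_trans (s + r) f, h] with x h1 h2 h3
  rw [h1, h2, h3, add_assoc]

/-- The symmetric difference quotient with step `h`. -/
def diffQuot (h : ℝ) : L2 →L[ℝ] L2 :=
  (2 * h)⁻¹ • ((trans h).toContinuousLinearMap - (trans (-h)).toContinuousLinearMap)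

theorem diffQuot_apply (h : ℝ) (f : L2) :
    diffQuot h f = (2 * h)⁻¹ • (trans h f - trans (-h) f) := rfl

theorem coeFn_diffQuot (h : ℝ) (f : L2) :
    diffQuot h f =ᵐ[volume] fun x => (2 * h)⁻¹ * (f (x + h) - f (x - h)) := by
  rw [diffQuot_apply]
  filter_upwards [Lp.coeFn_smul (2 * h)⁻¹ (trans h f - trans (-h) f),
    Lp.coeFn_sub (trans h f) (trans (-h) f), coeFn_trans h f, coeFn_trans (-h) f] with x h1 h2 h3 h4
  rw [h1, Pi.smul_apply, h2, Pi.sub_apply, h3, h4, smul_eq_mul, sub_eq_add_neg x h]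

theorem inner_diffQuot_left (h : ℝ) (f g : L2) : ⟪diffQuot h f, g⟫ = -⟪f, diffQuot h g⟫ := by
  simp only [diffQuot_apply, inner_smul_left, inner_smul_right, inner_sub_left, inner_sub_right,
    inner_trans_left, neg_neg]
  simp
  ring

theorem intervalIntegrable_trans (h : ℝ) (f : L2) :
    IntervalIntegrable (fun s => trans (h * s) f) volume (-1) 1 :=
  ((continuous_trans f).comp (continuous_const_mul h)).intervalIntegrable _ _

/-- The average of the translates `f(· + s)` over `|s| ≤ h`. -/
def avg (h : ℝ) : L2 →L[ℝ] L2 :=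
  LinearMap.mkContinuous
    { toFun := fun f => (2 : ℝ)⁻¹ • ∫ s in (-1 : ℝ)..1, trans (h * s) f
      map_add' := fun f g => by
        simp only [map_add]
        rw [intervalIntegral.integral_add (intervalIntegrable_trans h f)
          (intervalIntegrable_trans h g), smul_add]
      map_smul' := fun c f => by
        simp only [map_smul]
        rw [intervalIntegral.integral_smul, smul_comm]
        rfl } 1 (fun f => by
      have : ‖∫ s in (-1 : ℝ)..1, trans (h * s) f‖ ≤ ‖f‖ * |1 - (-1)| :=
        intervalIntegral.norm_integral_le_of_norm_le_const fun s _ => by simp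
      rw [LinearMap.coe_mk, AddHom.coe_mk, norm_smul]
      norm_num at this ⊢
      linarith)

theorem avg_apply (h : ℝ) (f : L2) :
    avg h f = (2 : ℝ)⁻¹ • ∫ s in (-1 : ℝ)..1, trans (h * s) f := rfl

theorem norm_avg_le (h : ℝ) (f : L2) : ‖avg h f‖ ≤ ‖f‖ := by
  have : ‖avg h‖ ≤ 1 := LinearMap.mkContinuous_norm_le _ zero_le_one _
  simpa using (avg h).le_of_opNorm_le this f

/-- Since the translates are parametrised by `h * s` with `s` in a fixed interval, `h = 0` is
allowed and gives the identity. Continuity at `0` is therefore the approximation property of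
averages. -/
theorem continuous_avg (f : L2) : Continuous fun h => avg h f := by
  have := intervalIntegral.continuous_parametric_intervalIntegral_of_continuous'
    (μ := volume) (f := fun h s : ℝ => trans (h * s) f)
    ((continuous_trans f).comp continuous_mul) (-1) 1
  exact this.const_smul (2 : ℝ)⁻¹

theorem avg_zero (f : L2) : avg 0 f = f := by
  have h0 : trans 0 f = f := by
    apply Lp.ext
    filter_upwards [coeFn_trans 0 f] with x hx
    rw [hx, add_zero]
  rw [avg_apply]
  simp only [zero_mul, h0, intervalIntegral.integral_const, smul_smul]
  norm_num

theorem inner_avg (h : ℝ) (f g : L2) :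
    ⟪avg h f, g⟫ = 2⁻¹ * ∫ s in (-1 : ℝ)..1, ⟪trans (h * s) f, g⟫ := by
  rw [avg_apply, inner_smul_left, real_inner_comm]
  have := (innerSL ℝ g).intervalIntegral_comp_comm (intervalIntegrable_trans h f)
  simp only [innerSL_apply_apply] at this
  rw [← this]
  simp [real_inner_comm]

theorem inner_avg_left (h : ℝ) (f g : L2) : ⟪avg h f, g⟫ = ⟪f, avg h g⟫ := by
  rw [inner_avg, real_inner_comm, inner_avg]
  have := intervalIntegral.integral_comp_neg (a := -1) (b := 1) fun s => ⟪trans (h * s) g, f⟫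
  rw [neg_neg] at this
  rw [← this]
  congr 2
  funext s
  rw [inner_trans_left, real_inner_comm, mul_neg]

theorem avg_trans (h r : ℝ) (f : L2) : avg h (trans r f) = trans r (avg h f) := by
  rw [avg_apply, avg_apply, map_smul]
  have := (trans r).toContinuousLinearMap.intervalIntegral_comp_comm (intervalIntegrable_trans h f)
  simp only [LinearIsometry.coe_toContinuousLinearMap] at this
  rw [← this]
  simp only [trans_trans, add_comm]

theorem avg_diffQuot (h : ℝ) (f : L2) : avg h (diffQuot h f) = diffQuot h (avg h f) := by
  simp only [diffQuot_apply, map_smul, map_sub, avg_trans]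

/-- The average of a function over the interval `[x - h, x + h]`. -/
def avgFun (h : ℝ) (f : ℝ → ℝ) (x : ℝ) : ℝ := 2⁻¹ * ∫ s in (-1 : ℝ)..1, f (x + h * s)

theorem avgFun_eq {h : ℝ} (hh : h ≠ 0) (f : ℝ → ℝ) (x : ℝ) :
    avgFun h f x = (2 * h)⁻¹ * ∫ s in (x - h)..(x + h), f s := by
  rw [avgFun, intervalIntegral.integral_comp_add_mul (fun s => f s) hh]
  simp only [smul_eq_mul, mul_neg, mul_one, ← sub_eq_add_neg]
  field_simp

theorem avgFun_eq_sub {h : ℝ} (hh : h ≠ 0) {f : ℝ → ℝ} (hf : LocallyIntegrable f) (x : ℝ) :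
    avgFun h f x = (2 * h)⁻¹ * ((∫ s in (0 : ℝ)..(x + h), f s) - ∫ s in (0 : ℝ)..(x - h), f s) := by
  have hi : ∀ a b, IntervalIntegrable f volume a b := fun a b =>
    (intervalIntegrable_iff').2 (hf.integrableOn_isCompact isCompact_uIcc)
  rw [avgFun_eq hh, intervalIntegral.integral_interval_sub_left (hi _ _) (hi _ _)]

theorem continuous_avgFun {h : ℝ} (hh : h ≠ 0) {f : ℝ → ℝ} (hf : LocallyIntegrable f) :
    Continuous (avgFun h f) := by
  have hi : ∀ a b, IntervalIntegrable f volume a b := fun a b =>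
    (intervalIntegrable_iff').2 (hf.integrableOn_isCompact isCompact_uIcc)
  have hc := intervalIntegral.continuous_primitive hi 0
  rw [funext (avgFun_eq_sub hh hf)]
  exact ((hc.comp (continuous_add_const h)).sub (hc.comp
    (continuous_id.sub continuous_const))).const_mul _

theorem hasDerivAt_avgFun {h : ℝ} (hh : h ≠ 0) {f : ℝ → ℝ} (hf : Continuous f) (x : ℝ) :
    HasDerivAt (avgFun h f) ((2 * h)⁻¹ * (f (x + h) - f (x - h))) x := by
  rw [funext (avgFun_eq_sub hh hf.locallyIntegrable)]
  have hd : ∀ z, HasDerivAt (fun z => ∫ s in (0 : ℝ)..z, f s) (f z) z := fun z =>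
    hf.integral_hasStrictDerivAt 0 z |>.hasDerivAt
  exact (((hd (x + h)).comp_add_const x h).sub ((hd (x - h)).comp_sub_const x h)).const_mul _

theorem integral_avg_mul (h : ℝ) (f : L2) {ψ : ℝ → ℝ} (hψ : IsTestFunction ψ) :
    ∫ x, avg h f x * ψ x = ∫ x, avgFun h f x * ψ x := by
  rw [← inner_toLp _ hψ.memLp, inner_avg]
  have h1 : ∀ s, ⟪trans (h * s) f, hψ.memLp.toLp ψ⟫ = ∫ x, f (x + h * s) * ψ x := by
    intro s
    rw [inner_toLp]
    refine integral_congr_ae ?_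
    filter_upwards [coeFn_trans (h * s) f] with x hx
    rw [hx]
  simp only [h1, avgFun]
  rw [intervalIntegral.integral_of_le (by norm_num)]
  -- `f` is only a class, so joint measurability of `f (x + h * s)` requires that the map `(s, x) ↦
  -- x + h * s` pull null sets back to null sets.
  have hmeas : AEStronglyMeasurable (Function.uncurry fun (s x : ℝ) => f (x + h * s) * ψ x)
      ((volume.restrict (Ioc (-1 : ℝ) 1)).prod volume) := by
    have hq : Measure.QuasiMeasurePreserving (fun z : ℝ × ℝ => z.2 + h * z.1)
        ((volume.restrict (Ioc (-1 : ℝ) 1)).prod volume) volume :=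
      QuasiMeasurePreserving.prod_of_right (by fun_prop) (Eventually.of_forall fun s =>
        (measurePreserving_add_right (volume : Measure ℝ) (h * s)).quasiMeasurePreserving)
    have := (Lp.aestronglyMeasurable f).comp_quasiMeasurePreserving hq
    exact this.mul (hψ.1.continuous.comp continuous_snd).aestronglyMeasurable
  have hint : Integrable (Function.uncurry fun (s x : ℝ) => f (x + h * s) * ψ x)
      ((volume.restrict (Ioc (-1 : ℝ) 1)).prod volume) := by
    rw [integrable_prod_iff hmeas]
    refine ⟨Eventually.of_forall fun s => ?_, ?_⟩
    · refine ((Lp.memLp (trans (h * s) f)).integrable_mul hψ.memLp).congr ?_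
      filter_upwards [coeFn_trans (h * s) f] with x hx
      simp [hx]
    -- The `x`-integral of the norm is a pairing with a translate of `|f|`, hence continuous in `s`.
    · have hc : Continuous fun s => ⟪trans (h * s) |f|, hψ.memLp.norm.toLp _⟫ :=
        ((continuous_trans |f|).comp (continuous_const_mul h)).inner continuous_const
      refine (hc.integrableOn_Icc.mono_set Ioc_subset_Icc_self).congr
        (Eventually.of_forall fun s => ?_)
      simp only [inner_toLp]
      refine integral_congr_ae ?_
      have e1 := (measurePreserving_add_right (volume : Measure ℝ)
        (h * s)).quasiMeasurePreserving.ae (Lp.coeFn_abs f)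
      filter_upwards [coeFn_trans (h * s) |f|, e1] with x hx h2
      simp [hx, h2]
  rw [integral_integral_swap hint, ← integral_const_mul]
  refine integral_congr_ae (Eventually.of_forall fun x => ?_)
  simp only
  rw [intervalIntegral.integral_of_le (by norm_num), integral_mul_const]
  ring

theorem coeFn_avg {h : ℝ} (hh : h ≠ 0) (f : L2) : avg h f =ᵐ[volume] avgFun h f := by
  have hli := (Lp.memLp f).locallyIntegrable (by norm_num)
  have hc := continuous_avgFun hh hli
  have key : ∀ᵐ x, avg h f x - avgFun h f x = 0 := by
    refine ae_eq_zero_of_integral_contDiff_smul_eq_zero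
      (((Lp.memLp (avg h f)).locallyIntegrable (by norm_num)).sub hc.locallyIntegrable)
      fun ψ h1 h2 => ?_
    have hψ : IsTestFunction ψ := ⟨h1, h2⟩
    have h3 : Integrable fun x => avg h f x * ψ x := (Lp.memLp _).integrable_mul hψ.memLp
    have h4 : Integrable fun x => avgFun h f x * ψ x :=
      (hc.mul h1.continuous).integrable_of_hasCompactSupport h2.mul_left
    have h5 := integral_avg_mul h f hψ
    rw [← sub_eq_zero, ← integral_sub h3 h4] at h5
    rw [← h5]
    refine integral_congr_ae (Eventually.of_forall fun x => ?_)
    simp only [smul_eq_mul]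
    ring
  filter_upwards [key] with x hx
  exact sub_eq_zero.1 hx

theorem IsTestFunction.avgFun {h : ℝ} (hh : h ≠ 0) {ψ : ℝ → ℝ} (hψ : IsTestFunction ψ) :
    IsTestFunction (avgFun h ψ) := by
  have hd := hasDerivAt_avgFun hh hψ.1.continuous
  constructor
  · rw [contDiff_infty_iff_deriv]
    refine ⟨fun x => (hd x).differentiableAt, ?_⟩
    rw [funext fun x => (hd x).deriv]
    exact contDiff_const.mul ((hψ.1.comp (contDiff_id.add contDiff_const)).sub
      (hψ.1.comp (contDiff_id.sub contDiff_const)))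
  · obtain ⟨R, hR⟩ := hψ.2.isCompact.isBounded.subset_closedBall 0
    refine HasCompactSupport.intro (isCompact_closedBall (0 : ℝ) (R + |h|)) fun x hx => ?_
    rw [Boussinesq.avgFun, intervalIntegral.integral_congr (g := fun _ => 0),
      intervalIntegral.integral_zero, mul_zero]
    intro s hs
    rw [uIcc_of_le (by norm_num), mem_Icc] at hs
    by_contra h0
    have h1 := hR (subset_tsupport _ h0)
    rw [mem_closedBall_zero_iff, Real.norm_eq_abs] at h1
    apply hx
    rw [mem_closedBall_zero_iff, Real.norm_eq_abs]
    have h2 : |h * s| ≤ |h| := by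
      rw [abs_mul]
      exact mul_le_of_le_one_right (abs_nonneg _) (abs_le.2 hs)
    calc |x| = |x + h * s - h * s| := by ring_nf
      _ ≤ |x + h * s| + |h * s| := abs_sub _ _
      _ ≤ R + |h| := add_le_add h1 h2

theorem toLp_avgFun {h : ℝ} (hh : h ≠ 0) {ψ : ℝ → ℝ} (hψ : IsTestFunction ψ) :
    (hψ.avgFun hh).memLp.toLp _ = avg h (hψ.memLp.toLp ψ) := by
  apply Lp.ext
  filter_upwards [(hψ.avgFun hh).memLp.coeFn_toLp, coeFn_avg hh (hψ.memLp.toLp ψ)] with x h1 h2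
  rw [h1, h2, Boussinesq.avgFun_eq hh, Boussinesq.avgFun_eq hh]
  congr 1
  refine intervalIntegral.integral_congr_ae ?_
  filter_upwards [hψ.memLp.coeFn_toLp] with s hs _
  rw [hs]

theorem toLp_deriv_avgFun {h : ℝ} (hh : h ≠ 0) {ψ : ℝ → ℝ} (hψ : IsTestFunction ψ) :
    (hψ.avgFun hh).memLp_deriv.toLp _ = diffQuot h (hψ.memLp.toLp ψ) := by
  apply Lp.ext
  have e1 := (measurePreserving_add_right (volume : Measure ℝ) h).quasiMeasurePreserving.ae
    hψ.memLp.coeFn_toLp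
  have e2 := (measurePreserving_sub_right (volume : Measure ℝ) h).quasiMeasurePreserving.ae
    hψ.memLp.coeFn_toLp
  filter_upwards [(hψ.avgFun hh).memLp_deriv.coeFn_toLp, coeFn_diffQuot h (hψ.memLp.toLp ψ),
    e1, e2] with x h1 h2 h3 h4
  rw [h1, h2, h3, h4, (hasDerivAt_avgFun hh hψ.1.continuous x).deriv]

/-- On `H¹`, the difference quotient is the average of the weak derivative. -/
theorem HasWeakDeriv.diffQuot_eq {f g : L2} (hfg : HasWeakDeriv f g) {h : ℝ} (hh : h ≠ 0) :
    diffQuot h f = avg h g := by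
  refine eq_of_forall_test fun ψ hψ => ?_
  -- An averaged test function has the difference quotient as its derivative. Both operators are
  -- then moved to the other side: the average is symmetric and the difference quotient skew.
  have h1 := hfg _ (hψ.avgFun hh)
  rw [← inner_toLp f (hψ.avgFun hh).memLp_deriv, ← inner_toLp g (hψ.avgFun hh).memLp,
    toLp_avgFun hh hψ, toLp_deriv_avgFun hh hψ] at h1
  rw [← inner_toLp _ hψ.memLp, ← inner_toLp _ hψ.memLp, inner_diffQuot_left, h1, neg_neg,
    inner_avg_left]

/-! ### Time derivatives of weak solutions -/

theorem exists_eventually_norm_le {E : Type*} [NormedAddCommGroup E] {I : Set ℝ} (hI : IsOpen I)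
    {X : ℝ → E} (hX : ContinuousOn X I) {t : ℝ} (ht : t ∈ I) :
    ∃ M : ℝ, 0 ≤ M ∧ ∀ᶠ s in 𝓝 t, ‖X s‖ ≤ M :=
  ⟨‖X t‖ + 1, by positivity,
    ((hX.continuousAt (hI.mem_nhds ht)).norm.eventually_lt continuousAt_const
      (lt_add_one _)).mono fun _ h => h.le⟩

/-- The device for removing a regularisation, be it an average (`h → 0`) or a Gaussian cutoff (`ε →
0`): derivatives that converge uniformly near a time pass to the limit. -/
theorem hasDerivAt_of_uniform_bound {ι : Type*} {l : Filter ι} [NeBot l] {F F' : ι → ℝ → ℝ}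
    {f f' : ℝ → ℝ} {δ : ι → ℝ} {s : Set ℝ} (hs : IsOpen s) (hδ : Tendsto δ l (𝓝 0))
    (hb : ∀ᶠ n in l, ∀ x ∈ s, |F' n x - f' x| ≤ δ n)
    (hd : ∀ᶠ n in l, ∀ x ∈ s, HasDerivAt (F n) (F' n x) x)
    (hp : ∀ x ∈ s, Tendsto (fun n => F n x) l (𝓝 (f x))) {x : ℝ} (hx : x ∈ s) :
    HasDerivAt f (f' x) x := by
  refine hasDerivAt_of_tendstoUniformlyOn (f' := F') hs ?_ hd hp hx
  rw [Metric.tendstoUniformlyOn_iff]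
  intro ε hε
  filter_upwards [hb, hδ.eventually (gt_mem_nhds hε)] with n h1 h2 z hz
  rw [dist_comm, Real.dist_eq]
  exact (h1 z hz).trans_lt h2

theorem hasDerivAt_inner_const {X : ℝ → L2} {X' : L2} {t : ℝ} (hX : HasDerivAt X X' t) (f : L2) :
    HasDerivAt (fun s => ⟪X s, f⟫) ⟪X', f⟫ t := by
  simpa using hX.inner ℝ (hasDerivAt_const t f)

/-- A curve in `L²` whose weak derivative is a continuous curve is differentiable in norm. -/
theorem hasDerivAt_of_weak {I : Set ℝ} (hI : IsOpen I) (hc : I.OrdConnected) {X W : ℝ → L2}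
    (hW : ContinuousOn W I)
    (h : ∀ ψ : ℝ → ℝ, IsTestFunction ψ → ∀ t ∈ I,
      HasDerivAt (fun s => ∫ x, X s x * ψ x) (∫ x, W t x * ψ x) t) {t : ℝ} (ht : t ∈ I) :
    HasDerivAt X (W t) t := by
  set Y : ℝ → L2 := fun r => ∫ s in t..r, W s with hY
  have hd : ∀ r ∈ I, HasDerivAt Y (W r) r := fun r hr =>
    intervalIntegral.integral_hasDerivAt_right
      ((hW.mono (hc.uIcc_subset ht hr)).intervalIntegrable)
      (hW.stronglyMeasurableAtFilter hI r hr) (hW.continuousAt (hI.mem_nhds hr))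
  have key : ∀ r ∈ I, X r = Y r + X t := by
    intro r hr
    refine eq_of_forall_test fun ψ hψ => ?_
    -- Tested against any `ψ`, the difference between `X` and the Bochner primitive of `W` has zero
    -- derivative, so it is constant on the interval.
    have hd2 : ∀ s ∈ I, HasDerivAt (fun s => (∫ x, X s x * ψ x) - ⟪Y s, hψ.memLp.toLp ψ⟫) 0 s := by
      intro s hs
      have h1 := (h ψ hψ s hs).sub (hasDerivAt_inner_const (hd s hs) (hψ.memLp.toLp ψ))
      rw [inner_toLp, sub_self] at h1
      exact h1
    have h2 := hI.is_const_of_deriv_eq_zero hc.isPreconnected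
      (fun s hs => (hd2 s hs).differentiableAt.differentiableWithinAt)
      (fun s hs => (hd2 s hs).deriv) hr ht
    have h3 : Y t = 0 := intervalIntegral.integral_same
    rw [← inner_toLp _ hψ.memLp, ← inner_toLp _ hψ.memLp, h3, inner_zero_left, sub_zero] at h2
    rw [← inner_toLp _ hψ.memLp, ← inner_toLp _ hψ.memLp, inner_add_left, ← h2]
    ring
  refine ((hd t ht).add_const (X t)).congr_of_eventuallyEq ?_
  filter_upwards [hI.mem_nhds ht] with r hr using key r hr

theorem hasWeakDeriv_toLp {f g : ℝ → ℝ} (hfg : ∀ x, HasDerivAt f (g x) x)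
    (hf : MemLp f 2 volume) (hg : MemLp g 2 volume) : HasWeakDeriv (hf.toLp f) (hg.toLp g) := by
  intro ψ hψ
  have e1 : ∫ x, hf.toLp f x * deriv ψ x = ∫ x, f x * deriv ψ x := by
    refine integral_congr_ae ?_
    filter_upwards [hf.coeFn_toLp] with x hx
    rw [hx]
  have e2 : ∫ x, hg.toLp g x * ψ x = ∫ x, g x * ψ x := by
    refine integral_congr_ae ?_
    filter_upwards [hg.coeFn_toLp] with x hx
    rw [hx]
  rw [e1, e2]
  exact integral_mul_deriv_eq_deriv_mul_of_integrable (fun x _ => hfg x)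
    (fun x _ => (hψ.1.differentiable (by simp) x).hasDerivAt)
    (hf.integrable_mul hψ.memLp_deriv) (hg.integrable_mul hψ.memLp) (hf.integrable_mul hψ.memLp)

/-- The curve `U` satisfies `∂ₜ U = ∂ₓ V` in the sense of distributions. -/
def IsTransported (I : Set ℝ) (U V : ℝ → L2) : Prop :=
  ContinuousOn U I ∧ ContinuousOn V I ∧
    ∀ ψ : ℝ → ℝ, IsTestFunction ψ → ∀ t ∈ I,
      HasDerivAt (fun s => ∫ x, U s x * ψ x) (-∫ x, V t x * deriv ψ x) t

/-- Testing with averaged functions replaces the unbounded `∂ₓ` by the bounded operator `diffQuot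
h`, so the right-hand side becomes a continuous curve in `L²`. -/
theorem IsTransported.hasDerivAt_avg {I : Set ℝ} {U V : ℝ → L2} (hUV : IsTransported I U V)
    (hI : IsOpen I) (hc : I.OrdConnected) {h : ℝ} (hh : h ≠ 0) {t : ℝ} (ht : t ∈ I) :
    HasDerivAt (fun s => avg h (U s)) (diffQuot h (V t)) t := by
  refine hasDerivAt_of_weak (X := fun s => avg h (U s)) (W := fun s => diffQuot h (V s)) hI hc
    ((diffQuot h).continuous.comp_continuousOn hUV.2.1) (fun ψ hψ s hs => ?_) ht
  have h1 := hUV.2.2 _ (hψ.avgFun hh) s hs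
  simp only [← inner_toLp _ (hψ.avgFun hh).memLp, ← inner_toLp _ (hψ.avgFun hh).memLp_deriv,
    toLp_avgFun hh hψ, toLp_deriv_avgFun hh hψ] at h1
  simpa only [← inner_toLp _ hψ.memLp, inner_avg_left, inner_diffQuot_left] using h1

/-- This enlarges the class of test functions from `C_c^∞` to `H¹`. The averaged derivative is `-⟪V,
avg h g⟫`; it converges uniformly near `t` because `V` is locally bounded and `avg h g → g` does not
involve time. -/
theorem IsTransported.hasDerivAt_inner {I : Set ℝ} {U V : ℝ → L2} (hUV : IsTransported I U V)
    (hI : IsOpen I) (hc : I.OrdConnected) {f g : L2} (hfg : HasWeakDeriv f g) {t : ℝ}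
    (ht : t ∈ I) : HasDerivAt (fun s => ⟪U s, f⟫) (-⟪V t, g⟫) t := by
  obtain ⟨M, hM, hV⟩ := exists_eventually_norm_le hI hUV.2.1 ht
  obtain ⟨J, hJ, hJo, htJ⟩ := eventually_nhds_iff.1 (hV.and (hI.mem_nhds ht))
  have hδ : Tendsto (fun h => M * ‖avg h g - g‖) (𝓝[≠] 0) (𝓝 0) := by
    have h1 : Tendsto (fun h => M * ‖avg h g - g‖) (𝓝 0) (𝓝 (M * ‖avg 0 g - g‖)) :=
      (((continuous_avg g).sub continuous_const).norm.const_mul M).tendsto 0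
    rw [avg_zero, sub_self, norm_zero, mul_zero] at h1
    exact h1.mono_left nhdsWithin_le_nhds
  refine hasDerivAt_of_uniform_bound (F := fun h s => ⟪avg h (U s), f⟫)
    (F' := fun h s => ⟪diffQuot h (V s), f⟫) (f' := fun s => -⟪V s, g⟫) hJo hδ ?_ ?_ ?_ htJ
  · filter_upwards [self_mem_nhdsWithin] with h hh s hs
    rw [inner_diffQuot_left, hfg.diffQuot_eq hh, neg_sub_neg, abs_sub_comm, ← inner_sub_right]
    exact (abs_real_inner_le_norm _ _).trans
      (mul_le_mul_of_nonneg_right (hJ s hs).1 (norm_nonneg _))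
  · filter_upwards [self_mem_nhdsWithin] with h hh s hs
    exact hasDerivAt_inner_const (hUV.hasDerivAt_avg hI hc hh (hJ s hs).2) f
  · intro s _
    have h1 := (((continuous_avg (U s)).inner (𝕜 := ℝ) (continuous_const (y := f))).tendsto 0).mono_left
      (nhdsWithin_le_nhds (s := {0}ᶜ))
    rwa [avg_zero] at h1

/-! ### Sobolev inequality and the nonlinearity -/

theorem norm_toLp_sq {f : ℝ → ℝ} (hf : MemLp f 2 volume) :
    ‖hf.toLp f‖ ^ 2 = ∫ x, f x ^ 2 := by
  rw [← real_inner_self_eq_norm_sq, inner_toLp]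
  refine integral_congr_ae ?_
  filter_upwards [hf.coeFn_toLp] with x hx
  rw [hx, sq]

/-- The one-dimensional Sobolev inequality for `C¹` functions. -/
theorem abs_le_norm_add_norm {f g : ℝ → ℝ} (hfg : ∀ x, HasDerivAt f (g x) x)
    (hf : MemLp f 2 volume) (hg : MemLp g 2 volume) (x : ℝ) :
    |f x| ≤ ‖hf.toLp f‖ + ‖hg.toLp g‖ := by
  have hd : ∀ z, HasDerivAt (fun z => f z ^ 2) (2 * f z * g z) z := fun z => by
    simpa using (hfg z).fun_pow 2
  have hi : Integrable fun z => 2 * f z * g z := by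
    simpa only [mul_assoc, Pi.mul_apply] using (hf.integrable_mul hg).const_mul 2
  have hi2 : Integrable fun z => f z ^ 2 := hf.integrable_sq
  have hi3 : Integrable fun z => g z ^ 2 := hg.integrable_sq
  -- `f²` and its derivative are integrable, so `f²` vanishes at `-∞` and `f(x)²` is the integral of
  -- `2ff' ≤ f² + f'²` up to `x`.
  have h0 := tendsto_zero_of_hasDerivAt_of_integrableOn_Iic (a := x) (fun z _ => hd z)
    hi.integrableOn hi2.integrableOn
  have h1 := integral_Iic_of_hasDerivAt_of_tendsto' (a := x) (fun z _ => hd z) hi.integrableOn h0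
  rw [sub_zero] at h1
  have h2 : f x ^ 2 ≤ ‖hf.toLp f‖ ^ 2 + ‖hg.toLp g‖ ^ 2 := by
    rw [← h1, norm_toLp_sq, norm_toLp_sq, ← integral_add hi2 hi3]
    have hpos : ∀ z, 0 ≤ f z ^ 2 + g z ^ 2 := fun z => by positivity
    refine (setIntegral_mono hi.integrableOn (hi2.add hi3).integrableOn fun z => ?_).trans
      (setIntegral_le_integral (hi2.add hi3) (Eventually.of_forall hpos))
    simp only [Pi.add_apply]
    nlinarith [sq_nonneg (f z - g z)]
  refine abs_le_of_sq_le_sq (h2.trans ?_) (by positivity)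
  nlinarith [mul_nonneg (norm_nonneg (hf.toLp f)) (norm_nonneg (hg.toLp g))]

theorem tendsto_avg_avg (f : L2) : Tendsto (fun h => avg h (avg h f)) (𝓝 0) (𝓝 f) := by
  have h1 : Tendsto (fun h => avg h f) (𝓝 0) (𝓝 f) := by
    have := (continuous_avg f).tendsto 0
    rwa [avg_zero] at this
  rw [tendsto_iff_norm_sub_tendsto_zero] at h1 ⊢
  refine squeeze_zero (fun _ => norm_nonneg _) (fun h => ?_) (by simpa using h1.const_mul 2)
  calc ‖avg h (avg h f) - f‖ = ‖avg h (avg h f - f) + (avg h f - f)‖ := by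
        rw [map_sub]; abel_nf
    _ ≤ ‖avg h f - f‖ + ‖avg h f - f‖ := (norm_add_le _ _).trans
        (add_le_add_left (norm_avg_le _ _) _)
    _ = 2 * ‖avg h f - f‖ := by ring

theorem norm_avg_avg_le (h : ℝ) (f : L2) : ‖avg h (avg h f)‖ ≤ ‖f‖ :=
  (norm_avg_le _ _).trans (norm_avg_le _ _)

/-- Averaging an `H¹` function twice makes it of class `C¹`. -/
theorem HasWeakDeriv.exists_hasDerivAt {f g : L2} (hfg : HasWeakDeriv f g) {h : ℝ} (hh : h ≠ 0) :
    ∃ F G : ℝ → ℝ, (∀ x, HasDerivAt F (G x) x) ∧ avg h (avg h f) =ᵐ[volume] F ∧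
      avg h (avg h g) =ᵐ[volume] G := by
  have hli := (Lp.memLp f).locallyIntegrable (by norm_num)
  refine ⟨_, _, hasDerivAt_avgFun hh (continuous_avgFun hh hli), ?_, ?_⟩
  · filter_upwards [coeFn_avg hh (avg h f)] with x hx
    rw [hx, avgFun_eq hh, avgFun_eq hh]
    congr 1
    refine intervalIntegral.integral_congr_ae ?_
    filter_upwards [coeFn_avg hh f] with s hs _
    rw [hs]
  · rw [← hfg.diffQuot_eq hh, avg_diffQuot]
    have e1 := (measurePreserving_add_right (volume : Measure ℝ) h).quasiMeasurePreserving.ae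
      (coeFn_avg hh f)
    have e2 := (measurePreserving_sub_right (volume : Measure ℝ) h).quasiMeasurePreserving.ae
      (coeFn_avg hh f)
    filter_upwards [coeFn_diffQuot h (avg h f), e1, e2] with x h1 h2 h3
    rw [h1, h2, h3]

/-- Averages contract the `L²` norm, so the constant does not depend on `h`. The bound thus survives
an almost everywhere limit along a subsequence, and it is a common bound for the nonlinearity at `f`
and at its averages. -/
theorem HasWeakDeriv.ae_abs_avg_avg_le {f g : L2} (hfg : HasWeakDeriv f g) {h : ℝ} (hh : h ≠ 0) :
    ∀ᵐ x, |avg h (avg h f) x| ≤ ‖f‖ + ‖g‖ := by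
  obtain ⟨F, G, hd, hF, hG⟩ := hfg.exists_hasDerivAt hh
  have mF : MemLp F 2 volume := (memLp_congr_ae hF).1 (Lp.memLp _)
  have mG : MemLp G 2 volume := (memLp_congr_ae hG).1 (Lp.memLp _)
  have eF : mF.toLp F = avg h (avg h f) := Lp.ext (mF.coeFn_toLp.trans hF.symm)
  have eG : mG.toLp G = avg h (avg h g) := Lp.ext (mG.coeFn_toLp.trans hG.symm)
  filter_upwards [hF] with x hx
  rw [hx]
  refine (abs_le_norm_add_norm hd mF mG x).trans ?_
  rw [eF, eG]
  exact add_le_add (norm_avg_avg_le _ _) (norm_avg_avg_le _ _)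

/-- The one-dimensional Sobolev inequality. -/
theorem HasWeakDeriv.ae_abs_le {f g : L2} (hfg : HasWeakDeriv f g) :
    ∀ᵐ x, |f x| ≤ ‖f‖ + ‖g‖ := by
  have hseq : Tendsto (fun n : ℕ => 1 / ((n : ℝ) + 1)) atTop (𝓝 0) :=
    tendsto_one_div_add_atTop_nhds_zero_nat
  obtain ⟨ns, -, hns⟩ :=
    (tendstoInMeasure_of_tendsto_Lp ((tendsto_avg_avg f).comp hseq)).exists_seq_tendsto_ae
  have hb : ∀ᵐ x, ∀ n : ℕ,
      |avg (1 / ((n : ℝ) + 1)) (avg (1 / ((n : ℝ) + 1)) f) x| ≤ ‖f‖ + ‖g‖ :=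
    ae_all_iff.2 fun n => hfg.ae_abs_avg_avg_le (by positivity)
  filter_upwards [hns, hb] with x h1 h2
  exact le_of_tendsto h1.abs (Eventually.of_forall fun i => h2 (ns i))

theorem hasDerivAt_abs_rpow_mul_self {p : ℝ} (hp : 0 < p) (x : ℝ) :
    HasDerivAt (fun x : ℝ => |x| ^ p * x) ((p + 1) * |x| ^ p) x := by
  rcases eq_or_ne x 0 with rfl | hx
  · rw [abs_zero, Real.zero_rpow hp.ne', mul_zero, hasDerivAt_iff_tendsto_slope]
    have hc : Tendsto (fun x : ℝ => |x| ^ p) (𝓝[≠] 0) (𝓝 0) := by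
      have : Continuous fun x : ℝ => |x| ^ p := continuous_abs.rpow_const fun _ => Or.inr hp.le
      have h1 := this.tendsto 0
      rw [abs_zero, Real.zero_rpow hp.ne'] at h1
      exact h1.mono_left nhdsWithin_le_nhds
    refine hc.congr' ?_
    filter_upwards [self_mem_nhdsWithin] with z hz
    rw [slope_def_field]
    have hz : z ≠ 0 := hz
    field_simp
    ring
  · have h1 := ((hasDerivAt_abs hx).rpow_const (p := p) (Or.inl (abs_ne_zero.2 hx))).mul
      (hasDerivAt_id x)
    refine h1.congr_deriv ?_
    have h2 : |x| ^ p = |x| ^ (p - 1) * |x| := by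
      rw [← Real.rpow_add_one (abs_ne_zero.2 hx), sub_add_cancel]
    have h3 : (SignType.sign x : ℝ) * x = |x| := by
      rw [mul_comm]; exact self_mul_sign x
    simp only [id]
    rw [h2]
    linear_combination p * |x| ^ (p - 1) * h3

theorem abs_rpow_mul_self_sub_le {p : ℝ} (hp : 0 < p) {M a b : ℝ} (ha : |a| ≤ M) (hb : |b| ≤ M) :
    |(|a| ^ p * a) - |b| ^ p * b| ≤ (p + 1) * M ^ p * |a - b| := by
  have := (convex_Icc (-M) M).norm_image_sub_le_of_norm_hasDerivWithin_le
    (f := fun x : ℝ => |x| ^ p * x) (C := (p + 1) * M ^ p)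
    (fun x _ => (hasDerivAt_abs_rpow_mul_self hp x).hasDerivWithinAt)
    (fun x hx => by
      rw [Real.norm_eq_abs, abs_of_nonneg (by positivity)]
      have : |x| ≤ M := abs_le.2 hx
      gcongr) (abs_le.1 hb) (abs_le.1 ha)
  exact this

theorem continuous_abs_rpow_mul_self {p : ℝ} (hp : 0 < p) :
    Continuous fun x : ℝ => |x| ^ p * x :=
  continuous_iff_continuousAt.2 fun x => (hasDerivAt_abs_rpow_mul_self hp x).continuousAt

theorem memLp_abs_rpow_mul_self {p : ℝ} (hp : 0 < p) {f : ℝ → ℝ} (hf : MemLp f 2 volume) {M : ℝ}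
    (hM : ∀ᵐ x, |f x| ≤ M) : MemLp (fun x => |f x| ^ p * f x) 2 volume := by
  refine hf.of_le_mul (c := M ^ p)
    ((continuous_abs_rpow_mul_self hp).comp_aestronglyMeasurable hf.1) ?_
  filter_upwards [hM] with x hx
  rw [norm_mul, Real.norm_eq_abs, abs_of_nonneg (by positivity)]
  gcongr

open Classical in
/-- The nonlinearity `f ↦ |f|^p f` on bounded functions in `L²`. -/
def nonlin (p : ℝ) (f : L2) : L2 :=
  -- The default `0` never occurs on `H¹`, whose elements are essentially bounded.
  if h : MemLp (fun x => |f x| ^ p * f x) 2 volume then h.toLp _ else 0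

theorem coeFn_nonlin {p : ℝ} (hp : 0 < p) {f : L2} {M : ℝ} (hM : ∀ᵐ x, |f x| ≤ M) :
    nonlin p f =ᵐ[volume] fun x => |f x| ^ p * f x := by
  have h := memLp_abs_rpow_mul_self hp (Lp.memLp f) hM
  rw [nonlin, dif_pos h]
  exact h.coeFn_toLp

theorem norm_nonlin_sub_le {p : ℝ} (hp : 0 < p) {f g : L2} {M : ℝ} (hf : ∀ᵐ x, |f x| ≤ M)
    (hg : ∀ᵐ x, |g x| ≤ M) : ‖nonlin p f - nonlin p g‖ ≤ (p + 1) * M ^ p * ‖f - g‖ := by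
  refine Lp.norm_le_mul_norm_of_ae_le_mul ?_
  filter_upwards [hf, hg, coeFn_nonlin hp hf, coeFn_nonlin hp hg,
    Lp.coeFn_sub (nonlin p f) (nonlin p g), Lp.coeFn_sub f g] with x h1 h2 h3 h4 h5 h6
  rw [h5, h6, Pi.sub_apply, Pi.sub_apply, h3, h4]
  exact abs_rpow_mul_self_sub_le hp h1 h2

/-- The integrand is the derivative of the integrable function `|F|^(p+2)/(p+2)`. -/
theorem integral_deriv_mul_nonlin {p : ℝ} (hp : 0 < p) {F G : ℝ → ℝ}
    (hd : ∀ x, HasDerivAt F (G x) x) (hF : MemLp F 2 volume) (hG : MemLp G 2 volume) :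
    ∫ x, G x * (|F x| ^ p * F x) = 0 := by
  have hM : ∀ x, |F x| ≤ ‖hF.toLp F‖ + ‖hG.toLp G‖ := abs_le_norm_add_norm hd hF hG
  set M := ‖hF.toLp F‖ + ‖hG.toLp G‖
  have hm := memLp_abs_rpow_mul_self hp hF (Eventually.of_forall hM)
  refine integral_eq_zero_of_hasDerivAt_of_integrable
    (f := fun x => (p + 2)⁻¹ * |F x| ^ (p + 2)) (fun x => ?_) (hG.integrable_mul hm) ?_
  · have h1 := ((hasDerivAt_abs_rpow (F x) (p := p + 2) (by linarith)).comp x (hd x)).const_mul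
      (p + 2)⁻¹
    refine h1.congr_deriv ?_
    rw [add_sub_cancel_right]
    field_simp
  · refine ((hF.integrable_mul hm).const_mul (p + 2)⁻¹).congr (Eventually.of_forall fun x => ?_)
    simp only [Pi.mul_apply]
    rw [Real.rpow_add' (abs_nonneg _) (by linarith), Real.rpow_two, sq_abs]
    ring

/-- The identity holds for the `C¹` double averages of `f`. It passes to the limit because the
nonlinearity is Lipschitz in `L²` on functions with a common bound. -/
theorem inner_nonlin_eq_zero {p : ℝ} (hp : 0 < p) {f g : L2} (hfg : HasWeakDeriv f g) :
    ⟪g, nonlin p f⟫ = 0 := by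
  set M := ‖f‖ + ‖g‖
  have hN : Tendsto (fun h => nonlin p (avg h (avg h f))) (𝓝[≠] 0) (𝓝 (nonlin p f)) := by
    rw [tendsto_iff_norm_sub_tendsto_zero]
    have h1 := (tendsto_iff_norm_sub_tendsto_zero.1 (tendsto_avg_avg f)).const_mul ((p + 1) * M ^ p)
    rw [mul_zero] at h1
    refine squeeze_zero' (Eventually.of_forall fun _ => norm_nonneg _) ?_
      (h1.mono_left nhdsWithin_le_nhds)
    filter_upwards [self_mem_nhdsWithin] with h hh
    exact norm_nonlin_sub_le hp (hfg.ae_abs_avg_avg_le hh) hfg.ae_abs_le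
  have hT := ((tendsto_avg_avg g).mono_left (nhdsWithin_le_nhds (s := {0}ᶜ))).inner (𝕜 := ℝ) hN
  refine tendsto_nhds_unique hT (tendsto_const_nhds.congr' ?_)
  filter_upwards [self_mem_nhdsWithin] with h hh
  obtain ⟨F, G, hd, hF, hG⟩ := hfg.exists_hasDerivAt hh
  have mF : MemLp F 2 volume := (memLp_congr_ae hF).1 (Lp.memLp _)
  have mG : MemLp G 2 volume := (memLp_congr_ae hG).1 (Lp.memLp _)
  rw [inner_eq_integral, ← integral_deriv_mul_nonlin hp hd mF mG]
  refine integral_congr_ae ?_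
  filter_upwards [hF, hG, coeFn_nonlin hp (hfg.ae_abs_avg_avg_le hh)] with x h1 h2 h3
  rw [h3, h2, h1]

/-! ### The energy space and conservation of momentum -/

/-- The component `u` of `w = (u, v)` as an element of `L²`. -/
def uPart (w : EnergySpace) : L2 := (w.fst : WithLp 2 (L2 × L2)).fst

/-- The component `∂ₓu` of `w = (u, v)` as an element of `L²`. -/
def uxPart (w : EnergySpace) : L2 := (w.fst : WithLp 2 (L2 × L2)).snd

/-- The component `v` of `w = (u, v)` as an element of `L²`. -/
def vPart (w : EnergySpace) : L2 := w.snd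

theorem norm_uPart_le (w : EnergySpace) : ‖uPart w‖ ≤ ‖w‖ :=
  (WithLp.norm_fst_le _ (w.fst : WithLp 2 (L2 × L2))).trans (WithLp.norm_fst_le _ w)

theorem norm_uxPart_le (w : EnergySpace) : ‖uxPart w‖ ≤ ‖w‖ :=
  (WithLp.norm_snd_le _ (w.fst : WithLp 2 (L2 × L2))).trans (WithLp.norm_fst_le _ w)

theorem norm_vPart_le (w : EnergySpace) : ‖vPart w‖ ≤ ‖w‖ := WithLp.norm_snd_le _ w

theorem continuous_uPart : Continuous uPart :=
  continuous_iff_continuousAt.2 fun w => tendsto_iff_norm_sub_tendsto_zero.2 <|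
    squeeze_zero (fun _ => norm_nonneg _) (fun z => norm_uPart_le (z - w))
      (tendsto_iff_norm_sub_tendsto_zero.1 tendsto_id)

theorem continuous_uxPart : Continuous uxPart :=
  continuous_iff_continuousAt.2 fun w => tendsto_iff_norm_sub_tendsto_zero.2 <|
    squeeze_zero (fun _ => norm_nonneg _) (fun z => norm_uxPart_le (z - w))
      (tendsto_iff_norm_sub_tendsto_zero.1 tendsto_id)

theorem continuous_vPart : Continuous vPart :=
  continuous_iff_continuousAt.2 fun w => tendsto_iff_norm_sub_tendsto_zero.2 <|
    squeeze_zero (fun _ => norm_nonneg _) (fun z => norm_vPart_le (z - w))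
      (tendsto_iff_norm_sub_tendsto_zero.1 tendsto_id)

theorem hasWeakDeriv_uPart (w : EnergySpace) : HasWeakDeriv (uPart w) (uxPart w) := w.fst.2

theorem ae_abs_uPart_le (w : EnergySpace) : ∀ᵐ x, |uPart w x| ≤ 2 * ‖w‖ := by
  filter_upwards [(hasWeakDeriv_uPart w).ae_abs_le] with x hx
  linarith [norm_uPart_le w, norm_uxPart_le w]

theorem continuous_nonlin_uPart {p : ℝ} (hp : 0 < p) : Continuous fun w => nonlin p (uPart w) := by
  refine continuous_iff_continuousAt.2 fun w => tendsto_iff_norm_sub_tendsto_zero.2 ?_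
  have h1 := (tendsto_iff_norm_sub_tendsto_zero.1 (continuous_uPart.tendsto w)).const_mul
    ((p + 1) * (2 * (‖w‖ + 1)) ^ p)
  rw [mul_zero] at h1
  refine squeeze_zero' (Eventually.of_forall fun _ => norm_nonneg _) ?_ h1
  filter_upwards [(continuous_norm.tendsto w).eventually (gt_mem_nhds (lt_add_one ‖w‖))] with z hz
  refine norm_nonlin_sub_le hp ?_ ?_
  · filter_upwards [ae_abs_uPart_le z] with x hx
    linarith
  · filter_upwards [ae_abs_uPart_le w] with x hx
    linarith

theorem momentum_eq_inner (w : EnergySpace) :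
    momentum (uComp w) (vComp w) = ⟪uPart w, vPart w⟫ := (inner_eq_integral _ _).symm

theorem IsSolution.isTransported {p : ℝ} {I : Set ℝ} {w : ℝ → EnergySpace}
    (hw : IsSolution p I w) : IsTransported I (fun s => uPart (w s)) fun s => vPart (w s) :=
  ⟨continuous_uPart.comp_continuousOn hw.1, continuous_vPart.comp_continuousOn hw.1,
    fun ψ hψ t ht => (hw.2 ψ hψ t ht).1⟩

theorem IsTestFunction.deriv {ψ : ℝ → ℝ} (hψ : IsTestFunction ψ) : IsTestFunction (deriv ψ) :=
  ⟨(contDiff_infty_iff_deriv.1 hψ.1).2, hψ.2.deriv⟩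

theorem deriv_avgFun {h : ℝ} (hh : h ≠ 0) {ψ : ℝ → ℝ} (hψ : IsTestFunction ψ) :
    deriv (avgFun h ψ) = avgFun h (deriv ψ) := by
  funext x
  rw [(hasDerivAt_avgFun hh hψ.1.continuous x).deriv, avgFun_eq hh,
    intervalIntegral.integral_deriv_eq_sub
      (fun z _ => (hψ.1.differentiable (by simp)).differentiableAt)
      (hψ.deriv.1.continuous.intervalIntegrable _ _)]

theorem toLp_deriv_deriv_avgFun_avgFun {h : ℝ} (hh : h ≠ 0) {ψ : ℝ → ℝ} (hψ : IsTestFunction ψ) :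
    ((hψ.avgFun hh).avgFun hh).deriv.memLp_deriv.toLp _ =
      diffQuot h (diffQuot h (hψ.memLp.toLp ψ)) := by
  have hd := (hψ.avgFun hh).deriv
  have h1 := toLp_deriv_avgFun hh hd
  rw [toLp_deriv_avgFun hh hψ] at h1
  rw [← h1]
  simp only [deriv_avgFun hh (hψ.avgFun hh)]

/-- The discrete form of `∫ f f' = 0`: `avg h` is symmetric, `diffQuot h` is skew and the two
commute, so their product is skew. -/
theorem inner_diffQuot_avg (h : ℝ) (f : L2) : ⟪diffQuot h f, avg h f⟫ = 0 := by
  have h1 : ⟪diffQuot h f, avg h f⟫ = -⟪diffQuot h f, avg h f⟫ := by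
    conv_lhs => rw [inner_diffQuot_left, ← avg_diffQuot, ← inner_avg_left, real_inner_comm]
  linarith

/-- Two averages are needed: `v_t` contains two derivatives of `u_x`, which is merely in `L²`, and
each average absorbs one derivative. -/
theorem IsSolution.hasDerivAt_avg_avg_vPart {p : ℝ} (hp : 0 < p) {I : Set ℝ} {w : ℝ → EnergySpace}
    (hw : IsSolution p I w) (hI : IsOpen I) (hc : I.OrdConnected) {h : ℝ} (hh : h ≠ 0) {t : ℝ}
    (ht : t ∈ I) :
    HasDerivAt (fun s => avg h (avg h (vPart (w s))))
      (-diffQuot h (diffQuot h (uxPart (w t))) +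
        diffQuot h (avg h (uPart (w t) - nonlin p (uPart (w t))))) t := by
  refine hasDerivAt_of_weak (X := fun s => avg h (avg h (vPart (w s))))
    (W := fun s => -diffQuot h (diffQuot h (uxPart (w s))) +
        diffQuot h (avg h (uPart (w s) - nonlin p (uPart (w s))))) hI hc ?_ ?_ ht
  · refine ContinuousOn.add ?_ ?_
    · exact ((diffQuot h).continuous.comp ((diffQuot h).continuous.comp
        continuous_uxPart)).neg.comp_continuousOn hw.1
    · exact ((diffQuot h).continuous.comp ((avg h).continuous.comp
        (continuous_uPart.sub (continuous_nonlin_uPart hp)))).comp_continuousOn hw.1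
  · intro ψ hψ s hs
    have hψ2 := (hψ.avgFun hh).avgFun hh
    have h1 := (hw.2 _ hψ2 s hs).2
    have e1 : ∫ x, (uComp (w s) x - |uComp (w s) x| ^ p * uComp (w s) x) *
        deriv (avgFun h (avgFun h ψ)) x =
        ∫ x, (uPart (w s) - nonlin p (uPart (w s)) : L2) x *
          deriv (avgFun h (avgFun h ψ)) x := by
      refine integral_congr_ae ?_
      filter_upwards [coeFn_nonlin hp (ae_abs_uPart_le (w s)),
        Lp.coeFn_sub (uPart (w s)) (nonlin p (uPart (w s)))] with x h1 h2
      rw [h2, Pi.sub_apply, h1]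
      rfl
    have e2 : ∀ r, ∫ x, vComp (w r) x * avgFun h (avgFun h ψ) x =
        ∫ x, avg h (avg h (vPart (w r))) x * ψ x := by
      intro r
      rw [← inner_toLp _ hψ.memLp, inner_avg_left, inner_avg_left, ← toLp_avgFun hh hψ,
        ← toLp_avgFun hh (hψ.avgFun hh), inner_toLp]
      rfl
    have e3 : ∫ x, uxComp (w s) x * deriv (deriv (avgFun h (avgFun h ψ))) x =
        ⟪uxPart (w s), diffQuot h (diffQuot h (hψ.memLp.toLp ψ))⟫ := by
      rw [← toLp_deriv_deriv_avgFun_avgFun hh hψ, inner_toLp]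
      rfl
    rw [e1, e3, ← inner_toLp _ hψ2.memLp_deriv, toLp_deriv_avgFun hh (hψ.avgFun hh),
      toLp_avgFun hh hψ] at h1
    simp only [e2] at h1
    refine h1.congr_deriv ?_
    rw [← inner_toLp _ hψ.memLp, inner_add_left, inner_neg_left, inner_diffQuot_left,
      inner_diffQuot_left, inner_diffQuot_left, inner_avg_left, ← avg_diffQuot]
    ring

/-- By skewness all terms coming from the linear part of the system vanish exactly for each `h`.
Only the nonlinear term is left, and `diffQuot h u = avg h u_x` brings it to a form with a limit. -/
theorem IsSolution.hasDerivAt_inner_avg_avg {p : ℝ} (hp : 0 < p) {I : Set ℝ} {w : ℝ → EnergySpace}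
    (hw : IsSolution p I w) (hI : IsOpen I) (hc : I.OrdConnected) {h : ℝ} (hh : h ≠ 0) {t : ℝ}
    (ht : t ∈ I) :
    HasDerivAt (fun s => ⟪avg h (avg h (uPart (w s))), avg h (avg h (vPart (w s)))⟫)
      ⟪avg h (avg h (avg h (avg h (uxPart (w t))))), nonlin p (uPart (w t))⟫ t := by
  have h1 := (avg h).hasFDerivAt.comp_hasDerivAt t (hw.isTransported.hasDerivAt_avg hI hc hh ht)
  have h2 := HasDerivAt.inner ℝ h1 (hw.hasDerivAt_avg_avg_vPart hp hI hc hh ht)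
  refine h2.congr_deriv ?_
  have hD := (hasWeakDeriv_uPart (w t)).diffQuot_eq hh
  simp only [Function.comp_apply]
  set u := uPart (w t)
  set g := uxPart (w t)
  set v := vPart (w t)
  set N := nonlin p u
  have T1 : ⟪avg h (diffQuot h v), avg h (avg h v)⟫ = 0 := by
    rw [avg_diffQuot, inner_diffQuot_avg]
  have T2 : ⟪avg h (avg h u), diffQuot h (diffQuot h g)⟫ = 0 := by
    rw [← neg_eq_zero, ← inner_diffQuot_left, ← avg_diffQuot, ← avg_diffQuot, hD, inner_avg_left,
      avg_diffQuot, real_inner_comm, inner_diffQuot_avg]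
  have T3 : ⟪avg h (avg h u), diffQuot h (avg h u)⟫ = 0 := by
    rw [real_inner_comm, inner_diffQuot_avg]
  have T4 : ⟪avg h (avg h u), diffQuot h (avg h N)⟫ = -⟪avg h (avg h (avg h (avg h g))), N⟫ := by
    rw [← neg_inj, ← inner_diffQuot_left, ← avg_diffQuot, ← avg_diffQuot, hD, neg_neg,
      ← inner_avg_left]
  rw [T1, inner_add_right, inner_neg_right, T2, map_sub, map_sub, inner_sub_right, T3, T4]
  ring

/-- Conservation of momentum. -/
theorem IsSolution.momentum_eq {p : ℝ} (hp : 0 < p) {I : Set ℝ} {w : ℝ → EnergySpace}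
    (hw : IsSolution p I w) (hI : IsOpen I) (hc : I.OrdConnected) {s t : ℝ} (hs : s ∈ I)
    (ht : t ∈ I) :
    momentum (uComp (w t)) (vComp (w t)) = momentum (uComp (w s)) (vComp (w s)) := by
  rw [momentum_eq_inner, momentum_eq_inner]
  have hsub := hc.uIcc_subset hs ht
  have hux : ContinuousOn (fun r => uxPart (w r)) (uIcc s t) :=
    continuous_uxPart.comp_continuousOn (hw.1.mono hsub)
  have hN : ContinuousOn (fun r => nonlin p (uPart (w r))) (uIcc s t) :=
    (continuous_nonlin_uPart hp).comp_continuousOn (hw.1.mono hsub)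
  have hA : ∀ h, ContinuousOn (fun r => ⟪avg h (avg h (avg h (avg h (uxPart (w r))))),
      nonlin p (uPart (w r))⟫) (uIcc s t) := fun h =>
    (((avg h).continuous.comp ((avg h).continuous.comp ((avg h).continuous.comp
      (avg h).continuous))).comp_continuousOn hux).inner hN
  have hE : ∀ h ≠ 0, (∫ r in s..t, ⟪avg h (avg h (avg h (avg h (uxPart (w r))))),
      nonlin p (uPart (w r))⟫) =
      ⟪avg h (avg h (uPart (w t))), avg h (avg h (vPart (w t)))⟫ -
        ⟪avg h (avg h (uPart (w s))), avg h (avg h (vPart (w s)))⟫ := fun h hh =>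
    intervalIntegral.integral_eq_sub_of_hasDerivAt
      (fun r hr => hw.hasDerivAt_inner_avg_avg hp hI hc hh (hsub hr)) (hA h).intervalIntegrable
  -- The integrand tends to `⟪u_x, |u|^p u⟫ = 0`; as averages are contractions, the product of the
  -- two norms dominates it.
  have hL : Tendsto (fun h => ∫ r in s..t, ⟪avg h (avg h (avg h (avg h (uxPart (w r))))),
      nonlin p (uPart (w r))⟫) (𝓝[≠] 0) (𝓝 (∫ r in s..t, 0)) := by
    refine intervalIntegral.tendsto_integral_filter_of_dominated_convergence
      (fun r => ‖uxPart (w r)‖ * ‖nonlin p (uPart (w r))‖) ?_ ?_ ?_ ?_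
    · exact Eventually.of_forall fun h =>
        ((hA h).mono uIoc_subset_uIcc).aestronglyMeasurable measurableSet_uIoc
    · refine Eventually.of_forall fun h => Eventually.of_forall fun r _ => ?_
      exact (norm_inner_le_norm _ _).trans (mul_le_mul_of_nonneg_right
        ((norm_avg_avg_le _ _).trans (norm_avg_avg_le _ _)) (norm_nonneg _))
    · exact (hux.norm.mul hN.norm).intervalIntegrable
    · refine Eventually.of_forall fun r _ => ?_
      have h1 : Tendsto (fun h => avg h (avg h (nonlin p (uPart (w r))))) (𝓝[≠] 0) _ :=
        (tendsto_avg_avg _).mono_left nhdsWithin_le_nhds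
      have h2 : Tendsto (fun h => avg h (avg h (uxPart (w r)))) (𝓝[≠] 0) _ :=
        (tendsto_avg_avg _).mono_left nhdsWithin_le_nhds
      have h3 := h2.inner (𝕜 := ℝ) h1
      rw [inner_nonlin_eq_zero hp (hasWeakDeriv_uPart (w r))] at h3
      simpa only [inner_avg_left] using h3
  have hR : Tendsto (fun h => ∫ r in s..t, ⟪avg h (avg h (avg h (avg h (uxPart (w r))))),
      nonlin p (uPart (w r))⟫) (𝓝[≠] 0)
      (𝓝 (⟪uPart (w t), vPart (w t)⟫ - ⟪uPart (w s), vPart (w s)⟫)) := by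
    have hT : ∀ r, Tendsto (fun h => ⟪avg h (avg h (uPart (w r))), avg h (avg h (vPart (w r)))⟫)
        (𝓝[≠] 0) (𝓝 ⟪uPart (w r), vPart (w r)⟫) := fun r =>
      ((tendsto_avg_avg _).inner (𝕜 := ℝ) (tendsto_avg_avg _)).mono_left nhdsWithin_le_nhds
    refine ((hT t).sub (hT s)).congr' ?_
    filter_upwards [self_mem_nhdsWithin] with h hh using (hE h hh).symm
  have := tendsto_nhds_unique hR hL
  rw [intervalIntegral.integral_zero] at this
  linarith

/-! ### The explicit ground state -/

/-- For `c = ±b` the function `(f' + c f) exp(-c x)` is constant, equal to `c f(0)`; the two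
relations determine `f`. -/
theorem eq_mul_cosh_of_deriv_deriv_eq {b : ℝ} (hb : b ≠ 0) {f g : ℝ → ℝ}
    (hf : ∀ x, HasDerivAt f (g x) x) (hg : ∀ x, HasDerivAt g (b ^ 2 * f x) x) (h0 : g 0 = 0)
    (x : ℝ) : f x = f 0 * Real.cosh (b * x) := by
  have he : ∀ c x : ℝ, HasDerivAt (fun x => Real.exp (c * x)) (Real.exp (c * x) * c) x := by
    intro c x
    simpa using ((hasDerivAt_id x).const_mul c).exp
  have key : ∀ c : ℝ, c ^ 2 = b ^ 2 → ∀ x, (g x + c * f x) * Real.exp (-c * x) = c * f 0 := by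
    intro c hc x
    have hd : ∀ x, HasDerivAt (fun x => (g x + c * f x) * Real.exp (-c * x)) 0 x := by
      intro x
      refine (((hg x).add ((hf x).const_mul c)).mul (he (-c) x)).congr_deriv ?_
      simp only [Pi.add_apply]
      rw [← hc]
      ring
    have := is_const_of_deriv_eq_zero (fun x => (hd x).differentiableAt) (fun x => (hd x).deriv) x 0
    simpa [h0] using this
  have k1 := key b rfl x
  have k2 := key (-b) (by ring) x
  have e1 : Real.exp (b * x) * Real.exp (-b * x) = 1 := by
    rw [← Real.exp_add]; simp
  rw [Real.cosh_eq]
  rw [neg_neg] at k2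
  rw [show -(b * x) = -b * x by ring]
  have h2 : 2 * b * f x = 2 * b * (f 0 * ((Real.exp (b * x) + Real.exp (-b * x)) / 2)) := by
    linear_combination Real.exp (b * x) * k1 - Real.exp (-b * x) * k2 - 2 * b * f x * e1
  exact mul_left_cancel₀ (by simpa using hb) h2

namespace IsGroundState

variable {p c : ℝ} {φ : ℝ → ℝ}

theorem hasDerivAt (h : IsGroundState p c φ) (x : ℝ) : HasDerivAt φ (deriv φ x) x :=
  (h.contDiff.differentiable (by norm_num) x).hasDerivAt

theorem hasDerivAt_deriv (h : IsGroundState p c φ) (x : ℝ) :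
    HasDerivAt (deriv φ) ((1 - c ^ 2) * φ x - φ x ^ (p + 1)) x := by
  have h1 : Differentiable ℝ (deriv φ) :=
    ((contDiff_succ_iff_deriv (n := 1)).1 (by simpa [one_add_one_eq_two] using h.contDiff)).2.2.differentiable
      (by norm_num)
  exact (h1 x).hasDerivAt.congr_deriv (by linarith [h.equation x])

/-- The energy is constant in `x` by the equation. Each of its terms is integrable on the line (the
last one since `φ` is bounded), and an integrable constant is zero. -/
theorem first_integral (hp : 0 < p) (h : IsGroundState p c φ) (x : ℝ) :
    deriv φ x ^ 2 = (1 - c ^ 2) * φ x ^ 2 - 2 / (p + 2) * φ x ^ (p + 2) := by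
  set E : ℝ → ℝ := fun x =>
    deriv φ x ^ 2 - (1 - c ^ 2) * φ x ^ 2 + 2 / (p + 2) * φ x ^ (p + 2) with hE
  have hd : ∀ x, HasDerivAt E 0 x := by
    intro x
    have h1 := (((h.hasDerivAt_deriv x).fun_pow 2).sub
      (((h.hasDerivAt x).fun_pow 2).const_mul (1 - c ^ 2))).add
      (((h.hasDerivAt x).rpow_const (p := p + 2) (Or.inl (h.pos x).ne')).const_mul (2 / (p + 2)))
    refine h1.congr_deriv ?_
    rw [show p + 2 - 1 = p + 1 by ring]
    have : p + 2 ≠ 0 := by positivity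
    field_simp
    ring
  have hc : ∀ x, E x = E 0 := fun x =>
    is_const_of_deriv_eq_zero (fun x => (hd x).differentiableAt) (fun x => (hd x).deriv) x 0
  have hM := abs_le_norm_add_norm h.hasDerivAt h.memLp h.memLp_deriv
  set M := ‖h.memLp.toLp φ‖ + ‖h.memLp_deriv.toLp (deriv φ)‖
  have hi : Integrable fun x => φ x ^ (p + 2) := by
    refine (h.memLp.integrable_sq.const_mul (M ^ p)).mono'
      (h.contDiff.continuous.rpow_const fun x => Or.inl (h.pos x).ne').aestronglyMeasurable
      (Eventually.of_forall fun x => ?_)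
    have hx : φ x ≤ M := (le_abs_self _).trans (hM x)
    have h0 := (h.pos x).le
    rw [Real.norm_of_nonneg (by positivity), Real.rpow_add' h0 (by linarith), Real.rpow_two]
    gcongr
  have hEi : Integrable E :=
    (h.memLp_deriv.integrable_sq.sub (h.memLp.integrable_sq.const_mul (1 - c ^ 2))).add
      (hi.const_mul (2 / (p + 2)))
  rw [funext hc] at hEi
  have h0 : E 0 = 0 := by
    rcases integrable_const_iff.1 hEi with h1 | h1
    · exact h1
    · exact absurd h1.measure_univ_lt_top (by simp)
  have h2 := hc x
  rw [h0, hE] at h2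
  linarith

theorem deriv_zero (h : IsGroundState p c φ) : deriv φ 0 = 0 := by
  have h1 : HasDerivAt (fun x => φ (-x)) (-deriv φ 0) 0 := by
    have h2 := h.hasDerivAt (-0)
    have h3 := HasDerivAt.comp (0 : ℝ) h2 (hasDerivAt_neg 0)
    rw [neg_zero, mul_neg_one] at h3
    exact h3
  rw [funext h.even] at h1
  linarith [h1.unique (h.hasDerivAt 0)]

end IsGroundState

/-- The frequency `b = (p/2) √(1 - c²)` of the ground state of wave speed `c`. -/
def freq (p c : ℝ) : ℝ := p / 2 * Real.sqrt (1 - c ^ 2)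

/-- The normalised profile `cosh(z)^{-q}`. -/
def prof (q z : ℝ) : ℝ := Real.cosh z ^ (-q)

/-- The amplitude of the ground state of frequency `1`. -/
def ampl (p : ℝ) : ℝ := (2 * (p + 2) / p ^ 2) ^ (1 / p)

theorem one_sub_sq_pos {c : ℝ} (hc : c ∈ Ioo (-1 : ℝ) 1) : 0 < 1 - c ^ 2 := by
  nlinarith [hc.1, hc.2]

theorem freq_sq {p c : ℝ} (hc : c ∈ Ioo (-1 : ℝ) 1) : freq p c ^ 2 = p ^ 2 / 4 * (1 - c ^ 2) := by
  rw [freq, mul_pow, Real.sq_sqrt (one_sub_sq_pos hc).le]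
  ring

theorem freq_pos {p c : ℝ} (hp : 0 < p) (hc : c ∈ Ioo (-1 : ℝ) 1) : 0 < freq p c := by
  have := Real.sqrt_pos.2 (one_sub_sq_pos hc)
  unfold freq
  positivity

theorem ampl_pos {p : ℝ} (hp : 0 < p) : 0 < ampl p := by
  unfold ampl
  positivity

/-- The explicit form of the ground state. -/
theorem IsGroundState.eq_prof {p c : ℝ} {φ : ℝ → ℝ} (hp : 0 < p) (hc : c ∈ Ioo (-1 : ℝ) 1)
    (h : IsGroundState p c φ) (x : ℝ) :
    φ x = ampl p * freq p c ^ (2 / p) * prof (2 / p) (freq p c * x) := by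
  set b := freq p c with hb
  have hb0 : 0 < b := freq_pos hp hc
  have hb2 : b ^ 2 = p ^ 2 / 4 * (1 - c ^ 2) := freq_sq hc
  have hα := one_sub_sq_pos hc
  -- This power linearises the problem: by the first integral `f'' = b² f`, and `f'(0) = 0` by
  -- evenness.
  set f : ℝ → ℝ := fun x => φ x ^ (-p / 2) with hf
  set g : ℝ → ℝ := fun x => deriv φ x * (-p / 2) * φ x ^ (-p / 2 - 1) with hg
  have hfd : ∀ x, HasDerivAt f (g x) x := fun x =>
    (h.hasDerivAt x).rpow_const (Or.inl (h.pos x).ne')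
  have hgd : ∀ x, HasDerivAt g (b ^ 2 * f x) x := by
    intro x
    have h1 := ((h.hasDerivAt_deriv x).mul_const (-p / 2)).mul
      ((h.hasDerivAt x).rpow_const (p := -p / 2 - 1) (Or.inl (h.pos x).ne'))
    refine h1.congr_deriv ?_
    have hE := h.first_integral hp x
    have hx := h.pos x
    have e1 : φ x ^ (-p / 2 - 1 - 1) = φ x ^ (-p / 2) / φ x ^ 2 := by
      rw [sub_sub, Real.rpow_sub hx]; norm_num
    have e2 : φ x ^ (-p / 2 - 1) = φ x ^ (-p / 2) / φ x := by
      rw [Real.rpow_sub hx, Real.rpow_one]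
    have e3 : φ x ^ (p + 1) = φ x ^ p * φ x := by
      rw [Real.rpow_add hx, Real.rpow_one]
    have e4 : φ x ^ (p + 2) = φ x ^ p * φ x ^ 2 := by
      rw [Real.rpow_add hx, Real.rpow_two]
    rw [e4] at hE
    simp only [hf]
    rw [e1, e2, e3, hb2]
    have h3 : p + 2 ≠ 0 := by positivity
    have e5 : deriv φ x * (-p / 2) * (deriv φ x * (-p / 2 - 1) * (φ x ^ (-p / 2) / φ x ^ 2)) =
        deriv φ x ^ 2 * ((p / 2) * (p / 2 + 1)) * (φ x ^ (-p / 2) / φ x ^ 2) := by ring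
    rw [e5, hE]
    field_simp
    ring
  have hcosh := eq_mul_cosh_of_deriv_deriv_eq hb0.ne' hfd hgd (by simp [hg, h.deriv_zero]) x
  have h0 := h.pos 0
  have hinv : ∀ z, φ z = f z ^ (-(2 / p)) := by
    intro z
    rw [hf]
    simp only
    rw [← Real.rpow_mul (h.pos z).le, show -p / 2 * -(2 / p) = 1 by field_simp, Real.rpow_one]
  -- Since `φ'(0) = 0`, the first integral at the origin fixes `φ(0)^p`.
  have hφ0 : φ 0 = ampl p * b ^ (2 / p) := by
    have hE := h.first_integral hp 0
    rw [h.deriv_zero, Real.rpow_add h0, Real.rpow_two] at hE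
    have h1 : φ 0 ^ p = 2 * (p + 2) / p ^ 2 * b ^ 2 := by
      have h3 : φ 0 ^ 2 * φ 0 ^ p = φ 0 ^ 2 * (2 * (p + 2) / p ^ 2 * b ^ 2) := by
        rw [hb2]
        have e1 : 2 * (p + 2) / p ^ 2 * (p ^ 2 / 4 * (1 - c ^ 2)) = (p + 2) / 2 * (1 - c ^ 2) := by
          field_simp
          ring
        have e2 : (p + 2) / 2 * (2 / (p + 2)) = 1 := by
          have : p + 2 ≠ 0 := by positivity
          field_simp
        rw [e1]
        linear_combination (p + 2) / 2 * hE - φ 0 ^ p * φ 0 ^ 2 * e2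
      exact mul_left_cancel₀ (by positivity) h3
    have h2 : φ 0 = (φ 0 ^ p) ^ (1 / p) := by
      rw [← Real.rpow_mul h0.le, mul_one_div_cancel hp.ne', Real.rpow_one]
    rw [h2, h1, Real.mul_rpow (by positivity) (by positivity), ampl, ← Real.rpow_natCast b 2,
      ← Real.rpow_mul hb0.le]
    congr 2
    push_cast
    ring
  have hf0 : 0 < f 0 := Real.rpow_pos_of_pos h0 _
  rw [hinv x, hcosh, Real.mul_rpow hf0.le (Real.cosh_pos _).le, ← hinv 0, hφ0, prof]

/-! ### Decay estimates and the product rule for pairings -/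

/-- The weight `(1 + x²)⁻¹`. -/
def weight (x : ℝ) : ℝ := (1 + x ^ 2)⁻¹

theorem weight_pos (x : ℝ) : 0 < weight x := by unfold weight; positivity

theorem weight_le_one (x : ℝ) : weight x ≤ 1 := inv_le_one_of_one_le₀ (by nlinarith [sq_nonneg x])

theorem continuous_weight : Continuous weight :=
  (by fun_prop : Continuous fun x : ℝ => 1 + x ^ 2).inv₀ fun x => by positivity

theorem integrable_weight : Integrable weight := integrable_inv_one_add_sq

theorem weight_mul (x : ℝ) : (1 + x ^ 2) * weight x = 1 :=
  mul_inv_cancel₀ (by positivity)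

theorem memLp_weight : MemLp weight 2 volume := by
  rw [memLp_two_iff_integrable_sq continuous_weight.aestronglyMeasurable]
  refine integrable_weight.mono' (continuous_weight.pow 2).aestronglyMeasurable
    (Eventually.of_forall fun x => ?_)
  rw [Real.norm_of_nonneg (by positivity), sq]
  exact mul_le_of_le_one_left (weight_pos x).le (weight_le_one x)

theorem memLp_of_abs_le_weight {f : ℝ → ℝ} (hf : AEStronglyMeasurable f volume) {C : ℝ}
    (h : ∀ x, |f x| ≤ C * weight x) : MemLp f 2 volume :=
  memLp_weight.of_le_mul hf (Eventually.of_forall fun x => by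
    rw [Real.norm_eq_abs, Real.norm_of_nonneg (weight_pos x).le]; exact h x)

theorem abs_mul_weight_le (x : ℝ) : |x| * weight x ≤ 1 := by
  rw [weight, ← div_eq_mul_inv, div_le_one (by positivity)]
  nlinarith [sq_nonneg (|x| - 1), sq_abs x, abs_nonneg x]

theorem sq_mul_weight_le (x : ℝ) : x ^ 2 * weight x ≤ 1 := by
  linarith [weight_mul x, weight_pos x]

theorem weight_sub_le (x y : ℝ) : weight (x - y) ≤ 2 * (1 + y ^ 2) * weight x := by
  rw [weight, weight, inv_le_iff_one_le_mul₀ (by positivity), ← div_eq_mul_inv, div_mul_eq_mul_div,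
    one_le_div (by positivity)]
  nlinarith [sq_nonneg (x - 2 * y), sq_nonneg (y * (x - y))]

theorem weight_mul_le {a b : ℝ} (ha : 0 < a) (ha1 : a ≤ 1) (hab : a ≤ b) (x : ℝ) :
    weight (b * x) ≤ (a ^ 2)⁻¹ * weight x := by
  rw [weight, weight, ← mul_inv]
  refine inv_anti₀ (by positivity) ?_
  have h1 : a ^ 2 ≤ b ^ 2 := by gcongr
  nlinarith [mul_le_mul_of_nonneg_right h1 (sq_nonneg x), sq_nonneg x]

theorem norm_toLp_le_of_abs_le_weight {f : ℝ → ℝ} (hf : MemLp f 2 volume) {C : ℝ}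
    (h : ∀ x, |f x| ≤ C * weight x) : ‖hf.toLp f‖ ≤ C * ‖memLp_weight.toLp weight‖ := by
  refine Lp.norm_le_mul_norm_of_ae_le_mul ?_
  filter_upwards [hf.coeFn_toLp, memLp_weight.coeFn_toLp] with x h1 h2
  rw [h1, h2, Real.norm_eq_abs, Real.norm_of_nonneg (weight_pos x).le]
  exact h x

/-- The Cauchy-Schwarz inequality against a function dominated by `(1 + x²)⁻¹`. -/
theorem abs_integral_mul_le (f : L2) {g : ℝ → ℝ} (hg : AEStronglyMeasurable g volume) {C : ℝ}
    (h : ∀ x, |g x| ≤ C * weight x) :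
    |∫ x, f x * g x| ≤ ‖f‖ * (C * ‖memLp_weight.toLp weight‖) := by
  have hm := memLp_of_abs_le_weight hg h
  rw [← inner_toLp f hm]
  exact (abs_real_inner_le_norm _ _).trans
    (mul_le_mul_of_nonneg_left (norm_toLp_le_of_abs_le_weight hm h) (norm_nonneg _))

theorem hasDerivAt_zero_of_abs_le {f ρ : ℝ → ℝ} {t : ℝ} (hf : f t = 0)
    (h : ∀ᶠ s in 𝓝 t, |f s| ≤ ρ s * |s - t|) (hρ : Tendsto ρ (𝓝 t) (𝓝 0)) : HasDerivAt f 0 t := by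
  rw [hasDerivAt_iff_isLittleO, Asymptotics.isLittleO_iff]
  intro c hc
  filter_upwards [h, hρ.eventually (gt_mem_nhds hc)] with s h1 h2
  rw [hf, smul_zero, sub_zero, sub_zero, Real.norm_eq_abs, Real.norm_eq_abs]
  exact h1.trans (mul_le_mul_of_nonneg_right h2.le (abs_nonneg _))

/-- The product rule for the pairing of a solution of `∂ₜ U = ∂ₓ V` with a family of functions. -/
theorem IsTransported.hasDerivAt_integral {I : Set ℝ} {U V : ℝ → L2} (hUV : IsTransported I U V)
    (hI : IsOpen I) (hc : I.OrdConnected) {t : ℝ} (ht : t ∈ I) {χ χt : ℝ → ℝ → ℝ} {χx B : ℝ → ℝ}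
    (hχ : ∀ᶠ s in 𝓝 t, MemLp (χ s) 2 volume) (hx : ∀ x, HasDerivAt (χ t) (χx x) x)
    (hχx : MemLp χx 2 volume) (hB : MemLp B 2 volume)
    (hχt : ∀ᶠ s in 𝓝 t, ∀ x, HasDerivAt (fun r => χ r x) (χt s x) s ∧ |χt s x| ≤ B x)
    (hm : AEStronglyMeasurable (χt t) volume) :
    HasDerivAt (fun s => ∫ x, U s x * χ s x)
      (-(∫ x, V t x * χx x) + ∫ x, U t x * χt t x) t := by
  have hχ0 : MemLp (χ t) 2 volume := hχ.self_of_nhds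
  obtain ⟨δ, hδ, hball⟩ := Metric.eventually_nhds_iff_ball.1 (hχ.and hχt)
  have hlip : ∀ s ∈ Metric.ball t δ, ∀ x, |χ s x - χ t x| ≤ B x * |s - t| := by
    intro s hs x
    have := (convex_ball t δ).norm_image_sub_le_of_norm_hasDerivWithin_le
      (f := fun r => χ r x) (C := B x)
      (fun r hr => (((hball r hr).2 x).1).hasDerivWithinAt)
      (fun r hr => ((hball r hr).2 x).2) (Metric.mem_ball_self hδ) hs
    simpa only [Real.norm_eq_abs] using this
  -- Uₛχₛ = Uₛχₜ + Uₜχₛ + (Uₛ - Uₜ)(χₛ - χₜ) - Uₜχₜ. The first term uses the equation, the second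
  -- dominated differentiation, and the third is `o(s - t)` since `χ` is Lipschitz in time while `U`
  -- is merely continuous.
  have h1 := hUV.hasDerivAt_inner hI hc (hasWeakDeriv_toLp hx hχ0 hχx) ht
  rw [inner_toLp] at h1
  simp only [inner_toLp] at h1
  have h2 : HasDerivAt (fun s => ∫ x, U t x * χ s x) (∫ x, U t x * χt t x) t := by
    refine (hasDerivAt_integral_of_dominated_loc_of_deriv_le (μ := volume)
      (F := fun s x => U t x * χ s x) (F' := fun s x => U t x * χt s x)
      (bound := fun x => |U t x| * B x) (Metric.ball_mem_nhds t hδ) ?_ ?_ ?_ ?_ ?_ ?_).2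
    · filter_upwards [hχ] with s hs
      exact (Lp.aestronglyMeasurable _).mul hs.1
    · exact (Lp.memLp _).integrable_mul hχ0
    · exact (Lp.aestronglyMeasurable _).mul hm
    · refine Eventually.of_forall fun x s hs => ?_
      rw [norm_mul, Real.norm_eq_abs, Real.norm_eq_abs]
      exact mul_le_mul_of_nonneg_left ((hball s hs).2 x).2 (abs_nonneg _)
    · exact (Lp.memLp (U t)).abs.integrable_mul hB
    · exact Eventually.of_forall fun x s hs => ((hball s hs).2 x).1.const_mul _
  have h3 : HasDerivAt (fun s => ∫ x, (U s - U t : L2) x * (χ s x - χ t x)) 0 t := by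
    refine hasDerivAt_zero_of_abs_le (ρ := fun s => ‖U s - U t‖ * ‖hB.toLp B‖) (by simp) ?_ ?_
    · filter_upwards [Metric.ball_mem_nhds t hδ] with s hs
      have hms : MemLp (fun x => χ s x - χ t x) 2 volume := (hball s hs).1.sub hχ0
      rw [← inner_toLp _ hms, mul_assoc]
      refine (abs_real_inner_le_norm _ _).trans (mul_le_mul_of_nonneg_left ?_ (norm_nonneg _))
      rw [mul_comm]
      refine Lp.norm_le_mul_norm_of_ae_le_mul ?_
      filter_upwards [hms.coeFn_toLp, hB.coeFn_toLp] with x e1 e2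
      rw [e1, e2, Real.norm_eq_abs, mul_comm]
      exact (hlip s hs x).trans (mul_le_mul_of_nonneg_right (le_abs_self _) (abs_nonneg _))
    · have hU := (hUV.1.continuousAt (hI.mem_nhds ht)).tendsto
      simpa using (tendsto_iff_norm_sub_tendsto_zero.1 hU).mul_const ‖hB.toLp B‖
  have h4 := (h1.add h2).add h3
  rw [add_zero] at h4
  have h5 := h4.sub_const (∫ x, U t x * χ t x)
  refine h5.congr_of_eventuallyEq ?_
  filter_upwards [hχ] with s hs
  simp only [Pi.add_apply]
  have hms : MemLp (fun x => χ s x - χ t x) 2 volume := hs.sub hχ0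
  have e0 : hms.toLp _ = hs.toLp _ - hχ0.toLp _ := MemLp.toLp_sub _ _
  rw [← inner_toLp _ hs, ← inner_toLp _ hs, ← inner_toLp _ hχ0, ← inner_toLp _ hχ0,
    ← inner_toLp _ hms, e0]
  simp only [inner_sub_left, inner_sub_right]
  ring

theorem integral_mul_comp_sub (f : L2) (g : ℝ → ℝ) (y : ℝ) :
    ∫ x, f x * g (x - y) = ∫ x, trans y f x * g x := by
  rw [← integral_add_right_eq_self (fun x => f x * g (x - y)) y]
  refine integral_congr_ae ?_
  filter_upwards [coeFn_trans y f] with x hx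
  rw [hx, add_sub_cancel_right]

/-! ### Pairings with a moving, dilated and cut off profile -/

/-- A bounded profile `P` with decaying derivative `P'`, and a cutoff function `θ` with decaying
derivative `θ'`, such that the products `P(b ·) θ` decay. -/
structure IsCutProfile (P P' θ θ' : ℝ → ℝ) : Prop where
  hasDerivAt_profile : ∀ z, HasDerivAt P (P' z) z
  continuous_deriv_profile : Continuous P'
  profile_le : ∃ C, ∀ z, |P z| ≤ C
  deriv_profile_le : ∃ C, ∀ z, |P' z| ≤ C * weight z ^ 2
  hasDerivAt_cutoff : ∀ x, HasDerivAt θ (θ' x) x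
  continuous_deriv_cutoff : Continuous θ'
  cutoff_le : ∀ x, |θ x| ≤ 1
  deriv_cutoff_le : ∃ C, ∀ x, |θ' x| ≤ C * weight x
  mul_le : ∀ b, 0 < b → ∃ C, ∀ x, |P (b * x) * θ x| ≤ C * weight x

namespace IsCutProfile

variable {P P' θ θ' : ℝ → ℝ}

theorem continuous_profile (h : IsCutProfile P P' θ θ') : Continuous P :=
  continuous_iff_continuousAt.2 fun x => (h.hasDerivAt_profile x).continuousAt

theorem continuous_cutoff (h : IsCutProfile P P' θ θ') : Continuous θ :=
  continuous_iff_continuousAt.2 fun x => (h.hasDerivAt_cutoff x).continuousAt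

/-- The two quantities are the derivatives of `P(bz)θ(z)` in `z` and in `b`. Uniformity in `b`
supplies the dominating function for differentiation in time; the second power of the weight in the
decay of `P'` absorbs the factor `z`. -/
theorem exists_bounds (h : IsCutProfile P P' θ θ') {a M : ℝ} (ha : 0 < a) (ha1 : a ≤ 1) :
    ∃ C, 0 ≤ C ∧ ∀ b, a ≤ b → b ≤ M → ∀ z,
      |b * P' (b * z) * θ z + P (b * z) * θ' z| ≤ C * weight z ∧
      |z * P' (b * z) * θ z| ≤ C * weight z := by
  obtain ⟨C0, h0⟩ := h.profile_le
  obtain ⟨C1, h1⟩ := h.deriv_profile_le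
  obtain ⟨C2, h2⟩ := h.deriv_cutoff_le
  have hC0 : 0 ≤ C0 := (abs_nonneg _).trans (h0 0)
  have hC1 : 0 ≤ C1 := by
    have := (abs_nonneg _).trans (h1 0)
    simpa [weight] using this
  have hC2 : 0 ≤ C2 := by
    have := (abs_nonneg _).trans (h2 0)
    simpa [weight] using this
  refine ⟨|M| * (C1 * (a ^ 2)⁻¹) + C0 * C2 + C1 * ((a ^ 2)⁻¹ * (a ^ 2)⁻¹), by positivity,
    fun b hab hbM z => ?_⟩
  have hb : 0 < b := ha.trans_le hab
  have hw := weight_mul_le ha ha1 hab z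
  have hwp := weight_pos (b * z)
  have hwz := weight_pos z
  have hP' : |P' (b * z)| ≤ C1 * (a ^ 2)⁻¹ * weight z := by
    refine (h1 _).trans ?_
    rw [mul_assoc]
    refine mul_le_mul_of_nonneg_left (le_trans ?_ hw) hC1
    rw [sq]
    exact mul_le_of_le_one_left hwp.le (weight_le_one _)
  have hzP' : |z| * |P' (b * z)| ≤ C1 * ((a ^ 2)⁻¹ * (a ^ 2)⁻¹) * weight z := by
    calc |z| * |P' (b * z)| ≤ |z| * (C1 * ((a ^ 2)⁻¹ * weight z) ^ 2) := by
          gcongr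
          exact (h1 _).trans (by gcongr)
      _ = C1 * ((a ^ 2)⁻¹ * (a ^ 2)⁻¹) * weight z * (|z| * weight z) := by ring
      _ ≤ C1 * ((a ^ 2)⁻¹ * (a ^ 2)⁻¹) * weight z * 1 := by
          gcongr
          exact abs_mul_weight_le z
      _ = _ := mul_one _
  constructor
  · calc |b * P' (b * z) * θ z + P (b * z) * θ' z|
        ≤ b * |P' (b * z)| * |θ z| + |P (b * z)| * |θ' z| := by
          refine (abs_add_le _ _).trans_eq ?_
          rw [abs_mul, abs_mul, abs_mul, abs_of_pos hb]
      _ ≤ |M| * (C1 * (a ^ 2)⁻¹ * weight z) * 1 + C0 * (C2 * weight z) := by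
          gcongr
          · exact hbM.trans (le_abs_self _)
          · exact h.cutoff_le z
          · exact h0 _
          · exact h2 _
      _ ≤ _ := by
          have : 0 ≤ C1 * ((a ^ 2)⁻¹ * (a ^ 2)⁻¹) * weight z := by positivity
          linarith
  · calc |z * P' (b * z) * θ z| = |z| * |P' (b * z)| * |θ z| := by rw [abs_mul, abs_mul]
      _ ≤ C1 * ((a ^ 2)⁻¹ * (a ^ 2)⁻¹) * weight z * 1 := by
          gcongr
          exact h.cutoff_le z
      _ ≤ _ := by
          have : 0 ≤ (|M| * (C1 * (a ^ 2)⁻¹) + C0 * C2) * weight z := by positivity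
          linarith

/-- The time derivative of the pairing of a solution of `∂ₜ U = ∂ₓ V`, in a moving frame, with a
profile of varying width. -/
theorem hasDerivAt_integral (h : IsCutProfile P P' θ θ') {I : Set ℝ} {U V : ℝ → L2}
    (hUV : IsTransported I U V) (hI : IsOpen I) (hc : I.OrdConnected) {b bd y yd : ℝ → ℝ}
    (hb : ∀ s ∈ I, HasDerivAt b (bd s) s) (hbd : ContinuousOn bd I)
    (hy : ∀ s ∈ I, HasDerivAt y (yd s) s) (hyd : ContinuousOn yd I) (hb0 : ∀ s ∈ I, 0 < b s)
    {t : ℝ} (ht : t ∈ I) :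
    HasDerivAt (fun s => ∫ x, trans (y s) (U s) x * (P (b s * x) * θ x))
      (-(∫ x, trans (y t) (V t) x * (b t * P' (b t * x) * θ x + P (b t * x) * θ' x))
        - yd t * (∫ x, trans (y t) (U t) x * (b t * P' (b t * x) * θ x + P (b t * x) * θ' x))
        + bd t * ∫ x, trans (y t) (U t) x * (x * P' (b t * x) * θ x)) t := by
  have hcP := h.continuous_profile
  have hcP' := h.continuous_deriv_profile
  have hcθ := h.continuous_cutoff
  have hcθ' := h.continuous_deriv_cutoff
  obtain ⟨My, hMy, hy1⟩ := exists_eventually_norm_le hI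
    (fun s hs => (hy s hs).continuousAt.continuousWithinAt) ht
  obtain ⟨Mb, hMb, hb1⟩ := exists_eventually_norm_le hI
    (fun s hs => (hb s hs).continuousAt.continuousWithinAt) ht
  obtain ⟨My', hMy', hyd1⟩ := exists_eventually_norm_le hI hyd ht
  obtain ⟨Mb', hMb', hbd1⟩ := exists_eventually_norm_le hI hbd ht
  set a := min (b t / 2) 1 with ha
  have hbt := hb0 t ht
  have ha0 : 0 < a := lt_min (by positivity) one_pos
  have ha1 : a ≤ 1 := min_le_right _ _
  have hab : ∀ᶠ s in 𝓝 t, a ≤ b s := by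
    have : a < b t := (min_le_left _ _).trans_lt (by linarith)
    exact ((hb t ht).continuousAt.eventually (lt_mem_nhds this)).mono fun _ h => h.le
  obtain ⟨C, hC, hbound⟩ := h.exists_bounds (M := Mb) ha0 ha1
  set g : ℝ → ℝ → ℝ := fun s z => b s * P' (b s * z) * θ z + P (b s * z) * θ' z with hg
  set k : ℝ → ℝ → ℝ := fun s z => z * P' (b s * z) * θ z with hk
  have hgc : ∀ s, Continuous (g s) := fun s => by simp only [hg]; fun_prop
  have hkc : ∀ s, Continuous (k s) := fun s => by simp only [hk]; fun_prop
  have hw : ∀ s x, |y s| ≤ My → weight (x - y s) ≤ 2 * (1 + My ^ 2) * weight x := by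
    intro s x hs
    refine (weight_sub_le x (y s)).trans ?_
    have := weight_pos x
    have h2 : y s ^ 2 ≤ My ^ 2 := by rw [← sq_abs]; gcongr
    gcongr
  have hgm : MemLp (fun x => g t (x - y t)) 2 volume := by
    refine memLp_of_abs_le_weight (C := C * (2 * (1 + My ^ 2)))
      ((hgc t).comp (by fun_prop)).aestronglyMeasurable fun x => ?_
    refine (hbound _ hab.self_of_nhds ((le_abs_self _).trans hb1.self_of_nhds) _).1.trans ?_
    rw [mul_assoc]
    exact mul_le_mul_of_nonneg_left (hw t x hy1.self_of_nhds) hC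
  have hkm : MemLp (fun x => k t (x - y t)) 2 volume := by
    refine memLp_of_abs_le_weight (C := C * (2 * (1 + My ^ 2)))
      ((hkc t).comp (by fun_prop)).aestronglyMeasurable fun x => ?_
    refine (hbound _ hab.self_of_nhds ((le_abs_self _).trans hb1.self_of_nhds) _).2.trans ?_
    rw [mul_assoc]
    exact mul_le_mul_of_nonneg_left (hw t x hy1.self_of_nhds) hC
  have key := hUV.hasDerivAt_integral hI hc ht
    (χ := fun s x => P (b s * (x - y s)) * θ (x - y s))
    (χt := fun s x => -yd s * g s (x - y s) + bd s * k s (x - y s))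
    (χx := fun x => g t (x - y t))
    (B := fun x => (My' + Mb') * (C * (2 * (1 + My ^ 2))) * weight x)
    ?_ ?_ hgm (memLp_weight.const_mul _) ?_ ?_
  · have e0 : ∀ s, ∫ x, U s x * (P (b s * (x - y s)) * θ (x - y s)) =
        ∫ x, trans (y s) (U s) x * (P (b s * x) * θ x) := fun s =>
      integral_mul_comp_sub (U s) (fun x => P (b s * x) * θ x) (y s)
    simp only [e0] at key
    refine key.congr_deriv ?_
    rw [integral_mul_comp_sub _ (g t)]
    have e1 : ∫ x, U t x * (-yd t * g t (x - y t) + bd t * k t (x - y t)) =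
        -yd t * (∫ x, U t x * g t (x - y t)) + bd t * ∫ x, U t x * k t (x - y t) := by
      rw [← integral_const_mul, ← integral_const_mul, ← integral_add]
      · refine integral_congr_ae (Eventually.of_forall fun x => ?_)
        simp only
        ring
      · exact ((Lp.memLp _).integrable_mul hgm).const_mul _
      · exact ((Lp.memLp _).integrable_mul hkm).const_mul _
    rw [e1, integral_mul_comp_sub _ (g t), integral_mul_comp_sub _ (k t)]
    ring
  · filter_upwards [hI.mem_nhds ht, hy1] with s hs hys
    obtain ⟨D, hD⟩ := h.mul_le (b s) (hb0 s hs)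
    have hD0 : 0 ≤ D := by
      have := (abs_nonneg _).trans (hD 0)
      simpa [weight] using this
    refine memLp_of_abs_le_weight (C := D * (2 * (1 + My ^ 2)))
      (by fun_prop : Continuous fun x => P (b s * (x - y s)) * θ (x - y s)).aestronglyMeasurable
      fun x => (hD _).trans ?_
    rw [mul_assoc]
    exact mul_le_mul_of_nonneg_left (hw s x hys) hD0
  · intro x
    have d1 : HasDerivAt (fun x => x - y t) 1 x := (hasDerivAt_id x).sub_const _
    have d2 := (h.hasDerivAt_profile (b t * (x - y t))).comp x (d1.const_mul (b t))
    have d3 := (h.hasDerivAt_cutoff (x - y t)).comp x d1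
    refine (d2.mul d3).congr_deriv ?_
    simp only [hg, Function.comp_apply]
    ring
  · filter_upwards [hI.mem_nhds ht, hy1, hb1, hyd1, hbd1, hab] with s hs hys hbs hyds hbds habs x
    constructor
    · have d1 : HasDerivAt (fun s => x - y s) (-yd s) s := (hy s hs).const_sub x
      have d2 := (h.hasDerivAt_profile (b s * (x - y s))).comp s ((hb s hs).mul d1)
      have d3 := (h.hasDerivAt_cutoff (x - y s)).comp s d1
      refine (d2.mul d3).congr_deriv ?_
      simp only [hg, hk, Function.comp_apply, Pi.mul_apply]
      ring
    · rw [Real.norm_eq_abs] at hys hbs hyds hbds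
      obtain ⟨q1, q2⟩ := hbound (b s) habs ((le_abs_self _).trans hbs) (x - y s)
      calc |-yd s * g s (x - y s) + bd s * k s (x - y s)|
          ≤ |yd s| * |g s (x - y s)| + |bd s| * |k s (x - y s)| := by
            refine (abs_add_le _ _).trans_eq ?_
            rw [abs_mul, abs_mul, abs_neg]
        _ ≤ My' * (C * weight (x - y s)) + Mb' * (C * weight (x - y s)) := by gcongr
        _ = (My' + Mb') * (C * weight (x - y s)) := by ring
        _ ≤ (My' + Mb') * (C * (2 * (1 + My ^ 2) * weight x)) := by
            gcongr
            exact hw s x hys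
        _ = _ := by ring
  · exact ((((hgc t).comp (by fun_prop : Continuous fun x => x - y t)).const_mul _).add
      (((hkc t).comp (by fun_prop : Continuous fun x => x - y t)).const_mul _)).aestronglyMeasurable

end IsCutProfile

/-! ### The profile `cosh^{-q}` and its odd primitive -/

/-- The derivative of `prof q`. -/
def dprof (q z : ℝ) : ℝ := Real.sinh z * -q * Real.cosh z ^ (-q - 1)

theorem hasDerivAt_prof (q z : ℝ) : HasDerivAt (prof q) (dprof q z) z :=
  (Real.hasDerivAt_cosh z).rpow_const (Or.inl (Real.cosh_pos z).ne')

theorem prof_pos (q z : ℝ) : 0 < prof q z := Real.rpow_pos_of_pos (Real.cosh_pos z) _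

theorem prof_neg (q z : ℝ) : prof q (-z) = prof q z := by rw [prof, prof, Real.cosh_neg]

theorem dprof_neg (q z : ℝ) : dprof q (-z) = -dprof q z := by
  rw [dprof, dprof, Real.cosh_neg, Real.sinh_neg]
  ring

theorem continuous_prof (q : ℝ) : Continuous (prof q) :=
  continuous_iff_continuousAt.2 fun x => (hasDerivAt_prof q x).continuousAt

theorem continuous_dprof (q : ℝ) : Continuous (dprof q) :=
  (Real.continuous_sinh.mul continuous_const).mul
    (Real.continuous_cosh.rpow_const fun x => Or.inl (Real.cosh_pos x).ne')

theorem abs_dprof_le {q : ℝ} (hq : 0 ≤ q) (z : ℝ) : |dprof q z| ≤ q * prof q z := by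
  have h1 : |Real.sinh z| ≤ Real.cosh z := by
    rw [abs_le]
    constructor
    · linarith [Real.exp_pos z, Real.cosh_add_sinh z]
    · linarith [Real.exp_pos (-z), Real.cosh_sub_sinh z]
  have h2 : prof q z = Real.cosh z * Real.cosh z ^ (-q - 1) := by
    rw [mul_comm, ← Real.rpow_add_one (Real.cosh_pos z).ne', sub_add_cancel, prof]
  have h3 : 0 < Real.cosh z ^ (-q - 1) := Real.rpow_pos_of_pos (Real.cosh_pos z) _
  rw [dprof, abs_mul, abs_mul, abs_neg, abs_of_nonneg hq, abs_of_pos h3, h2]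
  calc |Real.sinh z| * q * Real.cosh z ^ (-q - 1) ≤ Real.cosh z * q * Real.cosh z ^ (-q - 1) := by
        gcongr
    _ = _ := by ring

/-- The cube leaves one weight after multiplication by up to `|x|³`: one factor from dilation and
two from `exp(-εx²) - 1`. It comes from the sixth power of `m(1 + |z|) ≤ exp(q|z|/6)`. -/
theorem exists_prof_le {q : ℝ} (hq : 0 < q) : ∃ C, 0 < C ∧ ∀ z, prof q z ≤ C * weight z ^ 3 := by
  set m := min 1 (q / 6) with hm
  have hm0 : 0 < m := lt_min one_pos (by positivity)
  refine ⟨2 ^ q * (m ^ 6)⁻¹, by positivity, fun z => ?_⟩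
  have h1 : Real.exp |z| / 2 ≤ Real.cosh z := by
    rw [← Real.cosh_abs, Real.cosh_eq]
    linarith [Real.exp_pos (-|z|)]
  have h2 : prof q z ≤ 2 ^ q * (Real.exp (q * |z|))⁻¹ := by
    refine (Real.rpow_le_rpow_of_nonpos (by positivity) h1 (by linarith)).trans_eq ?_
    rw [Real.div_rpow (Real.exp_pos _).le (by norm_num), ← Real.exp_mul, Real.rpow_neg (by norm_num),
      div_inv_eq_mul, ← Real.exp_neg, mul_comm]
    congr 2
    ring
  refine h2.trans ?_
  have h3 : (m * (1 + |z|)) ^ 6 ≤ Real.exp (q * |z|) := by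
    have h4 : m * (1 + |z|) ≤ Real.exp (q / 6 * |z|) := by
      have := Real.add_one_le_exp (q / 6 * |z|)
      have h5 : m * |z| ≤ q / 6 * |z| := by
        gcongr
        exact min_le_right _ _
      have h6 : m ≤ 1 := min_le_left _ _
      linarith
    calc (m * (1 + |z|)) ^ 6 ≤ Real.exp (q / 6 * |z|) ^ 6 := by gcongr
      _ = Real.exp (q * |z|) := by
        rw [← Real.exp_nat_mul]
        congr 1
        push_cast
        ring
  have h7 : 1 + z ^ 2 ≤ (1 + |z|) ^ 2 := by nlinarith [abs_nonneg z, sq_abs z]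
  rw [mul_assoc, weight, inv_pow, ← mul_inv]
  gcongr
  calc m ^ 6 * (1 + z ^ 2) ^ 3 ≤ m ^ 6 * ((1 + |z|) ^ 2) ^ 3 := by gcongr
    _ = (m * (1 + |z|)) ^ 6 := by ring
    _ ≤ _ := h3

/-- The odd primitive of the profile is bounded. -/
theorem exists_oddPrimitive_prof_le {q : ℝ} (hq : 0 < q) :
    ∃ C, 0 ≤ C ∧ ∀ z, |oddPrimitive (prof q) z| ≤ C := by
  obtain ⟨C, hC, h⟩ := exists_prof_le hq
  have hle : ∀ z, ‖prof q z‖ ≤ C * weight z := fun z => by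
    rw [Real.norm_of_nonneg (prof_pos q z).le]
    refine (h z).trans ?_
    have h0 := (weight_pos z).le
    gcongr
    exact pow_le_of_le_one h0 (weight_le_one z) (by norm_num)
  have hi : Integrable (prof q) :=
    (integrable_weight.const_mul C).mono' (continuous_prof q).aestronglyMeasurable
      (Eventually.of_forall hle)
  refine ⟨∫ x, ‖prof q x‖, integral_nonneg fun _ => norm_nonneg _, fun z => ?_⟩
  have h1 : ‖∫ s in (0 : ℝ)..z, prof q s‖ ≤ ∫ s in uIoc 0 z, ‖prof q s‖ :=
    intervalIntegral.norm_integral_le_integral_norm_uIoc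
  exact h1.trans (setIntegral_le_integral hi.norm (Eventually.of_forall fun _ => norm_nonneg _))

theorem hasDerivAt_oddPrimitive_prof (q z : ℝ) :
    HasDerivAt (oddPrimitive (prof q)) (prof q z) z :=
  ((continuous_prof q).integral_hasStrictDerivAt 0 z).hasDerivAt

theorem isCutProfile_prof {q : ℝ} (hq : 0 < q) :
    IsCutProfile (prof q) (dprof q) (fun _ => 1) fun _ => 0 := by
  obtain ⟨C, hC, h⟩ := exists_prof_le hq
  have hw : ∀ z, weight z ^ 3 ≤ weight z ^ 2 := fun z =>
    pow_le_pow_of_le_one (weight_pos z).le (weight_le_one z) (by norm_num)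
  have hw1 : ∀ z, weight z ^ 2 ≤ weight z := fun z =>
    pow_le_of_le_one (weight_pos z).le (weight_le_one z) (by norm_num)
  constructor
  · exact hasDerivAt_prof q
  · exact continuous_dprof q
  · refine ⟨C, fun z => ?_⟩
    rw [abs_of_pos (prof_pos q z)]
    refine (h z).trans (mul_le_of_le_one_right hC.le (pow_le_one₀ (weight_pos z).le
      (weight_le_one z)))
  · refine ⟨q * C, fun z => (abs_dprof_le hq.le z).trans ?_⟩
    rw [mul_assoc]
    gcongr
    exact (h z).trans (mul_le_mul_of_nonneg_left (hw z) hC.le)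
  · exact fun x => hasDerivAt_const x 1
  · exact continuous_const
  · simp
  · exact ⟨0, fun x => by simp⟩
  · intro b hb
    refine ⟨C * ((min b 1) ^ 2)⁻¹, fun x => ?_⟩
    rw [mul_one, abs_of_pos (prof_pos _ _), mul_assoc]
    refine (h _).trans (mul_le_mul_of_nonneg_left (((hw _).trans (hw1 _)).trans ?_) hC.le)
    exact weight_mul_le (lt_min hb one_pos) (min_le_right _ _) (min_le_left _ _) x

/-! ### Gaussian cutoffs and Abel summation -/

theorem hasDerivAt_gauss (ε x : ℝ) :
    HasDerivAt (fun x : ℝ => Real.exp (-ε * x ^ 2)) (-(2 * ε * x * Real.exp (-ε * x ^ 2))) x := by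
  refine (((hasDerivAt_pow 2 x).const_mul (-ε)).exp).congr_deriv ?_
  norm_num
  ring

theorem gauss_le_weight_sq {ε : ℝ} (hε : 0 < ε) :
    ∃ C, 0 < C ∧ ∀ x, Real.exp (-ε * x ^ 2) ≤ C * weight x ^ 2 := by
  set m := min 1 (ε / 2) with hm
  have hm0 : 0 < m := lt_min one_pos (by positivity)
  refine ⟨(m ^ 2)⁻¹, by positivity, fun x => ?_⟩
  have h1 : m * (1 + x ^ 2) ≤ Real.exp (ε / 2 * x ^ 2) := by
    have h2 := Real.add_one_le_exp (ε / 2 * x ^ 2)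
    have h3 : m * x ^ 2 ≤ ε / 2 * x ^ 2 := by
      gcongr
      exact min_le_right _ _
    have h4 : m ≤ 1 := min_le_left _ _
    linarith
  have h5 : Real.exp (-ε * x ^ 2) = (Real.exp (ε / 2 * x ^ 2) ^ 2)⁻¹ := by
    rw [← Real.exp_nat_mul, ← Real.exp_neg]
    congr 1
    push_cast
    ring
  rw [h5, weight, inv_pow, ← mul_inv, ← mul_pow]
  gcongr

/-- The primitive is bounded but has nonzero limits at infinity; the Gaussian factor makes it an
admissible `L²` test function. -/
theorem isCutProfile_oddPrimitive_prof {q : ℝ} (hq : 0 < q) {ε : ℝ} (hε : 0 < ε) :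
    IsCutProfile (oddPrimitive (prof q)) (prof q) (fun x => Real.exp (-ε * x ^ 2))
      fun x => -(2 * ε * x * Real.exp (-ε * x ^ 2)) := by
  obtain ⟨C, hC, h⟩ := exists_prof_le hq
  obtain ⟨D, hD, hG⟩ := exists_oddPrimitive_prof_le hq
  obtain ⟨A, hA, hgauss⟩ := gauss_le_weight_sq hε
  have hw1 : ∀ z, weight z ^ 2 ≤ weight z := fun z =>
    pow_le_of_le_one (weight_pos z).le (weight_le_one z) (by norm_num)
  constructor
  · exact hasDerivAt_oddPrimitive_prof q
  · exact continuous_prof q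
  · exact ⟨D, hG⟩
  · refine ⟨C, fun z => ?_⟩
    rw [abs_of_pos (prof_pos q z)]
    exact (h z).trans (mul_le_mul_of_nonneg_left
      (pow_le_pow_of_le_one (weight_pos z).le (weight_le_one z) (by norm_num)) hC.le)
  · exact hasDerivAt_gauss ε
  · fun_prop
  · intro x
    rw [abs_of_pos (Real.exp_pos _), Real.exp_le_one_iff]
    nlinarith [mul_nonneg hε.le (sq_nonneg x)]
  · refine ⟨2 * ε * A, fun x => ?_⟩
    rw [abs_neg, abs_mul, abs_mul, abs_of_pos (Real.exp_pos _), abs_of_pos (by positivity)]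
    have hwp := (weight_pos x).le
    calc 2 * ε * |x| * Real.exp (-ε * x ^ 2) ≤ 2 * ε * |x| * (A * weight x ^ 2) := by
          gcongr
          exact hgauss x
      _ = 2 * ε * A * weight x * (|x| * weight x) := by ring
      _ ≤ 2 * ε * A * weight x * 1 := by
          gcongr
          exact abs_mul_weight_le x
      _ = _ := mul_one _
  · intro b _
    refine ⟨D * A, fun x => ?_⟩
    rw [abs_mul, abs_of_pos (Real.exp_pos _), mul_assoc]
    gcongr
    · exact hG _
    · exact (hgauss x).trans (mul_le_mul_of_nonneg_left (hw1 x) hA.le)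

theorem integral_Ioi_gauss {ε : ℝ} (hε : 0 < ε) {a : ℝ} (ha : 0 ≤ a) :
    IntegrableOn (fun r => 2 * ε * r * Real.exp (-ε * r ^ 2)) (Ioi a) ∧
      ∫ r in Ioi a, 2 * ε * r * Real.exp (-ε * r ^ 2) = Real.exp (-ε * a ^ 2) := by
  have hd : ∀ x ∈ Ici a, HasDerivAt (fun r : ℝ => -Real.exp (-ε * r ^ 2))
      (2 * ε * x * Real.exp (-ε * x ^ 2)) x := fun x _ =>
    (hasDerivAt_gauss ε x).neg.congr_deriv (neg_neg _)
  have hpos : ∀ x ∈ Ioi a, 0 ≤ 2 * ε * x * Real.exp (-ε * x ^ 2) := fun x hx => by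
    have : 0 < x := ha.trans_lt hx
    positivity
  have hl : Tendsto (fun r : ℝ => -Real.exp (-ε * r ^ 2)) atTop (𝓝 0) := by
    rw [← neg_zero]
    refine (Real.tendsto_exp_atBot.comp ?_).neg
    exact (tendsto_pow_atTop (two_ne_zero)).const_mul_atTop_of_neg (by linarith)
  refine ⟨integrableOn_Ioi_deriv_of_nonneg' hd hpos hl, ?_⟩
  rw [integral_Ioi_of_hasDerivAt_of_nonneg' hd hpos hl]
  ring

theorem integrable_mul_gauss {h : ℝ → ℝ} (hh : MemLp h 2 volume) {ε : ℝ} (hε : 0 < ε) :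
    Integrable fun x => h x * Real.exp (-ε * x ^ 2) := by
  obtain ⟨A, hA, hgauss⟩ := gauss_le_weight_sq hε
  suffices hm : MemLp (fun x : ℝ => Real.exp (-ε * x ^ 2)) 2 volume from hh.integrable_mul hm
  refine memLp_of_abs_le_weight (C := A) (by fun_prop : Continuous fun x : ℝ =>
    Real.exp (-ε * x ^ 2)).aestronglyMeasurable fun x => ?_
  rw [abs_of_pos (Real.exp_pos _)]
  exact (hgauss x).trans (mul_le_mul_of_nonneg_left
    (pow_le_of_le_one (weight_pos x).le (weight_le_one x) (by norm_num)) hA.le)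

/-- As `exp(-εx²)` is the integral of `2εr exp(-εr²)` over `r > |x|`, Fubini turns the Gaussian mean
into a weighted average, of total mass one, of the symmetric partial integrals. -/
theorem integral_mul_gauss {h : ℝ → ℝ} (hh : MemLp h 2 volume) {ε : ℝ} (hε : 0 < ε) :
    ∫ x, h x * Real.exp (-ε * x ^ 2) =
      ∫ r in Ioi (0 : ℝ), 2 * ε * r * Real.exp (-ε * r ^ 2) * ∫ x in (-r)..r, h x := by
  set k : ℝ → ℝ := fun r => 2 * ε * r * Real.exp (-ε * r ^ 2) with hk
  have hkc : Continuous k := by simp only [hk]; fun_prop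
  set Φ : ℝ → ℝ → ℝ := fun x r => h x * (Ioi |x|).indicator k r with hΦ
  have hnn : ∀ x r, 0 ≤ (Ioi |x|).indicator k r := fun x r =>
    indicator_nonneg (fun r hr => by
      have : 0 < r := (abs_nonneg x).trans_lt hr
      simp only [hk]
      positivity) r
  have hint : ∀ x, ∫ r, (Ioi |x|).indicator k r = Real.exp (-ε * x ^ 2) := fun x => by
    rw [integral_indicator measurableSet_Ioi, (integral_Ioi_gauss hε (abs_nonneg x)).2, sq_abs]
  have hmeas : AEStronglyMeasurable (Function.uncurry Φ) (volume.prod volume) := by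
    have e : Function.uncurry Φ = fun z : ℝ × ℝ =>
        h z.1 * {z : ℝ × ℝ | |z.1| < z.2}.indicator (fun z => k z.2) z := by
      funext z
      simp only [Function.uncurry, hΦ, indicator, mem_Ioi, mem_ofPred_eq]
    rw [e]
    refine hh.1.comp_fst.mul ?_
    exact ((hkc.comp continuous_snd).aestronglyMeasurable).indicator
      (isOpen_lt (continuous_abs.comp continuous_fst) continuous_snd).measurableSet
  have hΦi : Integrable (Function.uncurry Φ) (volume.prod volume) := by
    rw [integrable_prod_iff hmeas]
    constructor
    · refine Eventually.of_forall fun x => ?_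
      suffices hi : Integrable ((Ioi |x|).indicator k) from hi.const_mul (h x)
      rw [integrable_indicator_iff measurableSet_Ioi]
      exact (integral_Ioi_gauss hε (abs_nonneg x)).1
    · refine (integrable_mul_gauss hh hε).norm.congr (Eventually.of_forall fun x => ?_)
      simp only [Function.uncurry, hΦ, norm_mul]
      rw [integral_const_mul]
      congr 1
      rw [Real.norm_of_nonneg (Real.exp_pos _).le, ← hint x]
      refine integral_congr_ae (Eventually.of_forall fun r => ?_)
      exact (Real.norm_of_nonneg (hnn x r)).symm
  have hswap := integral_integral_swap hΦi
  have e1 : ∫ x, ∫ r, Φ x r = ∫ x, h x * Real.exp (-ε * x ^ 2) := by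
    refine integral_congr_ae (Eventually.of_forall fun x => ?_)
    simp only [hΦ]
    rw [integral_const_mul, hint]
  rw [← e1, hswap, ← integral_indicator measurableSet_Ioi]
  refine integral_congr_ae (Eventually.of_forall fun r => ?_)
  simp only
  by_cases hr : 0 < r
  · rw [indicator_of_mem (mem_Ioi.2 hr), intervalIntegral.integral_of_le (by linarith),
      ← integral_Ioc_eq_integral_Ioo.symm, ← integral_const_mul,
      ← integral_indicator measurableSet_Ioo]
    refine integral_congr_ae (Eventually.of_forall fun x => ?_)
    simp only [hΦ, indicator, mem_Ioi, mem_Ioo, abs_lt]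
    split_ifs <;> ring
  · rw [indicator_of_notMem (by simpa using hr)]
    refine integral_eq_zero_of_ae (Eventually.of_forall fun x => ?_)
    simp only [hΦ]
    rw [indicator_of_notMem (by
      simp only [mem_Ioi, not_lt]
      exact (not_lt.1 hr).trans (abs_nonneg x))]
    simp

/-- Abel's theorem: Gaussian summability of a convergent improper integral. -/
theorem tendsto_integral_mul_gauss {h : ℝ → ℝ} (hh : MemLp h 2 volume)
    (hR : Tendsto (fun R : ℝ => ∫ x in (-R)..R, h x) atTop (𝓝 0)) :
    Tendsto (fun ε : ℝ => ∫ x, h x * Real.exp (-ε * x ^ 2)) (𝓝[>] 0) (𝓝 0) := by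
  have hli := hh.locallyIntegrable (by norm_num)
  rw [Metric.tendsto_nhds]
  intro η hη
  obtain ⟨R0, hR0⟩ := eventually_atTop.1 ((Metric.tendsto_nhds.1 hR) (η / 2) (by positivity))
  set R := max R0 0
  set M := ∫ x in Ioc (-R) R, ‖h x‖ with hM
  have hM0 : 0 ≤ M := integral_nonneg fun _ => norm_nonneg _
  -- For `r ≤ R` the crude bound `M` is enlarged to `M exp(R² - r²)`. This keeps the weight
  -- Gaussian, with `ε + 1` in place of `ε`, and contributes `M exp(R²) ε/(ε + 1)`, which tends to
  -- `0`.
  have hF : ∀ r ∈ Ioi (0 : ℝ), ‖∫ x in (-r)..r, h x‖ ≤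
      η / 2 + M * Real.exp (R ^ 2) * Real.exp (-1 * r ^ 2) := by
    intro r hr
    have hr : 0 < r := hr
    rcases le_total R r with hRr | hRr
    · have := hR0 r ((le_max_left _ _).trans hRr)
      rw [dist_zero_right] at this
      have : 0 ≤ M * Real.exp (R ^ 2) * Real.exp (-1 * r ^ 2) := by positivity
      linarith
    · have h1 : ‖∫ x in (-r)..r, h x‖ ≤ M := by
        refine (intervalIntegral.norm_integral_le_integral_norm (by linarith)).trans ?_
        rw [intervalIntegral.integral_of_le (by linarith)]
        refine setIntegral_mono_set ?_ (Eventually.of_forall fun _ => norm_nonneg _)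
          (Ioc_subset_Ioc (by linarith) hRr).eventuallyLE
        exact ((hli.integrableOn_isCompact isCompact_Icc).mono_set Ioc_subset_Icc_self).norm
      have h2 : 1 ≤ Real.exp (R ^ 2) * Real.exp (-1 * r ^ 2) := by
        rw [← Real.exp_add, Real.one_le_exp_iff]
        nlinarith
      nlinarith
  have hlim : Tendsto (fun ε : ℝ => η / 2 + M * Real.exp (R ^ 2) * (ε / (ε + 1))) (𝓝[>] 0)
      (𝓝 (η / 2)) := by
    have : ContinuousAt (fun ε : ℝ => η / 2 + M * Real.exp (R ^ 2) * (ε / (ε + 1))) 0 := by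
      refine continuousAt_const.add (continuousAt_const.mul ?_)
      exact continuousAt_id.div (continuousAt_id.add continuousAt_const) (by norm_num)
    have h1 := this.tendsto
    simp only [zero_div, mul_zero, add_zero] at h1
    exact h1.mono_left nhdsWithin_le_nhds
  filter_upwards [self_mem_nhdsWithin, hlim.eventually (gt_mem_nhds (by linarith : η / 2 < η))]
    with ε hε hlt
  have hε : 0 < ε := hε
  rw [dist_zero_right, integral_mul_gauss hh hε]
  refine lt_of_le_of_lt ?_ hlt
  obtain ⟨i1, j1⟩ := integral_Ioi_gauss hε (le_refl (0 : ℝ))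
  obtain ⟨i2, j2⟩ := integral_Ioi_gauss (by linarith : 0 < ε + 1) (le_refl (0 : ℝ))
  have hbd : ∀ r ∈ Ioi (0 : ℝ), ‖2 * ε * r * Real.exp (-ε * r ^ 2) * ∫ x in (-r)..r, h x‖ ≤
      η / 2 * (2 * ε * r * Real.exp (-ε * r ^ 2)) + M * Real.exp (R ^ 2) * (ε / (ε + 1)) *
        (2 * (ε + 1) * r * Real.exp (-(ε + 1) * r ^ 2)) := by
    intro r hr
    have hr0 : 0 < r := hr
    have e1 : Real.exp (-(ε + 1) * r ^ 2) = Real.exp (-ε * r ^ 2) * Real.exp (-1 * r ^ 2) := by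
      rw [← Real.exp_add]
      congr 1
      ring
    rw [norm_mul, Real.norm_of_nonneg (by positivity), e1]
    refine (mul_le_mul_of_nonneg_left (hF r hr) (by positivity)).trans_eq ?_
    field_simp
  refine (norm_integral_le_of_norm_le ((i1.const_mul _).add (i2.const_mul _))
    ((ae_restrict_iff' measurableSet_Ioi).2 (Eventually.of_forall hbd))).trans_eq ?_
  rw [integral_add' (i1.const_mul _) (i2.const_mul _), integral_const_mul, integral_const_mul,
    j1, j2]
  simp

theorem abs_integral_mul_le_norm (f : L2) {g : ℝ → ℝ} (hg : MemLp g 2 volume) :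
    |∫ x, f x * g x| ≤ ‖f‖ * ‖hg.toLp g‖ := by
  rw [← inner_toLp f hg]
  exact abs_real_inner_le_norm _ _

theorem memLp_deriv_gauss {ε : ℝ} (hε : 0 < ε) :
    MemLp (fun x => -(2 * ε * x * Real.exp (-ε * x ^ 2))) 2 volume := by
  obtain ⟨C, hC⟩ := (isCutProfile_oddPrimitive_prof one_pos hε).deriv_cutoff_le
  exact memLp_of_abs_le_weight (by fun_prop : Continuous fun x : ℝ =>
    -(2 * ε * x * Real.exp (-ε * x ^ 2))).aestronglyMeasurable hC

/-- The derivative of the cutoff is `O(ε^{1/4})` in `L²` as `ε → 0`. Paired with an `L²` function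
times a bounded one, it disappears in the limit. -/
theorem norm_deriv_gauss_le {ε : ℝ} (hε : 0 < ε) :
    ‖(memLp_deriv_gauss hε).toLp _‖ ≤ Real.sqrt (4 * Real.sqrt (Real.pi * ε)) := by
  refine Real.le_sqrt_of_sq_le ?_
  rw [norm_toLp_sq]
  have h1 : ∫ x, 4 * ε * Real.exp (-ε * x ^ 2) = 4 * Real.sqrt (Real.pi * ε) := by
    rw [integral_const_mul, integral_gaussian, mul_assoc]
    congr 1
    have : Real.sqrt (Real.pi * ε) = Real.sqrt (ε ^ 2 * (Real.pi / ε)) := by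
      congr 1
      field_simp
    rw [this, Real.sqrt_mul (by positivity), Real.sqrt_sq hε.le]
  rw [← h1]
  refine integral_mono_of_nonneg (Eventually.of_forall fun x => sq_nonneg _)
    ((integrable_exp_neg_mul_sq hε).const_mul _) (Eventually.of_forall fun x => ?_)
  have h2 : ε * x ^ 2 * Real.exp (-ε * x ^ 2) ≤ 1 := by
    have h3 := Real.add_one_le_exp (ε * x ^ 2)
    have h4 : Real.exp (ε * x ^ 2) * Real.exp (-ε * x ^ 2) = 1 := by
      rw [← Real.exp_add]; simp
    rw [← h4]
    have := Real.exp_pos (-ε * x ^ 2)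
    gcongr
    linarith
  calc (-(2 * ε * x * Real.exp (-ε * x ^ 2))) ^ 2
      = 4 * ε * Real.exp (-ε * x ^ 2) * (ε * x ^ 2 * Real.exp (-ε * x ^ 2)) := by ring
    _ ≤ 4 * ε * Real.exp (-ε * x ^ 2) * 1 := by
        have := Real.exp_pos (-ε * x ^ 2)
        gcongr
    _ = _ := mul_one _

/-! ### Removing the Gaussian cutoff -/

theorem exists_prof_mul_le {q : ℝ} (hq : 0 < q) {a : ℝ} (ha : 0 < a) (ha1 : a ≤ 1) :
    ∃ C, 0 < C ∧ ∀ b, a ≤ b → ∀ x, prof q (b * x) ≤ C * weight x ^ 3 := by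
  obtain ⟨C, hC, h⟩ := exists_prof_le hq
  refine ⟨C * (a ^ 2)⁻¹ ^ 3, by positivity, fun b hab x => (h _).trans ?_⟩
  have := weight_mul_le ha ha1 hab x
  have := (weight_pos (b * x)).le
  rw [mul_assoc, ← mul_pow]
  gcongr

theorem sq_mul_weight_pow_le (x : ℝ) : x ^ 2 * weight x ^ 3 ≤ weight x := by
  have h0 := weight_pos x
  calc x ^ 2 * weight x ^ 3 = (x ^ 2 * weight x) * weight x * weight x := by ring
    _ ≤ 1 * 1 * weight x := by
      gcongr
      · exact sq_mul_weight_le x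
      · exact weight_le_one x
    _ = weight x := by ring

theorem abs_pow_mul_weight_pow_le (x : ℝ) : |x| ^ 3 * weight x ^ 3 ≤ weight x := by
  have h0 := weight_pos x
  calc |x| ^ 3 * weight x ^ 3 = (x ^ 2 * weight x) * (|x| * weight x) * weight x := by
        rw [← sq_abs x]; ring
    _ ≤ 1 * 1 * weight x := by
      gcongr
      · exact sq_mul_weight_le x
      · exact abs_mul_weight_le x
    _ = weight x := by ring

theorem abs_mul_weight_pow_le (x : ℝ) : |x| * weight x ^ 3 ≤ weight x := by
  have h0 := weight_pos x
  calc |x| * weight x ^ 3 = weight x * (|x| * weight x) * weight x := by ring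
    _ ≤ 1 * 1 * weight x := by
      gcongr
      · exact weight_le_one x
      · exact abs_mul_weight_le x
    _ = weight x := by ring

theorem weight_pow_le (x : ℝ) : weight x ^ 3 ≤ weight x :=
  pow_le_of_le_one (weight_pos x).le (weight_le_one x) (by norm_num)

theorem memLp_prof {q : ℝ} (hq : 0 < q) {b : ℝ} (hb : 0 < b) :
    MemLp (fun x => prof q (b * x)) 2 volume := by
  obtain ⟨C, hC, h⟩ := exists_prof_mul_le hq (lt_min hb one_pos) (min_le_right b 1)
  refine memLp_of_abs_le_weight (C := C)
    ((continuous_prof q).comp (continuous_const_mul b)).aestronglyMeasurable fun x => ?_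
  rw [abs_of_pos (prof_pos _ _)]
  exact (h b (min_le_left _ _) x).trans (mul_le_mul_of_nonneg_left (weight_pow_le x) hC.le)

theorem memLp_mul_prof {q : ℝ} (hq : 0 < q) {b : ℝ} (hb : 0 < b) :
    MemLp (fun x => x * prof q (b * x)) 2 volume := by
  obtain ⟨C, hC, h⟩ := exists_prof_mul_le hq (lt_min hb one_pos) (min_le_right b 1)
  refine memLp_of_abs_le_weight (C := C)
    (continuous_id.mul ((continuous_prof q).comp (continuous_const_mul b))).aestronglyMeasurable
    fun x => ?_
  rw [abs_mul, abs_of_pos (prof_pos _ _)]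
  calc |x| * prof q (b * x) ≤ |x| * (C * weight x ^ 3) := by
        gcongr
        exact h b (min_le_left _ _) x
    _ = C * (|x| * weight x ^ 3) := by ring
    _ ≤ _ := mul_le_mul_of_nonneg_left (abs_mul_weight_pow_le x) hC.le

theorem abs_gauss_sub_one_le {ε : ℝ} (hε : 0 < ε) (x : ℝ) :
    |Real.exp (-ε * x ^ 2) - 1| ≤ ε * x ^ 2 := by
  have h1 := Real.add_one_le_exp (-ε * x ^ 2)
  have h2 : Real.exp (-ε * x ^ 2) ≤ 1 := by
    rw [Real.exp_le_one_iff]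
    nlinarith [mul_nonneg hε.le (sq_nonneg x)]
  rw [abs_sub_comm, abs_of_nonneg (by linarith)]
  linarith

/-- Replacing the cutoff by `1` on decaying terms costs `εx²`, which the profile absorbs; the other
error is the derivative of the cutoff. The constant is uniform in `b`, as is needed for convergence
that is uniform in time. -/
theorem exists_gauss_error_le {q : ℝ} (hq : 0 < q) {a M : ℝ} (ha : 0 < a) (ha1 : a ≤ 1) :
    ∃ K, 0 ≤ K ∧ ∀ b, a ≤ b → b ≤ M → ∀ ε, 0 < ε → ∀ f : L2,
      |(∫ x, f x * (b * prof q (b * x) * Real.exp (-ε * x ^ 2) +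
          oddPrimitive (prof q) (b * x) * -(2 * ε * x * Real.exp (-ε * x ^ 2)))) -
        ∫ x, f x * (b * prof q (b * x))| ≤
          ‖f‖ * (K * (ε + Real.sqrt (4 * Real.sqrt (Real.pi * ε)))) ∧
      |(∫ x, f x * (x * prof q (b * x) * Real.exp (-ε * x ^ 2))) -
        ∫ x, f x * (x * prof q (b * x))| ≤
          ‖f‖ * (K * (ε + Real.sqrt (4 * Real.sqrt (Real.pi * ε)))) := by
  obtain ⟨C, hC, h⟩ := exists_prof_mul_le hq ha ha1
  obtain ⟨D, hD, hG⟩ := exists_oddPrimitive_prof_le hq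
  set N := ‖memLp_weight.toLp weight‖ with hN
  have hN0 : 0 ≤ N := norm_nonneg _
  refine ⟨|M| * C * N + C * N + D, by positivity, fun b hab hbM ε hε f => ?_⟩
  have hb : 0 < b := ha.trans_le hab
  set n := Real.sqrt (4 * Real.sqrt (Real.pi * ε)) with hn
  have hn0 : 0 ≤ n := Real.sqrt_nonneg _
  have hp := fun x => (prof_pos q (b * x)).le
  have hc : Continuous fun x => prof q (b * x) :=
    (continuous_prof q).comp (continuous_const_mul b)
  have hcG : Continuous fun x => oddPrimitive (prof q) (b * x) :=
    (isCutProfile_oddPrimitive_prof hq hε).continuous_profile.comp (continuous_const_mul b)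
  have b1 : ∀ x, |b * prof q (b * x) * (Real.exp (-ε * x ^ 2) - 1)| ≤
      (ε * (|M| * C)) * weight x := by
    intro x
    rw [abs_mul, abs_of_nonneg (mul_nonneg hb.le (hp x))]
    calc b * prof q (b * x) * |Real.exp (-ε * x ^ 2) - 1|
        ≤ |M| * (C * weight x ^ 3) * (ε * x ^ 2) := by
          have := hp x
          have := (weight_pos x).le
          gcongr
          · exact hbM.trans (le_abs_self M)
          · exact h b hab x
          · exact abs_gauss_sub_one_le hε x
      _ = (ε * (|M| * C)) * (x ^ 2 * weight x ^ 3) := by ring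
      _ ≤ _ := by
          gcongr
          exact sq_mul_weight_pow_le x
  have b2 : ∀ x, |x * prof q (b * x) * (Real.exp (-ε * x ^ 2) - 1)| ≤ (ε * C) * weight x := by
    intro x
    rw [abs_mul, abs_mul, abs_of_nonneg (hp x)]
    calc |x| * prof q (b * x) * |Real.exp (-ε * x ^ 2) - 1|
        ≤ |x| * (C * weight x ^ 3) * (ε * x ^ 2) := by
          have := hp x
          have := (weight_pos x).le
          gcongr
          · exact h b hab x
          · exact abs_gauss_sub_one_le hε x
      _ = (ε * C) * (|x| ^ 3 * weight x ^ 3) := by rw [← sq_abs x]; ring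
      _ ≤ _ := by
          gcongr
          exact abs_pow_mul_weight_pow_le x
  have c1 : Continuous fun x => b * prof q (b * x) * (Real.exp (-ε * x ^ 2) - 1) := by fun_prop
  have c2 : Continuous fun x => x * prof q (b * x) * (Real.exp (-ε * x ^ 2) - 1) := by fun_prop
  have m0 : MemLp (fun x => b * prof q (b * x)) 2 volume := (memLp_prof hq hb).const_mul b
  have m0' := memLp_mul_prof hq hb
  have m1 := memLp_of_abs_le_weight c1.aestronglyMeasurable b1
  have m2 := memLp_of_abs_le_weight c2.aestronglyMeasurable b2
  have hbd : ∀ᵐ x, ‖oddPrimitive (prof q) (b * x) * -(2 * ε * x * Real.exp (-ε * x ^ 2))‖ ≤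
      D * ‖-(2 * ε * x * Real.exp (-ε * x ^ 2))‖ := Eventually.of_forall fun x => by
    rw [norm_mul]
    exact mul_le_mul_of_nonneg_right (hG _) (norm_nonneg _)
  have m3 : MemLp (fun x => oddPrimitive (prof q) (b * x) *
      -(2 * ε * x * Real.exp (-ε * x ^ 2))) 2 volume :=
    (memLp_deriv_gauss hε).of_le_mul
      (hcG.aestronglyMeasurable.mul (memLp_deriv_gauss hε).1) hbd
  have n3 : ‖m3.toLp _‖ ≤ D * n := by
    refine le_trans (Lp.norm_le_mul_norm_of_ae_le_mul (g := (memLp_deriv_gauss hε).toLp _) ?_)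
      (mul_le_mul_of_nonneg_left (norm_deriv_gauss_le hε) hD)
    filter_upwards [hbd, m3.coeFn_toLp, (memLp_deriv_gauss hε).coeFn_toLp] with x e1 e2 e3
    rw [e2, e3]
    exact e1
  constructor
  · have e : (∫ x, f x * (b * prof q (b * x) * Real.exp (-ε * x ^ 2) +
          oddPrimitive (prof q) (b * x) * -(2 * ε * x * Real.exp (-ε * x ^ 2)))) -
        ∫ x, f x * (b * prof q (b * x)) =
        (∫ x, f x * (b * prof q (b * x) * (Real.exp (-ε * x ^ 2) - 1))) +
        ∫ x, f x * (oddPrimitive (prof q) (b * x) * -(2 * ε * x * Real.exp (-ε * x ^ 2))) := by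
      rw [sub_eq_iff_eq_add, ← integral_add, ← integral_add]
      · refine integral_congr_ae (Eventually.of_forall fun x => ?_)
        simp only
        ring
      · exact ((Lp.memLp f).integrable_mul m1).add ((Lp.memLp f).integrable_mul m3)
      · exact (Lp.memLp f).integrable_mul m0
      · exact (Lp.memLp f).integrable_mul m1
      · exact (Lp.memLp f).integrable_mul m3
    rw [e]
    refine (abs_add_le _ _).trans ((add_le_add (abs_integral_mul_le f m1.1 b1)
      (abs_integral_mul_le_norm f m3)).trans ?_)
    rw [← mul_add]
    refine mul_le_mul_of_nonneg_left ?_ (norm_nonneg _)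
    have : 0 ≤ (|M| * C * N + C * N) * n + (C * N + D) * ε := by positivity
    linarith
  · have e : (∫ x, f x * (x * prof q (b * x) * Real.exp (-ε * x ^ 2))) -
        ∫ x, f x * (x * prof q (b * x)) =
        ∫ x, f x * (x * prof q (b * x) * (Real.exp (-ε * x ^ 2) - 1)) := by
      rw [sub_eq_iff_eq_add, ← integral_add]
      · refine integral_congr_ae (Eventually.of_forall fun x => ?_)
        simp only
        ring
      · exact (Lp.memLp f).integrable_mul m2
      · exact (Lp.memLp f).integrable_mul m0'
    rw [e]
    refine (abs_integral_mul_le f m2.1 b2).trans (mul_le_mul_of_nonneg_left ?_ (norm_nonneg _))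
    have : 0 ≤ (|M| * C * N + C * N + D) * n + (|M| * C * N + D) * ε := by positivity
    linarith

/-- If the pairing with the odd primitive of the profile vanishes for all times, in the sense of
Gaussian summability, then so does its formal time derivative. -/
theorem IsTransported.stationary {q : ℝ} (hq : 0 < q) {I : Set ℝ} {U V : ℝ → L2}
    (hUV : IsTransported I U V) (hI : IsOpen I) (hc : I.OrdConnected) {b bd y yd : ℝ → ℝ}
    (hb : ∀ s ∈ I, HasDerivAt b (bd s) s) (hbd : ContinuousOn bd I)
    (hy : ∀ s ∈ I, HasDerivAt y (yd s) s) (hyd : ContinuousOn yd I) (hb0 : ∀ s ∈ I, 0 < b s)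
    (h0 : ∀ s ∈ I, Tendsto (fun ε : ℝ => ∫ x, trans (y s) (U s) x *
      (oddPrimitive (prof q) (b s * x) * Real.exp (-ε * x ^ 2))) (𝓝[>] 0) (𝓝 0))
    {t : ℝ} (ht : t ∈ I) :
    -(∫ x, trans (y t) (V t) x * (b t * prof q (b t * x)))
      - yd t * (∫ x, trans (y t) (U t) x * (b t * prof q (b t * x)))
      + bd t * (∫ x, trans (y t) (U t) x * (x * prof q (b t * x))) = 0 := by
  obtain ⟨MU, hMU, hU1⟩ := exists_eventually_norm_le hI hUV.1 ht
  obtain ⟨MV, hMV, hV1⟩ := exists_eventually_norm_le hI hUV.2.1 ht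
  obtain ⟨Mb, hMb, hb1⟩ := exists_eventually_norm_le hI
    (fun s hs => (hb s hs).continuousAt.continuousWithinAt) ht
  obtain ⟨My', hMy', hyd1⟩ := exists_eventually_norm_le hI hyd ht
  obtain ⟨Mb', hMb', hbd1⟩ := exists_eventually_norm_le hI hbd ht
  have hbt := hb0 t ht
  set a := min (b t / 2) 1 with ha
  have ha0 : 0 < a := lt_min (by positivity) one_pos
  have ha1 : a ≤ 1 := min_le_right _ _
  have hab : ∀ᶠ s in 𝓝 t, a ≤ b s := by
    have : a < b t := (min_le_left _ _).trans_lt (by linarith)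
    exact ((hb t ht).continuousAt.eventually (lt_mem_nhds this)).mono fun _ h => h.le
  obtain ⟨K, hK, hKb⟩ := exists_gauss_error_le hq (M := Mb) ha0 ha1
  obtain ⟨J, hJ, hJo, htJ⟩ := eventually_nhds_iff.1
    (hU1.and (hV1.and (hb1.and (hyd1.and (hbd1.and (hab.and (hI.mem_nhds ht)))))))
  set r : ℝ → ℝ := fun ε => ε + Real.sqrt (4 * Real.sqrt (Real.pi * ε)) with hr
  have hδ : Tendsto (fun ε => (MV + My' * MU + Mb' * MU) * (K * r ε)) (𝓝[>] 0) (𝓝 0) := by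
    have hcont : Continuous fun ε => (MV + My' * MU + Mb' * MU) * (K * r ε) := by
      simp only [hr]
      fun_prop
    have h1 := hcont.tendsto 0
    simp only [hr, mul_zero, Real.sqrt_zero, add_zero] at h1
    exact h1.mono_left nhdsWithin_le_nhds
  -- The cut off pairings tend to `0` at each time, and their time derivatives converge uniformly
  -- near `t` to the formal expression, which must then be the derivative of `0`.
  have key := hasDerivAt_of_uniform_bound (l := 𝓝[>] (0 : ℝ)) (f := fun _ => 0)
    (F := fun ε s => ∫ x, trans (y s) (U s) x *
      (oddPrimitive (prof q) (b s * x) * Real.exp (-ε * x ^ 2)))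
    (F' := fun ε s =>
      (-(∫ x, trans (y s) (V s) x * (b s * prof q (b s * x) * Real.exp (-ε * x ^ 2) +
          oddPrimitive (prof q) (b s * x) * -(2 * ε * x * Real.exp (-ε * x ^ 2))))
        - yd s * (∫ x, trans (y s) (U s) x * (b s * prof q (b s * x) * Real.exp (-ε * x ^ 2) +
          oddPrimitive (prof q) (b s * x) * -(2 * ε * x * Real.exp (-ε * x ^ 2))))
        + bd s * ∫ x, trans (y s) (U s) x * (x * prof q (b s * x) * Real.exp (-ε * x ^ 2))))
    (f' := fun s => -(∫ x, trans (y s) (V s) x * (b s * prof q (b s * x)))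
      - yd s * (∫ x, trans (y s) (U s) x * (b s * prof q (b s * x)))
      + bd s * (∫ x, trans (y s) (U s) x * (x * prof q (b s * x)))) hJo hδ ?_ ?_ ?_ htJ
  · exact key.unique (hasDerivAt_const t 0)
  · filter_upwards [self_mem_nhdsWithin] with ε hε s hs
    obtain ⟨q1, q2, q3, q4, q5, q6, q7⟩ := hJ s hs
    rw [Real.norm_eq_abs] at q3 q4 q5
    have hbM := (le_abs_self _).trans q3
    have e1 := (hKb (b s) q6 hbM ε hε (trans (y s) (V s))).1
    have e2 := (hKb (b s) q6 hbM ε hε (trans (y s) (U s))).1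
    have e3 := (hKb (b s) q6 hbM ε hε (trans (y s) (U s))).2
    rw [LinearIsometry.norm_map] at e1 e2 e3
    have hr0 : 0 ≤ K * r ε := by
      have hε : 0 < ε := hε
      simp only [hr]
      positivity
    generalize (∫ x, trans (y s) (V s) x * (b s * prof q (b s * x) * Real.exp (-ε * x ^ 2) +
          oddPrimitive (prof q) (b s * x) * -(2 * ε * x * Real.exp (-ε * x ^ 2)))) = A1 at *
    generalize (∫ x, trans (y s) (U s) x * (b s * prof q (b s * x) * Real.exp (-ε * x ^ 2) +
          oddPrimitive (prof q) (b s * x) * -(2 * ε * x * Real.exp (-ε * x ^ 2)))) = A2 at *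
    generalize (∫ x, trans (y s) (U s) x * (x * prof q (b s * x) * Real.exp (-ε * x ^ 2))) = A3 at *
    generalize (∫ x, trans (y s) (V s) x * (b s * prof q (b s * x))) = B1 at *
    generalize (∫ x, trans (y s) (U s) x * (b s * prof q (b s * x))) = B2 at *
    generalize (∫ x, trans (y s) (U s) x * (x * prof q (b s * x))) = B3 at *
    calc |-A1 - yd s * A2 + bd s * A3 - (-B1 - yd s * B2 + bd s * B3)|
        = |-(A1 - B1) + -(yd s * (A2 - B2)) + bd s * (A3 - B3)| := by ring_nf
      _ ≤ |A1 - B1| + |yd s| * |A2 - B2| + |bd s| * |A3 - B3| := by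
          refine (abs_add_le _ _).trans (add_le_add ((abs_add_le _ _).trans ?_) ?_)
          · rw [abs_neg, abs_neg, abs_mul]
          · rw [abs_mul]
      _ ≤ MV * (K * r ε) + My' * (MU * (K * r ε)) + Mb' * (MU * (K * r ε)) := by
          have e1' := e1.trans (mul_le_mul_of_nonneg_right q2 hr0)
          have e2' := e2.trans (mul_le_mul_of_nonneg_right q1 hr0)
          have e3' := e3.trans (mul_le_mul_of_nonneg_right q1 hr0)
          gcongr
      _ = _ := by ring
  · filter_upwards [self_mem_nhdsWithin] with ε hε s hs
    exact (isCutProfile_oddPrimitive_prof hq hε).hasDerivAt_integral hUV hI hc hb hbd hy hyd hb0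
      (hJ s hs).2.2.2.2.2.2
  · exact fun s hs => h0 s (hJ s hs).2.2.2.2.2.2

/-! ### Integrals of the profile -/

theorem integral_eq_zero_of_odd {f : ℝ → ℝ} (hf : ∀ x, f (-x) = -f x) : ∫ x, f x = 0 := by
  have h := integral_neg_eq_self f volume
  simp only [hf, integral_neg] at h
  linarith

/-- The squared `L²` norm of the normalised profile. -/
def profMass (q : ℝ) : ℝ := ∫ z, prof q z ^ 2

theorem integrable_prof_sq {q : ℝ} (hq : 0 < q) : Integrable fun z => prof q z ^ 2 := by
  simpa using (memLp_prof hq one_pos).integrable_sq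

theorem profMass_pos {q : ℝ} (hq : 0 < q) : 0 < profMass q :=
  integral_pos_of_integrable_nonneg_nonzero (x := 0) ((continuous_prof q).pow 2)
    (integrable_prof_sq hq) (fun _ => sq_nonneg _) (pow_pos (prof_pos q 0) 2).ne'

theorem integral_prof_mul_sq (q : ℝ) {b : ℝ} (hb : 0 < b) :
    ∫ x, prof q (b * x) ^ 2 = profMass q / b := by
  rw [Measure.integral_comp_mul_left (fun z => prof q z ^ 2) b, abs_of_pos (inv_pos.2 hb), smul_eq_mul,
    profMass, inv_mul_eq_div]

theorem memLp_dprof {q : ℝ} (hq : 0 < q) {b : ℝ} (hb : 0 < b) :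
    MemLp (fun x => dprof q (b * x)) 2 volume := by
  refine (memLp_prof hq hb).of_le_mul (c := q)
    ((continuous_dprof q).comp (continuous_const_mul b)).aestronglyMeasurable
    (Eventually.of_forall fun x => ?_)
  rw [Real.norm_eq_abs, Real.norm_of_nonneg (prof_pos _ _).le]
  exact abs_dprof_le hq.le _

theorem memLp_mul_dprof {q : ℝ} (hq : 0 < q) {b : ℝ} (hb : 0 < b) :
    MemLp (fun x => x * dprof q (b * x)) 2 volume := by
  refine (memLp_mul_prof hq hb).of_le_mul (c := q)
    (continuous_id.mul ((continuous_dprof q).comp (continuous_const_mul b))).aestronglyMeasurable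
    (Eventually.of_forall fun x => ?_)
  rw [norm_mul, norm_mul, Real.norm_eq_abs (dprof _ _), Real.norm_of_nonneg (prof_pos _ _).le,
    mul_left_comm]
  exact mul_le_mul_of_nonneg_left (abs_dprof_le hq.le _) (norm_nonneg _)

/-- Integrate the derivative of `x P(bx)²`, whose total integral is zero. -/
theorem integral_prof_mul_dprof {q : ℝ} (hq : 0 < q) {b : ℝ} (hb : 0 < b) :
    ∫ x, prof q (b * x) * (x * dprof q (b * x)) = -(profMass q / (2 * b ^ 2)) := by
  have i1 : Integrable fun x => prof q (b * x) ^ 2 := (memLp_prof hq hb).integrable_sq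
  have i2 : Integrable fun x => prof q (b * x) * (x * dprof q (b * x)) :=
    (memLp_prof hq hb).integrable_mul (memLp_mul_dprof hq hb)
  have i3 : Integrable fun x => x * prof q (b * x) * prof q (b * x) :=
    (memLp_mul_prof hq hb).integrable_mul (memLp_prof hq hb)
  have hd : ∀ x, HasDerivAt (fun x => x * prof q (b * x) * prof q (b * x))
      (prof q (b * x) ^ 2 + 2 * b * (prof q (b * x) * (x * dprof q (b * x)))) x := by
    intro x
    have d1 := (hasDerivAt_prof q (b * x)).comp x ((hasDerivAt_id x).const_mul b)
    refine (((hasDerivAt_id x).mul d1).mul d1).congr_deriv ?_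
    simp only [id, Function.comp_apply, Pi.mul_apply]
    ring
  have h := integral_eq_zero_of_hasDerivAt_of_integrable hd (i1.add (i2.const_mul (2 * b))) i3
  rw [integral_add i1 (i2.const_mul (2 * b)), integral_const_mul, integral_prof_mul_sq q hb] at h
  field_simp at h ⊢
  linarith

theorem oddPrimitive_comp_mul (q A : ℝ) {b : ℝ} (hb : b ≠ 0) (x : ℝ) :
    oddPrimitive (fun x => A * prof q (b * x)) x = A / b * oddPrimitive (prof q) (b * x) := by
  rw [oddPrimitive, oddPrimitive, intervalIntegral.integral_const_mul,
    intervalIntegral.integral_comp_mul_left (fun s => prof q s) hb, mul_zero, smul_eq_mul]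
  ring

theorem oddPrimitive_prof_neg (q x : ℝ) :
    oddPrimitive (prof q) (-x) = -oddPrimitive (prof q) x := by
  have h := intervalIntegral.integral_comp_neg (a := 0) (b := x) (prof q)
  simp only [prof_neg, neg_zero] at h
  rw [oddPrimitive, oddPrimitive, h]
  exact intervalIntegral.integral_symm _ _

/-! ### The modulation equations and the momentum expansion -/

section Modulation

variable {p : ℝ} {φ : ℝ → ℝ → ℝ} {I : Set ℝ} {w : ℝ → EnergySpace} {y l : ℝ → ℝ}
  {η : ℝ → EnergySpace}

theorem IsModulation.trans_uPart (hp : 0 < p)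
    (hφ : ∀ c ∈ Ioo (-1 : ℝ) 1, IsGroundState p c (φ c)) (h : IsModulation φ I w y l η) {s : ℝ}
    (hs : s ∈ I) : trans (y s) (uPart (w s)) =ᵐ[volume] fun x =>
      ampl p * freq p (l s) ^ (2 / p) * prof (2 / p) (freq p (l s) * x) + uPart (η s) x := by
  filter_upwards [coeFn_trans (y s) (uPart (w s)), (h.remainder s hs).1] with x h1 h2
  have h2 : uPart (η s) x = uPart (w s) (x + y s) - φ (l s) x := h2
  rw [h1, h2, (hφ _ (h.speed_mem s hs)).eq_prof hp (h.speed_mem s hs)]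
  ring

theorem IsModulation.trans_vPart (hp : 0 < p)
    (hφ : ∀ c ∈ Ioo (-1 : ℝ) 1, IsGroundState p c (φ c)) (h : IsModulation φ I w y l η) {s : ℝ}
    (hs : s ∈ I) : trans (y s) (vPart (w s)) =ᵐ[volume] fun x =>
      -l s * (ampl p * freq p (l s) ^ (2 / p) * prof (2 / p) (freq p (l s) * x)) +
        vPart (η s) x := by
  filter_upwards [coeFn_trans (y s) (vPart (w s)), (h.remainder s hs).2] with x h1 h2
  have h2 : vPart (η s) x = vPart (w s) (x + y s) - -(l s) * φ (l s) x := h2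
  rw [h1, h2, (hφ _ (h.speed_mem s hs)).eq_prof hp (h.speed_mem s hs)]
  ring

theorem integral_mul_of_ae_eq {f g : L2} {A : ℝ} {P k : ℝ → ℝ} (hP : MemLp P 2 volume)
    (hk : MemLp k 2 volume) (h : f =ᵐ[volume] fun x => A * P x + g x) :
    ∫ x, f x * k x = A * (∫ x, P x * k x) + ∫ x, g x * k x := by
  have i1 : Integrable fun x => A * (P x * k x) := (hP.integrable_mul hk).const_mul A
  have i2 : Integrable fun x => g x * k x := (Lp.memLp g).integrable_mul hk
  rw [← integral_const_mul, ← integral_add i1 i2]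
  refine integral_congr_ae ?_
  filter_upwards [h] with x hx
  rw [hx]
  ring

theorem IsModulation.integral_uPart (hp : 0 < p)
    (hφ : ∀ c ∈ Ioo (-1 : ℝ) 1, IsGroundState p c (φ c)) (h : IsModulation φ I w y l η) {s : ℝ}
    (hs : s ∈ I) {k : ℝ → ℝ} (hk : MemLp k 2 volume) :
    ∫ x, trans (y s) (uPart (w s)) x * k x = ampl p * freq p (l s) ^ (2 / p) *
      (∫ x, prof (2 / p) (freq p (l s) * x) * k x) + ∫ x, uPart (η s) x * k x :=
  integral_mul_of_ae_eq (memLp_prof (by positivity) (freq_pos hp (h.speed_mem s hs))) hk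
    (h.trans_uPart hp hφ hs)

theorem IsModulation.integral_vPart (hp : 0 < p)
    (hφ : ∀ c ∈ Ioo (-1 : ℝ) 1, IsGroundState p c (φ c)) (h : IsModulation φ I w y l η) {s : ℝ}
    (hs : s ∈ I) {k : ℝ → ℝ} (hk : MemLp k 2 volume) :
    ∫ x, trans (y s) (vPart (w s)) x * k x = -l s * (ampl p * freq p (l s) ^ (2 / p)) *
      (∫ x, prof (2 / p) (freq p (l s) * x) * k x) + ∫ x, vPart (η s) x * k x := by
  refine integral_mul_of_ae_eq (memLp_prof (by positivity) (freq_pos hp (h.speed_mem s hs))) hk ?_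
  filter_upwards [h.trans_vPart hp hφ hs] with x hx
  rw [hx]
  ring

theorem IsModulation.integral_mul_prof (hp : 0 < p)
    (hφ : ∀ c ∈ Ioo (-1 : ℝ) 1, IsGroundState p c (φ c)) (h : IsModulation φ I w y l η) {s : ℝ}
    (hs : s ∈ I) : ∫ x, uPart (η s) x * prof (2 / p) (freq p (l s) * x) = 0 := by
  have hb := freq_pos hp (h.speed_mem s hs)
  have hA : ampl p * freq p (l s) ^ (2 / p) ≠ 0 :=
    (mul_pos (ampl_pos hp) (Real.rpow_pos_of_pos hb _)).ne'
  have h1 := (h.orthogonal s hs).1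
  have h2 : ∫ x, uComp (η s) x * φ (l s) x = ampl p * freq p (l s) ^ (2 / p) *
      ∫ x, uPart (η s) x * prof (2 / p) (freq p (l s) * x) := by
    rw [← integral_const_mul]
    refine integral_congr_ae (Eventually.of_forall fun x => ?_)
    simp only
    rw [(hφ _ (h.speed_mem s hs)).eq_prof hp (h.speed_mem s hs)]
    change uPart (η s) x * _ = _
    ring
  rw [h2] at h1
  exact (mul_eq_zero.1 h1).resolve_left hA

/-- The ground state is even and the cut off primitive odd, so it contributes nothing for any `ε`.
For the remainder the improper orthogonality condition is summed by Abel's theorem. -/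
theorem IsModulation.tendsto_gauss (hp : 0 < p)
    (hφ : ∀ c ∈ Ioo (-1 : ℝ) 1, IsGroundState p c (φ c)) (h : IsModulation φ I w y l η) {s : ℝ}
    (hs : s ∈ I) : Tendsto (fun ε : ℝ => ∫ x, trans (y s) (uPart (w s)) x *
      (oddPrimitive (prof (2 / p)) (freq p (l s) * x) * Real.exp (-ε * x ^ 2))) (𝓝[>] 0) (𝓝 0) := by
  have hq : 0 < 2 / p := by positivity
  have hb := freq_pos hp (h.speed_mem s hs)
  set b := freq p (l s) with hbdef
  set G := oddPrimitive (prof (2 / p)) with hG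
  have hA : ampl p * b ^ (2 / p) ≠ 0 := (mul_pos (ampl_pos hp) (Real.rpow_pos_of_pos hb _)).ne'
  have hGc : Continuous G := (isCutProfile_oddPrimitive_prof hq one_pos).continuous_profile
  have hGb : Continuous fun x => G (b * x) := hGc.comp (continuous_const_mul b)
  obtain ⟨D, hD, hGD⟩ := exists_oddPrimitive_prof_le hq
  have hm : MemLp (fun x => uPart (η s) x * G (b * x)) 2 volume := by
    refine (Lp.memLp (uPart (η s))).of_le_mul (c := D)
      ((Lp.aestronglyMeasurable _).mul hGb.aestronglyMeasurable) (Eventually.of_forall fun x => ?_)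
    rw [norm_mul, mul_comm]
    exact mul_le_mul_of_nonneg_right (hGD _) (norm_nonneg _)
  have ht : Tendsto (fun R : ℝ => ∫ x in (-R)..R, uPart (η s) x * G (b * x)) atTop (𝓝 0) := by
    have h1 := (h.orthogonal s hs).2.const_mul ((ampl p * b ^ (2 / p) / b)⁻¹)
    rw [mul_zero] at h1
    refine h1.congr fun R => ?_
    rw [← intervalIntegral.integral_const_mul]
    refine intervalIntegral.integral_congr fun x _ => ?_
    rw [funext fun x => (hφ _ (h.speed_mem s hs)).eq_prof hp (h.speed_mem s hs) x,
      oddPrimitive_comp_mul _ _ hb.ne']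
    change _ * (uPart (η s) x * _) = _
    have : ampl p * b ^ (2 / p) / b ≠ 0 := div_ne_zero hA hb.ne'
    rw [mul_left_comm, inv_mul_cancel_left₀ this]
  refine (tendsto_integral_mul_gauss hm ht).congr' ?_
  filter_upwards [self_mem_nhdsWithin] with ε hε
  obtain ⟨C, hC⟩ := (isCutProfile_oddPrimitive_prof hq hε).mul_le b hb
  have hk : MemLp (fun x => G (b * x) * Real.exp (-ε * x ^ 2)) 2 volume :=
    memLp_of_abs_le_weight (by fun_prop : Continuous fun x =>
      G (b * x) * Real.exp (-ε * x ^ 2)).aestronglyMeasurable hC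
  have e0 : ∫ x, prof (2 / p) (freq p (l s) * x) * (G (b * x) * Real.exp (-ε * x ^ 2)) = 0 :=
    integral_eq_zero_of_odd fun x => by
      rw [mul_neg, prof_neg, hG, oddPrimitive_prof_neg, neg_sq]
      ring
  rw [h.integral_uPart hp hφ hs hk, e0, mul_zero, zero_add]
  simp only [mul_assoc]

theorem hasDerivAt_freq {l' : ℝ} {s : ℝ} (hl : HasDerivAt l l' s) (hs : l s ∈ Ioo (-1 : ℝ) 1)
    (hp : 0 < p) :
    HasDerivAt (fun r => freq p (l r)) (-(p ^ 2 / 4) * l s * l' / freq p (l s)) s := by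
  have h1 := ((hl.fun_pow 2).const_sub 1).sqrt (one_sub_sq_pos hs).ne' |>.const_mul (p / 2)
  refine h1.congr_deriv ?_
  have := Real.sqrt_pos.2 (one_sub_sq_pos hs)
  simp only [freq]
  field_simp
  norm_num
  ring

/-- The modulation equations. -/
theorem IsModulation.equations (hp : 0 < p)
    (hφ : ∀ c ∈ Ioo (-1 : ℝ) 1, IsGroundState p c (φ c)) (h : IsModulation φ I w y l η)
    (hI : IsOpen I) (hc : I.OrdConnected) (hw : IsSolution p I w) {t : ℝ} (ht : t ∈ I) :
    ∃ bd : ℝ, freq p (l t) * bd = -(p ^ 2 / 4) * l t * deriv l t ∧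
      bd * ((∫ x, uPart (η t) x * (x * dprof (2 / p) (freq p (l t) * x))) -
          ampl p * profMass (2 / p) * (2 / p - 1 / 2) * (freq p (l t) ^ (2 / p) / freq p (l t) ^ 2)) =
        freq p (l t) * ((∫ x, vPart (η t) x * dprof (2 / p) (freq p (l t) * x)) +
          deriv y t * ∫ x, uPart (η t) x * dprof (2 / p) (freq p (l t) * x)) ∧
      (deriv y t - l t) * (ampl p * freq p (l t) ^ (2 / p) * profMass (2 / p)) =
        -freq p (l t) * (∫ x, vPart (η t) x * prof (2 / p) (freq p (l t) * x)) +
          bd * ∫ x, uPart (η t) x * (x * prof (2 / p) (freq p (l t) * x)) := by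
  have hq : 0 < 2 / p := by positivity
  set q := 2 / p with hqdef
  have hld : ∀ s ∈ I, HasDerivAt l (deriv l s) s := fun s hs =>
    ((h.contDiffOn_l.differentiableOn (by norm_num)).differentiableAt (hI.mem_nhds hs)).hasDerivAt
  have hyd : ∀ s ∈ I, HasDerivAt y (deriv y s) s := fun s hs =>
    ((h.contDiffOn_y.differentiableOn (by norm_num)).differentiableAt (hI.mem_nhds hs)).hasDerivAt
  have hlc : ContinuousOn (deriv l) I := h.contDiffOn_l.continuousOn_deriv_of_isOpen hI (by norm_num)
  have hyc : ContinuousOn (deriv y) I := h.contDiffOn_y.continuousOn_deriv_of_isOpen hI (by norm_num)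
  set b : ℝ → ℝ := fun s => freq p (l s) with hb
  set bd : ℝ → ℝ := fun s => -(p ^ 2 / 4) * l s * deriv l s / b s with hbd
  have hb0 : ∀ s ∈ I, 0 < b s := fun s hs => freq_pos hp (h.speed_mem s hs)
  have hbder : ∀ s ∈ I, HasDerivAt b (bd s) s := fun s hs =>
    hasDerivAt_freq (hld s hs) (h.speed_mem s hs) hp
  have hbc : ContinuousOn bd I :=
    ((continuousOn_const.mul h.contDiffOn_l.continuousOn).mul hlc).div
      (fun s hs => (hbder s hs).continuousAt.continuousWithinAt) fun s hs => (hb0 s hs).ne'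
  have hbt := hb0 t ht
  refine ⟨bd t, ?_, ?_, ?_⟩
  · simp only [hbd]
    exact mul_div_cancel₀ _ hbt.ne'
  · have h1 := (isCutProfile_prof hq).hasDerivAt_integral hw.isTransported hI hc hbder hbc hyd hyc
      hb0 ht
    simp only [mul_one, mul_zero, add_zero] at h1
    -- Orthogonality evaluates this pairing in closed form at every time; comparing the derivative
    -- of the closed form with the one given by the equation yields the relation for `b'`.
    have e : ∀ s ∈ I, ampl p * profMass q * b s ^ (q - 1) =
        ∫ x, trans (y s) (uPart (w s)) x * prof q (b s * x) := by
      intro s hs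
      have e1 : ∫ x, prof (2 / p) (freq p (l s) * x) * prof q (b s * x) = profMass q / b s := by
        rw [← integral_prof_mul_sq q (hb0 s hs)]
        simp only [sq]
        rfl
      rw [h.integral_uPart hp hφ hs (memLp_prof hq (hb0 s hs)), h.integral_mul_prof hp hφ hs,
        add_zero, e1, Real.rpow_sub_one (hb0 s hs).ne']
      change _ = ampl p * b s ^ q * (profMass q / b s)
      ring
    have h2 := (((hbder t ht).rpow_const (p := q - 1) (Or.inl hbt.ne')).const_mul
      (ampl p * profMass q)).congr_of_eventuallyEq
      (f₁ := fun s => ∫ x, trans (y s) (uPart (w s)) x * prof q (b s * x))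
      ((hI.eventually_mem ht).mono fun s hs => (e s hs).symm)
    have h3 := h1.unique h2
    have m1 := memLp_dprof hq hbt
    rw [h.integral_uPart hp hφ ht (m1.const_mul (b t)),
      h.integral_vPart hp hφ ht (m1.const_mul (b t)),
      h.integral_uPart hp hφ ht (memLp_mul_dprof hq hbt), integral_prof_mul_dprof hq hbt,
      integral_eq_zero_of_odd (f := fun x => prof (2 / p) (freq p (l t) * x) * _) (fun x => by
        rw [mul_neg, prof_neg, dprof_neg]; ring),
      show q - 1 - 1 = q - (2 : ℕ) by push_cast; ring, Real.rpow_sub_natCast hbt.ne'] at h3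
    simp only [mul_left_comm _ (b t), integral_const_mul] at h3
    change bd t * (_ - ampl p * profMass q * (q - 1 / 2) * (b t ^ q / b t ^ 2)) = b t * _
    change _ + bd t * (ampl p * b t ^ q * -(profMass q / (2 * b t ^ 2)) + _) = _ at h3
    -- The ground state's share of the dilation term: combined with the exponent `q - 1` of the
    -- closed form, it produces the coefficient `q - 1/2`.
    have e3 : ampl p * b t ^ q * -(profMass q / (2 * b t ^ 2)) =
      -(ampl p * profMass q * (b t ^ q / b t ^ 2) / 2) := by
      field_simp
    rw [e3] at h3
    linear_combination h3
  · have h1 := hw.isTransported.stationary hq hI hc hbder hbc hyd hyc hb0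
      (fun s hs => h.tendsto_gauss hp hφ hs) ht
    have m1 := memLp_prof hq hbt
    rw [h.integral_uPart hp hφ ht (m1.const_mul (b t)),
      h.integral_vPart hp hφ ht (m1.const_mul (b t)),
      h.integral_uPart hp hφ ht (memLp_mul_prof hq hbt),
      integral_eq_zero_of_odd (f := fun x => prof (2 / p) (freq p (l t) * x) *
        (x * prof q (b t * x))) (fun x => by
        rw [mul_neg, prof_neg]; ring)] at h1
    simp only [mul_left_comm _ (b t), integral_const_mul] at h1
    have e1 : ∫ x, prof (2 / p) (freq p (l t) * x) * prof q (b t * x) = profMass q / b t := by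
      rw [← integral_prof_mul_sq q hbt]
      simp only [sq]
      rfl
    rw [e1, h.integral_mul_prof hp hφ ht] at h1
    have e2 : b t * (profMass q / b t) = profMass q := mul_div_cancel₀ _ hbt.ne'
    change (deriv y t - l t) * (ampl p * b t ^ q * profMass q) = -b t * _ + bd t * _
    change -(b t * (-l t * (ampl p * b t ^ q) * _) + _) - deriv y t *
      (b t * (ampl p * b t ^ q * _) + _) + bd t * (ampl p * b t ^ q * 0 + _) = 0 at h1
    linear_combination -h1 - (deriv y t - l t) * ampl p * b t ^ q * e2

/-- Expand in the frame centred at `y`. The cross term of the ground state with the first component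
of `η` vanishes by orthogonality, so a single linear term survives. -/
theorem IsModulation.momentum_eq (hp : 0 < p)
    (hφ : ∀ c ∈ Ioo (-1 : ℝ) 1, IsGroundState p c (φ c)) (h : IsModulation φ I w y l η) {t : ℝ}
    (ht : t ∈ I) : momentum (uComp (w t)) (vComp (w t)) =
      -l t * ((ampl p * freq p (l t) ^ (2 / p)) ^ 2 * (profMass (2 / p) / freq p (l t))) +
        ampl p * freq p (l t) ^ (2 / p) *
          (∫ x, vPart (η t) x * prof (2 / p) (freq p (l t) * x)) +
        ⟪uPart (η t), vPart (η t)⟫ := by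
  have hq : 0 < 2 / p := by positivity
  have hb := freq_pos hp (h.speed_mem t ht)
  have m1 := memLp_prof hq hb
  rw [momentum_eq_inner, ← (trans (y t)).inner_map_map, inner_eq_integral,
    h.integral_uPart hp hφ ht (Lp.memLp _)]
  have e1 : ∫ x, prof (2 / p) (freq p (l t) * x) * trans (y t) (vPart (w t)) x =
      -l t * (ampl p * freq p (l t) ^ (2 / p)) * (profMass (2 / p) / freq p (l t)) +
        ∫ x, vPart (η t) x * prof (2 / p) (freq p (l t) * x) := by
    simp only [mul_comm (prof _ _)]
    rw [h.integral_vPart hp hφ ht m1, ← integral_prof_mul_sq _ hb]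
    simp only [sq]
  have e2 : ∫ x, uPart (η t) x * trans (y t) (vPart (w t)) x = ⟪uPart (η t), vPart (η t)⟫ := by
    simp only [mul_comm (uPart (η t) _)]
    rw [integral_mul_of_ae_eq m1 (Lp.memLp (uPart (η t)))
      (A := -l t * (ampl p * freq p (l t) ^ (2 / p))) (g := vPart (η t)) (by
        filter_upwards [h.trans_vPart hp hφ ht] with x hx
        rw [hx]
        ring)]
    simp only [mul_comm (prof _ _)]
    rw [h.integral_mul_prof hp hφ ht, mul_zero, zero_add, real_inner_comm, inner_eq_integral]
  rw [e1, e2]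
  ring

end Modulation

/-! ### Estimates for the modulation system -/

theorem exists_pairing_le {q : ℝ} (hq : 0 < q) {a : ℝ} (ha : 0 < a) (ha1 : a ≤ 1) :
    ∃ C, 0 < C ∧ ∀ b, a ≤ b → ∀ f : L2,
      |∫ x, f x * prof q (b * x)| ≤ C * ‖f‖ ∧ |∫ x, f x * (x * prof q (b * x))| ≤ C * ‖f‖ ∧
      |∫ x, f x * dprof q (b * x)| ≤ C * ‖f‖ ∧ |∫ x, f x * (x * dprof q (b * x))| ≤ C * ‖f‖ := by
  obtain ⟨C, hC, h⟩ := exists_prof_mul_le hq ha ha1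
  set N := ‖memLp_weight.toLp weight‖ with hN
  have hN0 : 0 ≤ N := norm_nonneg _
  refine ⟨(1 + q) * C * N + 1, by positivity, fun b hab f => ?_⟩
  have hb : 0 < b := ha.trans_le hab
  have k1 : ∀ x, prof q (b * x) ≤ C * weight x := fun x =>
    (h b hab x).trans (mul_le_mul_of_nonneg_left (weight_pow_le x) hC.le)
  have k2 : ∀ x, |x| * prof q (b * x) ≤ C * weight x := fun x =>
    calc |x| * prof q (b * x) ≤ |x| * (C * weight x ^ 3) := by
          gcongr
          exact h b hab x
      _ = C * (|x| * weight x ^ 3) := by ring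
      _ ≤ _ := mul_le_mul_of_nonneg_left (abs_mul_weight_pow_le x) hC.le
  have k3 : ∀ x, |dprof q (b * x)| ≤ q * prof q (b * x) := fun x => abs_dprof_le hq.le _
  have key : ∀ {g : ℝ → ℝ}, MemLp g 2 volume → (∀ x, |g x| ≤ ((1 + q) * C) * weight x) →
      |∫ x, f x * g x| ≤ ((1 + q) * C * N + 1) * ‖f‖ := fun hg hb => by
    refine (abs_integral_mul_le f hg.1 hb).trans ?_
    have := norm_nonneg f
    nlinarith
  have hw := fun x => (weight_pos x).le
  refine ⟨key (memLp_prof hq hb) fun x => ?_, key (memLp_mul_prof hq hb) fun x => ?_,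
    key (memLp_dprof hq hb) fun x => ?_, key (memLp_mul_dprof hq hb) fun x => ?_⟩
  · rw [abs_of_pos (prof_pos _ _)]
    have : 0 ≤ q * C * weight x := by have := hw x; positivity
    linarith [k1 x]
  · rw [abs_mul, abs_of_pos (prof_pos _ _)]
    have : 0 ≤ q * C * weight x := by have := hw x; positivity
    linarith [k2 x]
  · have := hw x
    have : 0 ≤ C * weight x := by positivity
    nlinarith [k3 x, k1 x]
  · rw [abs_mul]
    have := hw x
    have : 0 ≤ C * weight x := by positivity
    nlinarith [mul_le_mul_of_nonneg_left (k3 x) (abs_nonneg x), k2 x]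

/-- The two equations are coupled. The second bounds `yd` by `1 + O((1 + |bd|)E)`; inserted in the
first, this leaves a multiple of `|bd|` that the smallness of `E` absorbs into half of `d₀`. -/
theorem abs_le_of_modulation_system {bd d R b X Y yd c Z W m E C b₂ d₀ m₀ : ℝ}
    (h1 : bd * (R - d) = b * (X + yd * Y)) (h2 : (yd - c) * m = -b * Z + bd * W)
    (hR : |R| ≤ C * E) (hX : |X| ≤ C * E) (hY : |Y| ≤ C * E) (hZ : |Z| ≤ C * E) (hW : |W| ≤ C * E)
    (hd₀ : 0 < d₀) (hd : d₀ ≤ d) (hm₀ : 0 < m₀) (hm : m₀ ≤ m) (hb : 0 < b) (hb₂ : b ≤ b₂)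
    (hc : |c| ≤ 1) (hC : 0 < C) (hE : 0 ≤ E) (hE1 : E ≤ 1)
    (hsmall : (C + b₂ * C * C / m₀) * E ≤ d₀ / 2) :
    |bd| ≤ 2 / d₀ * (b₂ * C * (2 + b₂ * C / m₀)) * E := by
  set β := |bd| with hβ
  have hβ0 : 0 ≤ β := abs_nonneg _
  have hb20 : 0 < b₂ := hb.trans_le hb₂
  have s1 : |yd - c| * m₀ ≤ b₂ * (C * E) + β * (C * E) := by
    calc |yd - c| * m₀ ≤ |yd - c| * m := by gcongr
      _ = |(yd - c) * m| := by rw [abs_mul, abs_of_pos (hm₀.trans_le hm)]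
      _ = |-b * Z + bd * W| := by rw [h2]
      _ ≤ b * |Z| + β * |W| := by
          refine (abs_add_le _ _).trans_eq ?_
          rw [abs_mul, abs_mul, abs_neg, abs_of_pos hb]
      _ ≤ _ := by gcongr
  have s2 : |yd| ≤ 1 + (b₂ * (C * E) + β * (C * E)) / m₀ := by
    have t1 : |yd - c| ≤ (b₂ * (C * E) + β * (C * E)) / m₀ := (le_div_iff₀ hm₀).2 s1
    have t2 : |yd| ≤ |yd - c| + |c| := by
      have := abs_add_le (yd - c) c
      rwa [sub_add_cancel] at this
    linarith
  have s3 : β * (d₀ - C * E) ≤ b₂ * (C * E + |yd| * (C * E)) := by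
    have t1 : d₀ - C * E ≤ |R - d| := by
      have := (abs_le.1 hR).2
      linarith [neg_abs_le (R - d)]
    calc β * (d₀ - C * E) ≤ β * |R - d| := by gcongr
      _ = |b * (X + yd * Y)| := by rw [← h1, abs_mul]
      _ ≤ b * (|X| + |yd| * |Y|) := by
          rw [abs_mul, abs_of_pos hb, ← abs_mul yd Y]
          gcongr
          exact abs_add_le _ _
      _ ≤ _ := by gcongr
  have s4 : b₂ * (C * E + |yd| * (C * E)) ≤
      b₂ * C * (2 + b₂ * C / m₀) * E + β * (b₂ * C * C / m₀ * E) := by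
    calc b₂ * (C * E + |yd| * (C * E))
        ≤ b₂ * (C * E + (1 + (b₂ * (C * E) + β * (C * E)) / m₀) * (C * E)) := by gcongr
      _ = b₂ * C * (2 + b₂ * C / m₀ * E) * E + β * (b₂ * C * C / m₀ * E) * E := by
          field_simp
          ring
      _ ≤ b₂ * C * (2 + b₂ * C / m₀ * 1) * E + β * (b₂ * C * C / m₀ * E) * 1 := by gcongr
      _ = _ := by ring
  have s5 : β * d₀ ≤ b₂ * C * (2 + b₂ * C / m₀) * E + β * (d₀ / 2) := by
    have := mul_le_mul_of_nonneg_left hsmall hβ0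
    nlinarith
  have s6 : β * (d₀ / 2) ≤ b₂ * C * (2 + b₂ * C / m₀) * E := by linarith
  have s7 : β ≤ b₂ * C * (2 + b₂ * C / m₀) * E / (d₀ / 2) := (le_div_iff₀ (by positivity)).2 s6
  refine s7.trans_eq ?_
  field_simp

/-- Here `-c A²σ/b` is the momentum of the ground state, and `m`, that of the reference wave, drops
out. The `Z` of the momentum enters with weight `b/(Aσ)`, exactly opposite to the `Z` of the
equation for `D`. -/
theorem modulation_speed_identity {A σ b D Z W bd P c m : ℝ} (hA : 0 < A) (hσ : 0 < σ) (hb : 0 < b)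
    (h : D * (A * σ) = -b * Z + bd * W) :
    D - ((A ^ 2 * (σ / b))⁻¹ * (-c * (A ^ 2 * (σ / b)) - m) -
        (A ^ 2 * (σ / b))⁻¹ * (-c * (A ^ 2 * (σ / b)) + A * Z + P - m)) =
      (A ^ 2 * (σ / b))⁻¹ * (P + A / b * (bd * W)) := by
  have hN : A ^ 2 * (σ / b) ≠ 0 := by positivity
  have e : A ^ 2 * (σ / b) * D = -A * Z + A / b * (bd * W) := by
    have e1 : A ^ 2 * (σ / b) * D = A / b * (D * (A * σ)) := by ring
    rw [e1, h]
    field_simp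
  have e2 : D = (A ^ 2 * (σ / b))⁻¹ * (A ^ 2 * (σ / b) * D) := (inv_mul_cancel_left₀ hN _).symm
  rw [e2, e]
  ring

theorem abs_inv_mul_add_le {N n₀ P F E W bd f₀ C₁ C₂ : ℝ} (hn₀ : 0 < n₀) (hN : n₀ ≤ N)
    (hF : 0 ≤ F) (hF₀ : F ≤ f₀) (hC₂ : 0 ≤ C₂) (hE : 0 ≤ E) (hP : |P| ≤ E ^ 2)
    (hbd : |bd| ≤ C₂ * E) (hW : |W| ≤ C₁ * E) :
    |N⁻¹ * (P + F * (bd * W))| ≤ n₀⁻¹ * (1 + f₀ * C₂ * C₁) * E ^ 2 := by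
  have h1 : |P + F * (bd * W)| ≤ (1 + f₀ * C₂ * C₁) * E ^ 2 :=
    calc |P + F * (bd * W)| ≤ |P| + F * (|bd| * |W|) := by
          refine (abs_add_le _ _).trans_eq ?_
          rw [abs_mul, abs_mul, abs_of_nonneg hF]
      _ ≤ E ^ 2 + f₀ * ((C₂ * E) * (C₁ * E)) := by
          have := hF.trans hF₀
          gcongr
      _ = _ := by ring
  rw [abs_mul, abs_of_pos (inv_pos.2 (hn₀.trans_le hN)), mul_assoc]
  gcongr

theorem lpNorm_sq_eq {f : ℝ → ℝ} (hf : MemLp f 2 volume) :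
    lpNorm f 2 volume ^ 2 = ∫ x, f x ^ 2 := by
  rw [← norm_toLp_sq hf, Lp.norm_toLp, toReal_eLpNorm hf.1]

theorem momentum_neg_mul (c : ℝ) (f : ℝ → ℝ) :
    momentum f (fun x => -c * f x) = -c * ∫ x, f x ^ 2 := by
  rw [momentum, ← integral_const_mul]
  refine integral_congr_ae (Eventually.of_forall fun x => ?_)
  simp only
  ring

theorem IsGroundState.integral_sq {p c : ℝ} {φ : ℝ → ℝ} (hp : 0 < p) (hc : c ∈ Ioo (-1 : ℝ) 1)
    (h : IsGroundState p c φ) :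
    ∫ x, φ x ^ 2 = (ampl p * freq p c ^ (2 / p)) ^ 2 * (profMass (2 / p) / freq p c) := by
  rw [← integral_prof_mul_sq _ (freq_pos hp hc), ← integral_const_mul]
  refine integral_congr_ae (Eventually.of_forall fun x => ?_)
  simp only
  rw [h.eq_prof hp hc]
  ring

theorem freq_le {p c : ℝ} (hp : 0 < p) : freq p c ≤ p / 2 := by
  have : Real.sqrt (1 - c ^ 2) ≤ 1 := Real.sqrt_le_one.2 (by nlinarith [sq_nonneg c])
  exact mul_le_of_le_one_right (by positivity) this

theorem freq_anti {p c d : ℝ} (hp : 0 < p) (hcd : |c| ≤ |d|) : freq p d ≤ freq p c := by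
  unfold freq
  have := sq_le_sq.2 hcd
  gcongr

end Boussinesq

end

/-! ### Choice of constants and conclusion -/

open Boussinesq in
theorem mainTheorem3 (p : ℝ) (hp : 0 < p) (hp4 : p < 4) (ω : ℝ) (hω : |ω| = Real.sqrt (p / 4))
    (φ : ℝ → ℝ → ℝ)
    (hφ : ∀ c ∈ Set.Ioo (-1 : ℝ) 1, Boussinesq.IsGroundState p c (φ c)) :
    ∃ C : ℝ, 0 < C ∧ ∀ K : ℝ, 0 < K → ∃ ε₀ : ℝ, 0 < ε₀ ∧
      ∀ ε ∈ Set.Ioo (0 : ℝ) ε₀,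
      ∀ (I : Set ℝ), IsOpen I → I.OrdConnected → (0 : ℝ) ∈ I →
      ∀ (w : ℝ → Boussinesq.EnergySpace), Boussinesq.IsSolution p I w →
        (∀ t ∈ I, w t ∈ Boussinesq.orbitNhd ω (φ ω) ε) →
      ∀ (y l : ℝ → ℝ) (η : ℝ → Boussinesq.EnergySpace),
        Boussinesq.IsModulation φ I w y l η →
        (∀ t ∈ I, ‖η t‖ + |l t - ω| ≤ K * ε) →
      ∀ t ∈ I,
        |(deriv y t - l t) -
            ((MeasureTheory.lpNorm (φ (l t)) 2 MeasureTheory.volume ^ 2)⁻¹ *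
                (Boussinesq.momentum (φ (l t)) (fun x => -(l t) * φ (l t) x)
                  - Boussinesq.momentum (φ ω) (fun x => -ω * φ ω x))
              - (MeasureTheory.lpNorm (φ (l t)) 2 MeasureTheory.volume ^ 2)⁻¹ *
                (Boussinesq.momentum (Boussinesq.uComp (w 0)) (Boussinesq.vComp (w 0))
                  - Boussinesq.momentum (φ ω) (fun x => -ω * φ ω x)))|
          ≤ C * (‖η t‖ ^ 2 + |l t - ω| * ‖η t‖) ∧
        |deriv l t| ≤ C * ‖η t‖ := by
  have hω0 : 0 < |ω| := by rw [hω]; exact Real.sqrt_pos.2 (by positivity)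
  have hω1 : |ω| < 1 := by
    rw [hω, Real.sqrt_lt' one_pos]
    linarith
  have hq : 0 < 2 / p := by positivity
  -- Nondegeneracy of the equation for `b'`; this is the condition `p < 4`.
  have hq2 : 0 < 2 / p - 1 / 2 := by
    rw [sub_pos, div_lt_div_iff₀ (by norm_num) hp]
    linarith
  set q := 2 / p with hqdef
  -- Speeds with `|λ| ≤ ρ < 1` have frequency in `[b₀, b₂]`, so all constants below are uniform in
  -- `λ` and independent of `K`.
  set ρ := (1 + |ω|) / 2 with hρ
  have hρ0 : 0 < ρ := by positivity
  have hρmem : ρ ∈ Ioo (-1 : ℝ) 1 := ⟨by linarith, by linarith⟩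
  set b₀ := freq p ρ with hb₀
  have hb₀pos : 0 < b₀ := freq_pos hp hρmem
  set b₂ := p / 2 with hb₂
  have hb₂pos : 0 < b₂ := by positivity
  have hκ := ampl_pos hp
  have hσ := profMass_pos hq
  set κ := ampl p
  set σ := profMass q
  obtain ⟨C₁, hC₁, hpair⟩ := exists_pairing_le hq (lt_min hb₀pos one_pos) (min_le_right b₀ 1)
  -- `d₀`, `m₀` and `n₀` bound from below, for `b` in `[b₀, b₂]`, the coefficient of `b'`, that of
  -- `y' - λ`, and `‖φ_λ‖²`.
  set d₀ := κ * σ * (q - 1 / 2) * (b₀ ^ q / b₂ ^ 2) with hd₀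
  have hd₀pos : 0 < d₀ := by positivity
  set m₀ := κ * b₀ ^ q * σ with hm₀
  have hm₀pos : 0 < m₀ := by positivity
  set n₀ := (κ * b₀ ^ q) ^ 2 * (σ / b₂) with hn₀
  have hn₀pos : 0 < n₀ := by positivity
  set C₂ := 2 / d₀ * (b₂ * C₁ * (2 + b₂ * C₁ / m₀)) with hC₂
  have hC₂pos : 0 < C₂ := by positivity
  set C₃ := n₀⁻¹ * (1 + κ * b₂ ^ q / b₀ * C₂ * C₁) with hC₃
  have hC₃pos : 0 < C₃ := by positivity
  set C₄ := b₂ * C₂ / (p ^ 2 / 4 * (|ω| / 2)) with hC₄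
  have hC₄pos : 0 < C₄ := by positivity
  -- The four bounds keep `|λ| ≤ ρ`, keep `|λ| ≥ |ω|/2`, give `‖η‖ ≤ 1`, and allow the absorption in
  -- the coupled system.
  set δ := min (min ((1 - |ω|) / 2) (|ω| / 2)) (min 1 (d₀ / 2 / (C₁ + b₂ * C₁ * C₁ / m₀))) with hδ
  have hδpos : 0 < δ :=
    lt_min (lt_min (by linarith) (by positivity)) (lt_min one_pos (by positivity))
  refine ⟨C₃ + C₄, by positivity, fun K hK => ⟨δ / K, by positivity, ?_⟩⟩
  intro ε hε I hI hc h0 w hw _ y l η hmod hbound t ht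
  have hsmall : ‖η t‖ + |l t - ω| ≤ δ := by
    refine (hbound t ht).trans ?_
    have := (lt_div_iff₀ hK).1 hε.2
    linarith
  set E := ‖η t‖ with hE
  have hE0 : 0 ≤ E := norm_nonneg _
  have hlω0 : 0 ≤ |l t - ω| := abs_nonneg _
  have hδ1 : δ ≤ (1 - |ω|) / 2 := (min_le_left _ _).trans (min_le_left _ _)
  have hδ2 : δ ≤ |ω| / 2 := (min_le_left _ _).trans (min_le_right _ _)
  have hδ3 : δ ≤ 1 := (min_le_right _ _).trans (min_le_left _ _)
  have hδ4 : δ ≤ d₀ / 2 / (C₁ + b₂ * C₁ * C₁ / m₀) := (min_le_right _ _).trans (min_le_right _ _)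
  have hlt := hmod.speed_mem t ht
  have hl1 : |l t| ≤ |ρ| := by
    rw [abs_of_pos hρ0]
    have := abs_add_le (l t - ω) ω
    rw [sub_add_cancel] at this
    linarith
  have hl2 : |ω| / 2 ≤ |l t| := by
    have := abs_sub_abs_le_abs_sub ω (l t)
    rw [abs_sub_comm] at this
    linarith
  have hbge : b₀ ≤ freq p (l t) := freq_anti hp hl1
  have hble : freq p (l t) ≤ b₂ := freq_le hp
  have hgs := hφ _ hlt
  obtain ⟨bd, eb, e1, e2⟩ := hmod.equations hp hφ hI hc hw ht
  have eM := hmod.momentum_eq hp hφ ht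
  rw [hw.momentum_eq hp hI hc h0 ht] at eM
  rw [lpNorm_sq_eq hgs.memLp, momentum_neg_mul, hgs.integral_sq hp hlt, eM]
  have hbpos := freq_pos hp hlt
  have hbmin : min b₀ 1 ≤ freq p (l t) := (min_le_left _ _).trans hbge
  set b := freq p (l t) with hb
  have hU : ‖uPart (η t)‖ ≤ E := norm_uPart_le _
  have hV : ‖vPart (η t)‖ ≤ E := norm_vPart_le _
  obtain ⟨-, u2, u3, u4⟩ := hpair b hbmin (uPart (η t))
  obtain ⟨v1, -, v3, -⟩ := hpair b hbmin (vPart (η t))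
  have hCU : C₁ * ‖uPart (η t)‖ ≤ C₁ * E := by gcongr
  have hCV : C₁ * ‖vPart (η t)‖ ≤ C₁ * E := by gcongr
  have hP : |inner ℝ (uPart (η t)) (vPart (η t))| ≤ E ^ 2 := by
    refine (abs_real_inner_le_norm _ _).trans ?_
    rw [sq]
    gcongr
  have hbq1 : b₀ ^ q ≤ b ^ q := Real.rpow_le_rpow hb₀pos.le hbge hq.le
  have hbq2 : b ^ q ≤ b₂ ^ q := Real.rpow_le_rpow hbpos.le hble hq.le
  have hbd : |bd| ≤ C₂ * E := by
    refine abs_le_of_modulation_system e1 e2 (u4.trans hCU) (v3.trans hCV) (u3.trans hCU)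
      (v1.trans hCV) (u2.trans hCU) hd₀pos ?_ hm₀pos ?_ hbpos hble (abs_le.2 ⟨hlt.1.le, hlt.2.le⟩)
      hC₁ hE0 (by linarith) ?_
    · simp only [hd₀]
      gcongr
    · simp only [hm₀]
      gcongr
    · have : E ≤ d₀ / 2 / (C₁ + b₂ * C₁ * C₁ / m₀) := by linarith
      rw [mul_comm]
      exact (le_div_iff₀ (by positivity)).1 this
  have hA : 0 < κ * b ^ q := by positivity
  constructor
  · rw [modulation_speed_identity hA hσ hbpos e2]
    refine (abs_inv_mul_add_le hn₀pos ?_ (by positivity) (f₀ := κ * b₂ ^ q / b₀) ?_ hC₂pos.le hE0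
      hP hbd (u2.trans hCU)).trans ?_
    · simp only [hn₀]
      gcongr
    · gcongr
    -- The bound obtained is purely quadratic in `‖η‖`; the mixed term is nonnegative and is simply
    -- added.
    · refine mul_le_mul (by linarith) ?_ (sq_nonneg E) (by positivity)
      exact le_add_of_nonneg_right (by positivity)
  -- `b b' = -(p²/4) λ λ'` is solved for `λ'`, using `|λ| ≥ |ω|/2`.
  · have e5 : |deriv l t| * (p ^ 2 / 4 * (|ω| / 2)) ≤ b₂ * C₂ * E := by
      calc |deriv l t| * (p ^ 2 / 4 * (|ω| / 2)) ≤ |deriv l t| * (p ^ 2 / 4 * |l t|) := by gcongr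
        _ = |-(p ^ 2 / 4) * l t * deriv l t| := by
            rw [abs_mul, abs_mul, abs_neg, abs_of_pos (by positivity : 0 < p ^ 2 / 4)]
            ring
        _ = b * |bd| := by rw [← eb, abs_mul, abs_of_pos hbpos]
        _ ≤ b₂ * (C₂ * E) := by gcongr
        _ = _ := by ring
    have e6 : |deriv l t| ≤ C₄ * E := by
      rw [hC₄, div_mul_eq_mul_div]
      exact (le_div_iff₀ (by positivity)).2 e5
    exact e6.trans (mul_le_mul_of_nonneg_right (by linarith) hE0)
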